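/- Notation: for a non-zero polynomial $P\in\mathbb{Z}[T]$, let the height $H(P)$ be the maximum of the absolute values of its coefficients divided by the greatest common divisor of its coefficients; for $j\ge 0$ let $P^{[j]}=\frac{1}{j!}\frac{d^jP}{dT^j}$ be its $j$-th divided derivative; and call a polynomial of $\mathbb{Z}[T]$ primary if it is a (positive) power of an irreducible element of the ring $\mathbb{Z}[T]$. The symbols $i,j,n$ denote integers. Proposition 9.4. Let $\xi$ be a non-zero complex number which is not a root of unity, and let $\beta,\epsilon,\mu,\sigma,\tau,\nu\in\mathbb{R}$ with $$0<\mu<\sigma,\quad 0\le\tau\le 1-\sigma,\quad \beta>\max\{1+\sigma-\mu,\,2\mu+\tau\},$$ $$0<2\epsilon<\min\{\mu,\,\sigma-\mu\}\quad\text{and}\quad \nu>1+\beta+\sigma-2\mu-\tau+2\epsilon.$$ Suppose that, for each sufficiently large positive integer $n$, there exists a non-zero polynomial $P=P_n\in\mathbb{Z}[T]$ with $\deg(P)\le n$ and $H(P)\le\exp(n^\beta)$ satisfying $$\max\bigl\{|P^{[j]}(\xi^i)| : 1\le i\le n^\sigma,\ 0\le j<n^\tau\bigr\}<\exp(-n^\nu).$$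 Then, for each sufficiently large $n$, there exists an integer $D$ with $1\le D\le 2n^3$ satisfying the following property. For any set $I$ of cardinality $|I|\ge n^{\mu-\epsilon}$ consisting of integers $i$ coprime to $D$ in the range $1\le i\le n^\mu$, there exists a primary polynomial $S\in\mathbb{Z}[T]$ satisfying $$\deg(S)\le n^{1-(\sigma-\mu)-\tau+3\epsilon},\quad \log H(S)\le n^{\beta-2(\sigma-\mu)-\tau+3\epsilon},\quad \prod_{i\in I}|S(\xi^i)|\le\exp\bigl(-n^{\nu+\mu-\tau-2\epsilon}\bigr).$$ -/

import Mathlib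

open Polynomial Filter

/-- The (homogeneous, absolute) height of a polynomial with integer coefficients: the maximum of
the absolute values of its coefficients, divided by the (positive) greatest common divisor of its
coefficients. -/
noncomputable def polyHeight (P : ℤ[X]) : ℝ :=
  P.supNorm / (P.content : ℝ)

/-- A polynomial with integer coefficients is primary if it is a positive power of an irreducible
element of the ring `ℤ[X]`. -/
def IsPrimaryPoly (S : ℤ[X]) : Prop :=
  ∃ R : ℤ[X], Irreducible R ∧ ∃ k : ℕ, 0 < k ∧ S = R ^ k

/-!
Write `x_i = ξ ^ i`. The polynomials `P^{[j]}(T ^ p)`, for primes `p ≤ n ^ (σ - μ)` and `j` up to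
about `n ^ τ / 2`, have small Taylor coefficients at all the points `x_i` with `i ≤ n ^ μ`. The proof
extracts the power `S` of an irreducible polynomial from their greatest common divisor `Q`.

*The common divisor is small.* If integer polynomials `F_f = Q E_f` have small Taylor coefficients at
some points, and if the `E_f` generate the unit ideal of `ℚ[T]`, then a basis of a space of
polynomials of bounded degree can be chosen among the `T ^ a E_f`. Its determinant is a nonzero
integer, and computing it in terms of Taylor coefficients at the points bounds the product of the
values of `Q` and of the differences of the points (`prod_eval_gcd_le`, `prod_norm_aeval_gcd_le`).

*Roots of unity.* At most one root of unity `ρ` of order at most `2 n ^ 3` is very close to `ξ`;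
its order is the integer `D` (which is `1` if there is no such `ρ`). As `i` is prime to `D`, only
`Φ_D` can be small at `x_i` among the cyclotomic polynomials of small order. The same
determinant, applied to `P` and to a large power of `Φ_m`, shows that `ρ` cannot be too close to
`ξ` (`eventually_exp_neg_le_norm_sub`): otherwise, at the level where the distance becomes
comparable to the smallness of `P`, their common divisor, a power of `Φ_m` of degree at most `n`,
would be too small. So the factors of `Q` with torsion roots can be discarded
(`eventually_exists_small_factors`).

*Few factors.* Let `R` be another irreducible factor of `Q`, of multiplicity `k`, with a root `α`.
For most primes `p` one has `ℚ(α ^ p) = ℚ(α)` (`two_pow_card_not_isGoodPrime_le`), the minimal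
polynomial of `α ^ p` has the degree of `R` and at least the `p`-th power of its Mahler measure
(`intMahler_pow_le`), and it divides `P` to the order `k + t - 1`
(`pow_dvd_of_pow_dvd_hasseDeriv_comp`). A given irreducible polynomial `V` arises in this way for few
pairs `(R, p)`, because a root of `V` which is a `p`-th power in its own field for many `p` would be
a `∏ p`-th power there, of too small a Mahler measure by a lower bound of Dobrowolski type
(`two_le_intMahler_pow`). Hence the degrees and the heights of the factors `R`, weighted by
`k + t - 1` and by the number of primes, are bounded by those of `P`
(`sum_natDegree_and_log_intMahler_le`).

By the pigeonhole principle some `R` is small at the points `x_i` in proportion to its degree and its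
height (`exists_le_exp_of_prod_pow_le`), and `S` is a suitable power of it (`exists_pow_of_small`).
-/

/-! ### A determinant with small entries -/

/-- Values of linear functionals on polynomials of degree `< D`, expanded in the monomial basis. -/
lemma matrix_functional_eq_mul {K T : Type*} [Field K] [Fintype T] {D : ℕ}
    (idx : T ≃ Fin D) (Φ : T → K[X] →ₗ[K] K) (U : T → K[X]) (hU : ∀ b, (U b).degree < D) :
    (Matrix.of fun r b => Φ r (U b)) =
      (Matrix.of fun r c => Φ r (X ^ (idx c : ℕ))) *
        (Matrix.of fun c b => (U b).coeff (idx c)) := by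
  ext r b
  rw [Matrix.mul_apply]
  simp only [Matrix.of_apply]
  have h1 : U b = ∑ c : T, (U b).coeff (idx c) • (X ^ (idx c : ℕ) : K[X]) := by
    rw [Equiv.sum_comp idx (fun j : Fin D => (U b).coeff j • (X ^ (j : ℕ) : K[X])),
      Fin.sum_univ_eq_sum_range (fun j => (U b).coeff j • (X ^ j : K[X])) D]
    conv_lhs => rw [(U b).as_sum_range' D (by
      by_cases h0 : U b = 0
      · have := hU b
        simp only [h0, natDegree_zero]
        rcases Nat.eq_zero_or_pos D with hD | hD
        · exact absurd (idx b).2 (by simp [hD])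
        · exact hD
      · exact (natDegree_lt_iff_degree_lt h0).2 (hU b))]
    simp [smul_X_eq_monomial]
  conv_lhs => rw [h1]
  simp [map_sum, mul_comm]

/-- If the columns of a complex matrix are bounded row by row, so is its determinant. -/
lemma norm_det_le_factorial_mul_prod {T : Type*} [Fintype T] [DecidableEq T]
    (A : Matrix T T ℂ) (h : T → ℝ) (hA : ∀ r c, ‖A r c‖ ≤ h r) :
    ‖A.det‖ ≤ (Fintype.card T).factorial * ∏ r, h r := by
  rw [Matrix.det_apply]
  refine (norm_sum_le _ _).trans ?_
  have : ∀ σ ∈ (Finset.univ : Finset (Equiv.Perm T)),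
      ‖Equiv.Perm.sign σ • ∏ i, A (σ i) i‖ ≤ ∏ r, h r := by
    intro σ _
    have h1 : ‖Equiv.Perm.sign σ • ∏ i, A (σ i) i‖ = ∏ i, ‖A (σ i) i‖ := by
      rcases Int.units_eq_one_or (Equiv.Perm.sign σ) with h | h <;> simp [h]
    rw [h1, ← Equiv.prod_comp σ h]
    exact Finset.prod_le_prod (fun _ _ => norm_nonneg _) (fun i _ => hA _ _)
  refine (Finset.sum_le_card_nsmul _ _ _ this).trans ?_
  simp [Fintype.card_perm]

/-- The Newton basis polynomial of index `r` for the points `x₀, …, x_{a-1}`, each repeated `s`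
times: it is monic of degree `r`, the product of `X - x` over the first `r` nodes. -/
noncomputable def newtonPoly {a : ℕ} (s : ℕ) (x : Fin a → ℂ) (r : Fin (a * s)) : ℂ[X] :=
  (∏ i ∈ Finset.univ.filter (· < r.divNat), (X - C (x i)) ^ s) *
    (X - C (x r.divNat)) ^ (r.modNat : ℕ)

lemma newtonPoly_monic {a : ℕ} (s : ℕ) (x : Fin a → ℂ) (r : Fin (a * s)) :
    (newtonPoly s x r).Monic := by
  unfold newtonPoly
  exact (monic_prod_of_monic _ _ fun i _ => (monic_X_sub_C _).pow s).mul ((monic_X_sub_C _).pow _)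

lemma newtonPoly_natDegree {a : ℕ} (s : ℕ) (x : Fin a → ℂ) (r : Fin (a * s)) :
    (newtonPoly s x r).natDegree = r := by
  unfold newtonPoly
  rw [Monic.natDegree_mul (monic_prod_of_monic _ _ fun i _ => (monic_X_sub_C _).pow s)
    ((monic_X_sub_C _).pow _), natDegree_prod_of_monic _ _ fun i _ => (monic_X_sub_C _).pow s]
  simp only [natDegree_pow, natDegree_X_sub_C, mul_one, Finset.sum_const, smul_eq_mul]
  have : (Finset.univ.filter (· < r.divNat)).card = (r.divNat : ℕ) := by
    rw [Finset.filter_gt_eq_Iio, Fin.card_Iio]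
  rw [this, Fin.coe_divNat, Fin.coe_modNat, Nat.div_add_mod']

/-- The Newton polynomials are triangular with respect to Taylor coefficients at the nodes. -/
lemma coeff_taylor_mul_newtonPoly_of_lt {a s : ℕ} (x : Fin a → ℂ) (q : ℂ[X])
    {r c : Fin (a * s)} (h : r < c) :
    (taylor (x r.divNat) (q * newtonPoly s x c)).coeff r.modNat = 0 := by
  have hlt : (r : ℕ) < c := h
  have hs : 0 < s := Nat.pos_of_ne_zero (by rintro rfl; simpa using r.2)
  have hdvd : ∀ k : ℕ, (r.modNat : ℕ) < k → (X - C (x r.divNat)) ^ k ∣ q * newtonPoly s x c →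
      (taylor (x r.divNat) (q * newtonPoly s x c)).coeff r.modNat = 0 := by
    rintro k hk ⟨g, hg⟩
    rw [hg, taylor_mul, taylor_pow, map_sub, taylor_X, taylor_C, add_sub_cancel_right,
      coeff_X_pow_mul', if_neg (by omega)]
  rcases lt_or_ge r.divNat c.divNat with h1 | h1
  · refine hdvd s (by rw [Fin.coe_modNat]; exact Nat.mod_lt _ hs) (Dvd.dvd.mul_left ?_ q)
    unfold newtonPoly
    exact Dvd.dvd.mul_right (Finset.dvd_prod_of_mem (fun i => (X - C (x i)) ^ s)
      (by simpa using h1)) _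
  · have h2 : r.divNat = c.divNat := by
      refine le_antisymm ?_ h1
      rw [Fin.le_def, Fin.coe_divNat, Fin.coe_divNat]
      exact Nat.div_le_div_right hlt.le
    refine hdvd c.modNat ?_ (Dvd.dvd.mul_left ?_ q)
    · have h3 : (r : ℕ) / s = (c : ℕ) / s := by
        simpa [Fin.ext_iff] using h2
      have h4 := Nat.div_add_mod (r : ℕ) s
      have h5 := Nat.div_add_mod (c : ℕ) s
      rw [Fin.coe_modNat, Fin.coe_modNat]
      rw [h3] at h4
      omega
    · unfold newtonPoly
      rw [h2]
      exact Dvd.intro_left _ rfl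

lemma coeff_taylor_mul_newtonPoly_self {a s : ℕ} (x : Fin a → ℂ) (q : ℂ[X]) (r : Fin (a * s)) :
    (taylor (x r.divNat) (q * newtonPoly s x r)).coeff r.modNat =
      q.eval (x r.divNat) *
        ∏ i ∈ Finset.univ.filter (· < r.divNat), (x r.divNat - x i) ^ s := by
  unfold newtonPoly
  rw [← mul_assoc, taylor_mul, taylor_pow, map_sub, taylor_X, taylor_C, add_sub_cancel_right,
    coeff_mul_X_pow', if_pos le_rfl, Nat.sub_self, taylor_coeff_zero, eval_mul, eval_prod]
  simp

lemma prod_fin_mul {a s : ℕ} (f : Fin a → ℝ) :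
    ∏ r : Fin (a * s), f r.divNat = ∏ i, f i ^ s := by
  rw [← Equiv.prod_comp finProdFinEquiv, Fintype.prod_prod_type]
  refine Finset.prod_congr rfl fun i _ => ?_
  have : ∀ l : Fin s, (finProdFinEquiv (i, l)).divNat = i := fun l =>
    congrArg Prod.fst (finProdFinEquiv.symm_apply_apply (i, l))
  simp [this]

/-- The product of the values `|q(x_i)|^s` and of the distances `|x_i - x_j|^{s²}` is bounded by
a determinant formed with Taylor coefficients of the products `q U_b` and coefficients of the
`U_b`, for every family of integer polynomials `U_b` forming a basis of the polynomials of degree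
`< as + e` over `ℚ`. -/
theorem prod_eval_mul_prod_sub_le_of_basis {a s e : ℕ} (x : Fin a → ℂ) (q : ℂ[X])
    (U : Fin (a * s + e) → ℤ[X]) (hU : ∀ b, (U b).degree < (a * s + e : ℕ))
    (hli : LinearIndependent ℚ fun b => (U b).map (Int.castRingHom ℚ))
    {η H : ℝ}
    (hη : ∀ b i, ∀ l < s, ‖(taylor (x i) (q * (U b).map (Int.castRingHom ℂ))).coeff l‖ ≤ η)
    (hH : ∀ b j, |((U b).coeff j : ℝ)| ≤ H) :
    ∏ i, (‖q.eval (x i)‖ * ∏ j ∈ Finset.univ.filter (· < i), ‖x i - x j‖ ^ s) ^ s ≤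
      (a * s + e).factorial * (η ^ (a * s) * H ^ e) := by
  classical
  set T := Fin (a * s) ⊕ Fin e
  let idx : T ≃ Fin (a * s + e) := finSumFinEquiv
  let Φ : T → ℂ[X] →ₗ[ℂ] ℂ := fun r => Sum.elim
    (fun r : Fin (a * s) => (lcoeff ℂ (r.modNat : ℕ)).comp
      ((taylor (x r.divNat)).comp (LinearMap.mulLeft ℂ q)))
    (fun j : Fin e => lcoeff ℂ (a * s + j)) r
  let B : T → ℂ[X] := fun c => Sum.elim (newtonPoly s x) (fun j : Fin e => X ^ (a * s + (j : ℕ))) c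
  let V : T → ℂ[X] := fun b => (U (idx b)).map (Int.castRingHom ℂ)
  have hBdeg : ∀ c, (B c).Monic ∧ (B c).natDegree = idx c := by
    rintro (r | j)
    · exact ⟨newtonPoly_monic s x r, newtonPoly_natDegree s x r⟩
    · exact ⟨monic_X_pow _, natDegree_X_pow _⟩
  have hBlt : ∀ c, (B c).degree < (a * s + e : ℕ) := by
    intro c
    rw [degree_eq_natDegree (hBdeg c).1.ne_zero, (hBdeg c).2]
    exact_mod_cast (idx c).2
  have hVlt : ∀ c, (V c).degree < (a * s + e : ℕ) := fun c => degree_map_le.trans_lt (hU _)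
  have e1 := matrix_functional_eq_mul idx Φ B hBlt
  have e2 := matrix_functional_eq_mul idx Φ V hVlt
  -- the change of basis to the Newton basis is unimodular
  have d1 : (Matrix.of fun c b => (B b).coeff (idx c)).det = 1 := by
    rw [← Matrix.det_reindex_self idx, Matrix.det_of_isUpperTriangular]
    · refine Finset.prod_eq_one fun k _ => ?_
      have := hBdeg (idx.symm k)
      simp only [Matrix.reindex_apply, Matrix.submatrix_apply, Matrix.of_apply]
      rw [← this.2]
      exact this.1
    · intro c b hcb
      simp only [Matrix.reindex_apply, Matrix.submatrix_apply, Matrix.of_apply]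
      refine coeff_eq_zero_of_natDegree_lt ?_
      rw [(hBdeg _).2]
      simpa using hcb
  -- the determinant of the integer coefficients is a nonzero integer
  have d2 : 1 ≤ ‖(Matrix.of fun c b => (V b).coeff (idx c)).det‖ := by
    let MZ : Matrix T T ℤ := Matrix.of fun c b => (U (idx b)).coeff (idx c)
    have hm : (Matrix.of fun c b => (V b).coeff (idx c)) = MZ.map (Int.castRingHom ℂ) := by
      ext c b; simp [MZ, V]
    have hdet : MZ.det ≠ 0 := by
      intro h0
      have h1 : (MZ.map (Int.castRingHom ℚ)).det = 0 := by
        rw [← RingHom.mapMatrix_apply, ← RingHom.map_det, h0, map_zero]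
      obtain ⟨v, hv, hv0⟩ := Matrix.exists_mulVec_eq_zero_iff.2 h1
      apply hv
      have h2 : ∑ b : T, v b • (U (idx b)).map (Int.castRingHom ℚ) = 0 := by
        ext k
        rw [finsetSum_coeff, coeff_zero]
        by_cases hk : k < a * s + e
        · have := congrFun hv0 (idx.symm ⟨k, hk⟩)
          simp only [Matrix.mulVec, dotProduct, Pi.zero_apply] at this
          rw [← this]
          refine Finset.sum_congr rfl fun b _ => ?_
          simp [MZ, mul_comm]
        · refine Finset.sum_eq_zero fun b _ => ?_
          rw [coeff_smul, coeff_map, coeff_eq_zero_of_degree_lt, map_zero, smul_zero]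
          exact (hU _).trans_le (by exact_mod_cast not_lt.1 hk)
      have h3 := hli.comp idx idx.injective
      rw [Fintype.linearIndependent_iff] at h3
      exact funext (h3 v h2)
    rw [hm, ← RingHom.mapMatrix_apply, ← RingHom.map_det]
    simp only [eq_intCast, Complex.norm_intCast]
    exact_mod_cast Int.one_le_abs hdet
  -- the functionals on the Newton basis
  have d3 : (Matrix.of fun r b => Φ r (B b)).det =
      ∏ r : Fin (a * s), (q.eval (x r.divNat) *
        ∏ i ∈ Finset.univ.filter (· < r.divNat), (x r.divNat - x i) ^ s) := by
    have hb : (Matrix.of fun r b => Φ r (B b)) = Matrix.fromBlocks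
        (Matrix.of fun r c : Fin (a * s) =>
          (taylor (x r.divNat) (q * newtonPoly s x c)).coeff r.modNat)
        (Matrix.of fun (r : Fin (a * s)) (c : Fin e) => Φ (Sum.inl r) (B (Sum.inr c))) 0 1 := by
      ext (r | r) (c | c)
      · simp [Φ, B]
      · simp
      · simp only [Matrix.of_apply, Matrix.fromBlocks_apply₂₁, Matrix.zero_apply, Φ, B,
          Sum.elim_inr, Sum.elim_inl, lcoeff_apply]
        refine coeff_eq_zero_of_natDegree_lt ?_
        rw [newtonPoly_natDegree]
        have := c.2
        omega
      · simp [Φ, B, coeff_X_pow, Matrix.one_apply, Fin.ext_iff]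
    rw [hb, Matrix.det_fromBlocks_zero₂₁, Matrix.det_one, mul_one,
      Matrix.det_of_isLowerTriangular]
    · exact Finset.prod_congr rfl fun r _ => coeff_taylor_mul_newtonPoly_self x q r
    · intro r c hrc
      exact coeff_taylor_mul_newtonPoly_of_lt x q (by simpa using hrc)
  have key : ‖(Matrix.of fun r b => Φ r (B b)).det‖ ≤ ‖(Matrix.of fun r b => Φ r (V b)).det‖ := by
    rw [e1, e2, Matrix.det_mul, Matrix.det_mul, d1, mul_one, norm_mul]
    exact le_mul_of_one_le_right (norm_nonneg _) d2
  have lhs : ‖(Matrix.of fun r b => Φ r (B b)).det‖ =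
      ∏ i, (‖q.eval (x i)‖ * ∏ j ∈ Finset.univ.filter (· < i), ‖x i - x j‖ ^ s) ^ s := by
    rw [d3, norm_prod, ← prod_fin_mul
      (fun i => ‖q.eval (x i)‖ * ∏ j ∈ Finset.univ.filter (· < i), ‖x i - x j‖ ^ s)]
    simp [norm_prod, norm_pow]
  have rhs := norm_det_le_factorial_mul_prod (Matrix.of fun r b => Φ r (V b))
    (Sum.elim (fun _ => η) (fun _ => H)) (by
      rintro (r | j) b
      · have hs : 0 < s := Nat.pos_of_ne_zero (by rintro rfl; simpa using r.2)
        simpa [Φ, V] using hη (idx b) r.divNat r.modNat (by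
          rw [Fin.coe_modNat]; exact Nat.mod_lt _ hs)
      · simpa [Φ, V] using hH (idx b) (a * s + j))
  rw [← lhs]
  refine key.trans (rhs.trans (le_of_eq ?_))
  simp [T, Fintype.card_sum]

/-- If `E_f` generate the unit ideal of `ℚ[X]` and have degree at most `d`, then suitable
multiples `X ^ k * E_f` with `k < d` form a basis of the polynomials of degree `< D`, for some
`D` between `d` and `2 d`. -/
lemma exists_basis_of_bezout {ι : Type*} [Fintype ι] (E : ι → ℤ[X]) (V : ι → ℚ[X])
    (hV : ∑ f, V f * (E f).map (Int.castRingHom ℚ) = 1) {d : ℕ} (hd : ∀ f, (E f).natDegree ≤ d)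
    (f₀ : ι) (hf₀ : E f₀ ≠ 0) :
    ∃ g : Fin ((E f₀).natDegree + d) → ι × ℕ, (∀ b, (g b).2 < d) ∧
      (∀ b, (X ^ (g b).2 * E (g b).1).degree < (((E f₀).natDegree + d : ℕ) : WithBot ℕ)) ∧
      LinearIndependent ℚ fun b => (X ^ (g b).2 * E (g b).1).map (Int.castRingHom ℚ) := by
  classical
  set φ := Int.castRingHom ℚ
  set A := (E f₀).map φ with hA
  set D := (E f₀).natDegree + d with hD
  have hφ : Function.Injective φ := RingHom.injective_int φ
  have hA0 : A ≠ 0 := (Polynomial.map_ne_zero_iff hφ).2 hf₀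
  have hAdeg : A.natDegree = (E f₀).natDegree := natDegree_map_eq_of_injective hφ _
  have hEdeg : ∀ f, ((E f).map φ).natDegree ≤ d := fun f => natDegree_map_le.trans (hd f)
  let S : Set ℚ[X] := {w | ∃ p : ι × ℕ, p.2 < d ∧
    (X ^ p.2 * E p.1).degree < ((D : ℕ) : WithBot ℕ) ∧ w = (X ^ p.2 * E p.1).map φ}
  have hgen : ∀ (f : ι) (m : ℕ), m ≤ d → (E f).natDegree + m ≤ D → ∀ w : ℚ[X], w.degree < m →
      w * (E f).map φ ∈ Submodule.span ℚ S := by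
    intro f m hm hfm w hw
    rcases eq_or_ne (E f) 0 with h0 | h0
    · simp [h0]
    rcases eq_or_ne w 0 with hw0 | hw0
    · simp [hw0]
    rw [← natDegree_lt_iff_degree_lt hw0] at hw
    rw [w.as_sum_range' m hw, Finset.sum_mul]
    refine Submodule.sum_mem _ fun k hk => ?_
    rw [Finset.mem_range] at hk
    rw [← smul_X_eq_monomial, smul_mul_assoc]
    refine Submodule.smul_mem _ _ (Submodule.subset_span ⟨(f, k), by simp only; omega, ?_, by simp⟩)
    have : (X ^ k * E f) ≠ 0 := mul_ne_zero (pow_ne_zero _ X_ne_zero) h0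
    rw [← natDegree_lt_iff_degree_lt this, natDegree_mul (pow_ne_zero _ X_ne_zero) h0,
      natDegree_X_pow]
    omega
  have hspan : Submodule.span ℚ S = degreeLT ℚ D := by
    apply le_antisymm
    · rw [Submodule.span_le]
      rintro w ⟨p, -, hp, rfl⟩
      exact mem_degreeLT.2 (degree_map_le.trans_lt hp)
    · intro w hw
      rw [mem_degreeLT] at hw
      -- reduce the Bezout coefficients modulo `A`, the error being a multiple of `A`
      let W : ι → ℚ[X] := fun f => (w * V f) % A
      have hW : ∀ f, (W f).degree < A.natDegree := fun f => by
        rw [← degree_eq_natDegree hA0]; exact EuclideanDomain.mod_lt _ hA0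
      have hdvd : A ∣ w - ∑ f, W f * (E f).map φ := by
        have : w - ∑ f, W f * (E f).map φ = ∑ f, (w * V f - W f) * (E f).map φ := by
          have h1 : w = ∑ f, (w * V f) * (E f).map φ := by
            simp_rw [mul_assoc, ← Finset.mul_sum]
            rw [hV, mul_one]
          conv_lhs => rw [h1]
          rw [← Finset.sum_sub_distrib]
          simp_rw [sub_mul]
        rw [this]
        refine Finset.dvd_sum fun f _ => Dvd.dvd.mul_right ?_ _
        exact ⟨_, sub_eq_of_eq_add' (EuclideanDomain.mod_add_div _ A).symm⟩
      obtain ⟨u, hu⟩ := hdvd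
      have hw2 : w = u * A + ∑ f, W f * (E f).map φ := by
        rw [mul_comm u, ← hu]; ring
      have hAd : A.natDegree ≤ d := hEdeg f₀
      have hsumdeg : (w - ∑ f, W f * (E f).map φ).degree < ((D : ℕ) : WithBot ℕ) := by
        refine (degree_sub_le _ _).trans_lt (max_lt hw ?_)
        refine (degree_sum_le _ _).trans_lt ((Finset.sup_lt_iff ?_).2 fun f _ => ?_)
        · exact WithBot.bot_lt_coe _
        · by_cases h0 : W f * (E f).map φ = 0
          · rw [h0, degree_zero]; exact WithBot.bot_lt_coe _
          · rw [← natDegree_lt_iff_degree_lt h0]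
            have h1 := left_ne_zero_of_mul h0
            have h2 := (natDegree_lt_iff_degree_lt h1).2 (hW f)
            have h3 := natDegree_mul_le (p := W f) (q := (E f).map φ)
            have h4 := hEdeg f
            omega
      rw [hw2]
      refine Submodule.add_mem _ (hgen f₀ d le_rfl (by omega) u ?_)
        (Submodule.sum_mem _ fun f _ => hgen f A.natDegree hAd (by have := hd f; omega) _ (hW f))
      rw [hu] at hsumdeg
      by_cases hu0 : u = 0
      · rw [hu0, degree_zero]; exact WithBot.bot_lt_coe _
      · rw [← natDegree_lt_iff_degree_lt (mul_ne_zero hA0 hu0), natDegree_mul hA0 hu0] at hsumdeg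
        rw [← natDegree_lt_iff_degree_lt hu0]
        omega
  have hfr : Module.finrank ℚ (Submodule.span ℚ S) = D := by
    rw [hspan, (degreeLTEquiv ℚ D).finrank_eq, Module.finrank_fin_fun]
  have : Module.Finite ℚ (Submodule.span ℚ S) := by
    rw [hspan]; exact Module.Finite.equiv (degreeLTEquiv ℚ D).symm
  obtain ⟨v, hv, -, hli⟩ := Submodule.exists_fun_fin_finrank_span_eq ℚ S
  choose p hp1 hp2 hp3 using hv
  refine ⟨fun b => p (Fin.cast hfr.symm b), fun b => hp1 _, fun b => hp2 _, ?_⟩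
  have h1 := hli.comp (Fin.cast hfr.symm) (Fin.cast_injective _)
  have h2 : (fun b => (X ^ (p (Fin.cast hfr.symm b)).2 *
      E (p (Fin.cast hfr.symm b)).1).map φ) = v ∘ Fin.cast hfr.symm :=
    funext fun b => (hp3 _).symm
  rw [h2]
  exact h1

/-- **Small values force a small common divisor.** Let `F_f = Q E_f` be integer polynomials with
`E_f` generating the unit ideal of `ℚ[X]`. If all the `X ^ k * F_f` have small Taylor coefficients
of order `< s` at the points `x_i`, then the product of the `|Q(x_i)|^s` is small, up to the
discriminant of the points. -/
theorem prod_eval_gcd_le {ι : Type*} [Fintype ι] (E : ι → ℤ[X]) (V : ι → ℚ[X])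
    (hV : ∑ f, V f * (E f).map (Int.castRingHom ℚ) = 1) {d : ℕ} (hd : ∀ f, (E f).natDegree ≤ d)
    (f₀ : ι) (hf₀ : E f₀ ≠ 0) (q : ℂ[X]) {a s : ℕ} (has : a * s ≤ d) (x : Fin a → ℂ)
    {η H : ℝ} (hH1 : 1 ≤ H) (hη0 : 0 ≤ η)
    (hη : ∀ f i, ∀ k < d, ∀ l < s,
      ‖(taylor (x i) (X ^ k * (q * (E f).map (Int.castRingHom ℂ)))).coeff l‖ ≤ η)
    (hH : ∀ f j, |((E f).coeff j : ℝ)| ≤ H) :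
    ∏ i, (‖q.eval (x i)‖ * ∏ j ∈ Finset.univ.filter (· < i), ‖x i - x j‖ ^ s) ^ s ≤
      (2 * d).factorial * (η ^ (a * s) * H ^ (2 * d)) := by
  obtain ⟨g, hg1, hg2, hg3⟩ := exists_basis_of_bezout E V hV hd f₀ hf₀
  obtain ⟨e, he⟩ : ∃ e, (E f₀).natDegree + d = a * s + e := ⟨(E f₀).natDegree + d - a * s, by omega⟩
  have hd0 : (E f₀).natDegree + d ≤ 2 * d := by have := hd f₀; omega
  generalize (E f₀).natDegree + d = D at *
  subst he
  refine (prod_eval_mul_prod_sub_le_of_basis x q (fun b => X ^ (g b).2 * E (g b).1) hg2 hg3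
    (η := η) (H := H) ?_ ?_).trans ?_
  · intro b i l hl
    have := hη (g b).1 i (g b).2 (hg1 b) l hl
    convert this using 4
    simp only [Polynomial.map_mul, Polynomial.map_pow, map_X]
    ring
  · intro b j
    rw [coeff_X_pow_mul']
    split_ifs
    · exact hH _ _
    · simpa using zero_le_one.trans hH1
  · gcongr
    omega

/-! ### Mahler measures and common divisors of integer polynomials -/

/-- The Mahler measure of an integer polynomial. -/
noncomputable def intMahler (F : ℤ[X]) : ℝ := (F.map (Int.castRingHom ℂ)).mahlerMeasure

lemma intMahler_mul (F G : ℤ[X]) : intMahler (F * G) = intMahler F * intMahler G := by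
  simp [intMahler, Polynomial.map_mul, mahlerMeasure_mul]

lemma one_le_intMahler {F : ℤ[X]} (hF : F ≠ 0) : 1 ≤ intMahler F :=
  one_le_mahlerMeasure_of_ne_zero hF

lemma intMahler_one : intMahler 1 = 1 := by simp [intMahler]

lemma intMahler_pow (F : ℤ[X]) (k : ℕ) : intMahler (F ^ k) = intMahler F ^ k := by
  induction k with
  | zero => simp [intMahler_one]
  | succ k ih => rw [pow_succ, intMahler_mul, ih, pow_succ]

lemma intMahler_le_of_dvd {E F : ℤ[X]} (hF : F ≠ 0) (h : E ∣ F) : intMahler E ≤ intMahler F := by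
  obtain ⟨G, rfl⟩ := h
  rw [intMahler_mul]
  exact le_mul_of_one_le_right (mahlerMeasure_nonneg _) (one_le_intMahler (right_ne_zero_of_mul hF))

lemma abs_coeff_le_two_pow_mul_intMahler (E : ℤ[X]) (j : ℕ) :
    |(E.coeff j : ℝ)| ≤ 2 ^ E.natDegree * intMahler E := by
  have h1 := norm_coeff_le_choose_mul_mahlerMeasure j (E.map (Int.castRingHom ℂ))
  rw [coeff_map, eq_intCast, Complex.norm_intCast,
    natDegree_map_eq_of_injective (RingHom.injective_int _)] at h1
  refine h1.trans ?_
  unfold intMahler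
  gcongr
  · exact mahlerMeasure_nonneg _
  · exact_mod_cast Nat.choose_le_two_pow _ _

lemma abs_coeff_le_of_dvd {E F : ℤ[X]} (hF : F ≠ 0) (h : E ∣ F) (j : ℕ) :
    |(E.coeff j : ℝ)| ≤ 2 ^ F.natDegree * intMahler F := by
  refine (abs_coeff_le_two_pow_mul_intMahler E j).trans ?_
  have := natDegree_le_of_dvd h hF
  have h2 := intMahler_le_of_dvd hF h
  have := zero_le_one.trans (one_le_intMahler hF)
  have h3 : 0 ≤ intMahler E := mahlerMeasure_nonneg _
  gcongr
  norm_num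

lemma intMahler_le_of_abs_coeff_le {F : ℤ[X]} {d : ℕ} (hd : F.natDegree ≤ d) {B : ℝ}
    (hB : ∀ j, |(F.coeff j : ℝ)| ≤ B) : intMahler F ≤ (d + 1) * B := by
  have hB0 : 0 ≤ B := (abs_nonneg _).trans (hB 0)
  refine (mahlerMeasure_le_sum_norm_coeff _).trans ?_
  rw [Polynomial.sum_over_range _ (by simp)]
  refine (Finset.sum_le_card_nsmul _ _ B fun j _ => ?_).trans ?_
  · simpa using hB j
  · rw [Finset.card_range, nsmul_eq_mul, natDegree_map_eq_of_injective (RingHom.injective_int _)]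
    push_cast
    gcongr

/-- A finite family of integer polynomials has a primitive common divisor `Q` such that the
cofactors generate the unit ideal of `ℚ[X]`. -/
theorem exists_primitive_gcd {ι : Type*} [Fintype ι] (F : ι → ℤ[X]) (f₀ : ι) (hf₀ : F f₀ ≠ 0) :
    ∃ (Q : ℤ[X]) (E : ι → ℤ[X]) (V : ι → ℚ[X]), Q.IsPrimitive ∧ (∀ f, F f = Q * E f) ∧
      ∑ f, V f * (E f).map (Int.castRingHom ℚ) = 1 := by
  set φ := Int.castRingHom ℚ
  have hφ : Function.Injective φ := RingHom.injective_int φ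
  set I := Ideal.span (Set.range fun f => (F f).map φ)
  obtain ⟨g, hg⟩ := (inferInstance : I.IsPrincipal)
  have hg' : I = Ideal.span {g} := hg
  have hg0 : g ≠ 0 := by
    rintro rfl
    have : (F f₀).map φ ∈ I := Ideal.subset_span ⟨f₀, rfl⟩
    rw [hg', Ideal.mem_span_singleton, zero_dvd_iff, Polynomial.map_eq_zero_iff hφ] at this
    exact hf₀ this
  obtain ⟨b, hb, hbm⟩ := IsLocalization.integerNormalization_spec (nonZeroDivisors ℤ) g
  set G := IsLocalization.integerNormalization (nonZeroDivisors ℤ) g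
  have hb0 : (b : ℚ) ≠ 0 := by exact_mod_cast nonZeroDivisors.ne_zero hb
  have hGg : G.map φ = C (b : ℚ) * g := by
    rw [show G.map φ = b • g from hbm]
    ext k; simp
  have hG0 : G ≠ 0 := by
    intro h
    rw [h, Polynomial.map_zero] at hGg
    exact mul_ne_zero (C_ne_zero.2 hb0) hg0 hGg.symm
  have hc0 : (G.content : ℚ) ≠ 0 := by
    exact_mod_cast (content_eq_zero_iff.not.2 hG0)
  have hQ : G.map φ = C (G.content : ℚ) * G.primPart.map φ := by
    conv_lhs => rw [G.eq_C_content_mul_primPart]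
    simp [φ]
  have hQg : G.primPart.map φ = C ((b : ℚ) / G.content) * g := by
    have h1 := hQ.symm.trans hGg
    rw [div_eq_mul_inv, C_mul, mul_comm (C (b : ℚ)), mul_assoc, ← h1, ← mul_assoc, ← C_mul,
      inv_mul_cancel₀ hc0, C_1, one_mul]
  have hdvd : ∀ f, G.primPart ∣ F f := by
    intro f
    rw [IsPrimitive.Int.dvd_iff_map_cast_dvd_map_cast _ _ G.isPrimitive_primPart]
    have : (F f).map φ ∈ I := Ideal.subset_span ⟨f, rfl⟩
    rw [hg', Ideal.mem_span_singleton] at this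
    refine dvd_trans ?_ this
    change G.primPart.map φ ∣ g
    rw [hQg]
    exact ((isUnit_C.2 (div_ne_zero hb0 hc0).isUnit).mul_left_dvd).2 dvd_rfl
  choose E hE using hdvd
  have hgI : G.primPart.map φ ∈ I := by
    rw [hg', hQg]
    exact Ideal.mul_mem_left _ _ (Ideal.mem_span_singleton_self g)
  obtain ⟨V, hV⟩ := Ideal.mem_span_range_iff_exists_fun.1 hgI
  refine ⟨G.primPart, E, V, G.isPrimitive_primPart, hE, ?_⟩
  have hne : G.primPart.map φ ≠ 0 :=
    (Polynomial.map_ne_zero_iff hφ).2 G.isPrimitive_primPart.ne_zero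
  apply mul_left_cancel₀ hne
  rw [mul_one]
  conv_rhs => rw [← hV]
  rw [Finset.mul_sum]
  refine Finset.sum_congr rfl fun f _ => ?_
  rw [hE f, Polynomial.map_mul]
  ring

/-! ### Truncated norms of Taylor expansions -/

/-- The `ℓ¹`-norm of the coefficients of degree `< s`: a submultiplicative size for power series
truncated at order `s`. -/
noncomputable def truncNorm (s : ℕ) (g : ℂ[X]) : ℝ := ∑ l ∈ Finset.range s, ‖g.coeff l‖

lemma truncNorm_nonneg (s : ℕ) (g : ℂ[X]) : 0 ≤ truncNorm s g :=
  Finset.sum_nonneg fun _ _ => norm_nonneg _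

lemma norm_coeff_le_truncNorm {s l : ℕ} (h : l < s) (g : ℂ[X]) : ‖g.coeff l‖ ≤ truncNorm s g :=
  Finset.single_le_sum (f := fun l => ‖g.coeff l‖) (fun _ _ => norm_nonneg _)
    (Finset.mem_range.2 h)

lemma truncNorm_add_le (s : ℕ) (g h : ℂ[X]) : truncNorm s (g + h) ≤ truncNorm s g + truncNorm s h := by
  unfold truncNorm
  rw [← Finset.sum_add_distrib]
  exact Finset.sum_le_sum fun l _ => by rw [coeff_add]; exact norm_add_le _ _

lemma truncNorm_sum_le {ι : Type*} (s : ℕ) (t : Finset ι) (g : ι → ℂ[X]) :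
    truncNorm s (∑ i ∈ t, g i) ≤ ∑ i ∈ t, truncNorm s (g i) := by
  classical
  induction t using Finset.induction_on with
  | empty => simp [truncNorm]
  | insert i t hi ih =>
    rw [Finset.sum_insert hi, Finset.sum_insert hi]
    exact (truncNorm_add_le _ _ _).trans (by gcongr)

lemma truncNorm_C_mul (s : ℕ) (c : ℂ) (g : ℂ[X]) : truncNorm s (C c * g) = ‖c‖ * truncNorm s g := by
  simp [truncNorm, Finset.mul_sum]

lemma truncNorm_C_le (s : ℕ) (c : ℂ) : truncNorm s (C c) ≤ ‖c‖ := by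
  unfold truncNorm
  simp_rw [coeff_C, apply_ite norm, norm_zero, Finset.sum_ite_eq']
  split_ifs <;> simp

lemma truncNorm_X_le (s : ℕ) : truncNorm s X ≤ 1 := by
  unfold truncNorm
  simp_rw [coeff_X, apply_ite norm, norm_zero, norm_one, Finset.sum_ite_eq]
  split_ifs <;> simp

lemma truncNorm_mul_le (s : ℕ) (g h : ℂ[X]) :
    truncNorm s (g * h) ≤ truncNorm s g * truncNorm s h := by
  unfold truncNorm
  have h1 : ∀ l ∈ Finset.range s, ‖(g * h).coeff l‖ ≤
      ∑ p ∈ Finset.HasAntidiagonal.antidiagonal l, ‖g.coeff p.1‖ * ‖h.coeff p.2‖ := by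
    intro l _
    rw [coeff_mul]
    exact (norm_sum_le _ _).trans (Finset.sum_le_sum fun p _ => norm_mul_le _ _)
  refine (Finset.sum_le_sum h1).trans ?_
  rw [Finset.sum_mul_sum, ← Finset.sum_product', Finset.sum_sigma',
    ← Finset.sum_image (f := fun p : ℕ × ℕ => ‖g.coeff p.1‖ * ‖h.coeff p.2‖)
      (g := fun q : (_ : ℕ) × ℕ × ℕ => q.2)]
  · refine Finset.sum_le_sum_of_subset_of_nonneg ?_ fun _ _ _ => by positivity
    intro p hp
    obtain ⟨⟨l, q⟩, hq, rfl⟩ := Finset.mem_image.1 hp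
    simp only [Finset.mem_sigma, Finset.mem_range, Finset.HasAntidiagonal.mem_antidiagonal] at hq
    simp only [Finset.mem_product, Finset.mem_range]
    omega
  · rintro ⟨l, q⟩ hq ⟨l', q'⟩ hq' h
    simp only [Finset.coe_sigma, Set.mem_sigma_iff, Finset.mem_coe, Finset.mem_range,
      Finset.HasAntidiagonal.mem_antidiagonal] at hq hq'
    obtain rfl : q = q' := h
    obtain rfl : l = l' := by omega
    rfl

lemma truncNorm_pow_le (s : ℕ) (g : ℂ[X]) (k : ℕ) : truncNorm s (g ^ k) ≤ truncNorm s g ^ k := by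
  induction k with
  | zero => rw [pow_zero, pow_zero, ← C_1]; simpa using truncNorm_C_le s 1
  | succ k ih =>
    rw [pow_succ, pow_succ]
    exact (truncNorm_mul_le _ _ _).trans (mul_le_mul_of_nonneg_right ih (truncNorm_nonneg _ _))

lemma truncNorm_X_add_C_le (s : ℕ) (x : ℂ) : truncNorm s (X + C x) ≤ 1 + ‖x‖ :=
  (truncNorm_add_le _ _ _).trans (add_le_add (truncNorm_X_le s) (truncNorm_C_le s x))

lemma truncNorm_comp_le {s : ℕ} (g u : ℂ[X]) (hu : u.coeff 0 = 0) {B : ℝ} (hB : 1 ≤ B)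
    (huB : truncNorm s u ≤ B) : truncNorm s (g.comp u) ≤ truncNorm s g * B ^ s := by
  rw [comp_eq_sum_left, Polynomial.sum_over_range' _ (by simp) (max s (g.natDegree + 1))
    (by omega)]
  refine (truncNorm_sum_le _ _ _).trans ?_
  simp_rw [truncNorm_C_mul]
  have hX : X ∣ u := X_dvd_iff.2 hu
  rw [← Finset.sum_subset (Finset.range_subset_range.2 (le_max_left s _))]
  · rw [truncNorm, Finset.sum_mul]
    refine Finset.sum_le_sum fun m hm => ?_
    gcongr
    refine (truncNorm_pow_le _ _ _).trans ?_
    refine (pow_le_pow_left₀ (truncNorm_nonneg _ _) huB m).trans ?_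
    exact pow_le_pow_right₀ hB (Finset.mem_range.1 hm).le
  · intro m _ hm
    rw [Finset.mem_range, not_lt] at hm
    have : truncNorm s (u ^ m) = 0 := by
      refine Finset.sum_eq_zero fun l hl => ?_
      obtain ⟨v, hv⟩ := pow_dvd_pow_of_dvd hX m
      rw [Finset.mem_range] at hl
      rw [hv, coeff_X_pow_mul', if_neg (by omega), norm_zero]
    rw [this, mul_zero]

lemma truncNorm_taylor_X_pow_le (s : ℕ) (x : ℂ) (k : ℕ) :
    truncNorm s (taylor x (X ^ k)) ≤ (1 + ‖x‖) ^ k := by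
  rw [taylor_X_pow]
  exact (truncNorm_pow_le _ _ _).trans
    (pow_le_pow_left₀ (truncNorm_nonneg _ _) (truncNorm_X_add_C_le s x) k)

/-- Taylor coefficients at `x` of `g(T ^ p)` in terms of those of `g` at `x ^ p`. -/
lemma truncNorm_taylor_comp_X_pow_le (s : ℕ) (g : ℂ[X]) (x : ℂ) (p : ℕ) :
    truncNorm s (taylor x (g.comp (X ^ p))) ≤
      truncNorm s (taylor (x ^ p) g) * (2 * (1 + ‖x‖) ^ p) ^ s := by
  have h1 : taylor x (g.comp (X ^ p)) =
      (taylor (x ^ p) g).comp ((X + C x) ^ p - C (x ^ p)) := by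
    simp only [taylor_apply, comp_assoc]
    simp
  have h2 : (1 : ℝ) ≤ (1 + ‖x‖) ^ p := one_le_pow₀ (by linarith [norm_nonneg x])
  rw [h1]
  refine truncNorm_comp_le _ _ ?_ (by linarith) ?_
  · simp [coeff_zero_eq_eval_zero]
  · rw [sub_eq_add_neg, ← C_neg]
    refine (truncNorm_add_le _ _ _).trans ?_
    have h3 := (truncNorm_pow_le s (X + C x) p).trans
      (pow_le_pow_left₀ (truncNorm_nonneg _ _) (truncNorm_X_add_C_le s x) p)
    have h4 := truncNorm_C_le s (-x ^ p)
    rw [norm_neg, norm_pow] at h4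
    have h5 : ‖x‖ ^ p ≤ (1 + ‖x‖) ^ p :=
      pow_le_pow_left₀ (norm_nonneg _) (by linarith) p
    linarith

/-- If the divided derivatives of `P` of order `< j + s` are small at `x ^ p`, the Taylor
coefficients of order `< s` at `x` of `T ^ k * P^{[j]}(T ^ p)` are small. -/
lemma truncNorm_taylor_hasseDeriv_comp_le (P : ℂ[X]) (x : ℂ) (p j k s : ℕ) {η : ℝ}
    (hη : ∀ m < j + s, ‖(hasseDeriv m P).eval (x ^ p)‖ ≤ η) :
    truncNorm s (taylor x (X ^ k * (hasseDeriv j P).comp (X ^ p))) ≤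
      (1 + ‖x‖) ^ k * (s * (2 ^ (j + s) * η) * (2 * (1 + ‖x‖) ^ p) ^ s) := by
  rw [taylor_mul]
  refine (truncNorm_mul_le _ _ _).trans ?_
  have h1 := truncNorm_taylor_X_pow_le s x k
  have h2 := truncNorm_taylor_comp_X_pow_le s (hasseDeriv j P) x p
  have h3 : truncNorm s (taylor (x ^ p) (hasseDeriv j P)) ≤ s * (2 ^ (j + s) * η) := by
    refine (Finset.sum_le_card_nsmul _ _ (2 ^ (j + s) * η) fun l hl => ?_).trans (by simp)
    rw [Finset.mem_range] at hl
    rw [taylor_coeff, ← LinearMap.comp_apply, hasseDeriv_comp]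
    have h4 := hη (l + j) (by omega)
    have h5 : ((l + j).choose l : ℝ) ≤ 2 ^ (j + s) := by
      refine (Nat.cast_le.2 (Nat.choose_le_two_pow (l + j) l)).trans ?_
      push_cast
      exact pow_le_pow_right₀ (by norm_num) (by omega)
    rw [LinearMap.smul_apply, eval_smul, nsmul_eq_mul, norm_mul, Complex.norm_natCast]
    gcongr
  have := norm_nonneg x
  have := truncNorm_nonneg s (taylor x ((hasseDeriv j P).comp (X ^ p)))
  gcongr
  refine h2.trans ?_
  gcongr

/-! ### Irreducible integer polynomials and their complex roots -/

lemma aeval_map_rat (α : ℂ) (f : ℤ[X]) : aeval α (f.map (Int.castRingHom ℚ)) = aeval α f := by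
  rw [show Int.castRingHom ℚ = algebraMap ℤ ℚ from rfl, aeval_map_algebraMap]

lemma aeval_eq_eval_map (α : ℂ) (f : ℤ[X]) : aeval α f = (f.map (Int.castRingHom ℂ)).eval α := by
  rw [eval_map, aeval_def]; rfl

lemma Irreducible.natDegree_ne_zero_of_aeval_eq_zero {R : ℤ[X]} (hR : Irreducible R) {α : ℂ}
    (hα : aeval α R = 0) : R.natDegree ≠ 0 := by
  intro h
  rw [eq_C_of_natDegree_eq_zero h, aeval_C] at hα
  apply hR.ne_zero
  rw [eq_C_of_natDegree_eq_zero h]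
  have : R.coeff 0 = 0 := by simpa using hα
  rw [this, C_0]

lemma Irreducible.map_rat_irreducible {R : ℤ[X]} (hR : Irreducible R) {α : ℂ}
    (hα : aeval α R = 0) : Irreducible (R.map (Int.castRingHom ℚ)) :=
  (IsPrimitive.Int.irreducible_iff_irreducible_map_cast
    (hR.isPrimitive (hR.natDegree_ne_zero_of_aeval_eq_zero hα))).1 hR

lemma Irreducible.map_rat_dvd_iff {R : ℤ[X]} (hR : Irreducible R) {α : ℂ}
    (hα : aeval α R = 0) (f : ℚ[X]) : R.map (Int.castRingHom ℚ) ∣ f ↔ aeval α f = 0 := by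
  constructor
  · rintro ⟨g, rfl⟩
    rw [map_mul, aeval_map_rat, hα, zero_mul]
  · intro hf
    by_contra hn
    obtain ⟨u, v, huv⟩ := (hR.map_rat_irreducible hα).coprime_iff_not_dvd.2 hn
    have := congrArg (aeval α) huv
    simp [hf, aeval_map_rat, hα] at this

lemma Irreducible.dvd_iff_aeval {R : ℤ[X]} (hR : Irreducible R) {α : ℂ}
    (hα : aeval α R = 0) (f : ℤ[X]) : R ∣ f ↔ aeval α f = 0 := by
  rw [IsPrimitive.Int.dvd_iff_map_cast_dvd_map_cast _ _
    (hR.isPrimitive (hR.natDegree_ne_zero_of_aeval_eq_zero hα)), hR.map_rat_dvd_iff hα,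
    aeval_map_rat]

/-- Polynomial relations over `ℚ` pass from one root of an irreducible polynomial to another. -/
lemma Irreducible.aeval_eq_zero_of_root {R : ℤ[X]} (hR : Irreducible R) {α β : ℂ}
    (hα : aeval α R = 0) (hβ : aeval β R = 0) {f : ℚ[X]} (h : aeval α f = 0) : aeval β f = 0 :=
  (hR.map_rat_dvd_iff hβ f).1 ((hR.map_rat_dvd_iff hα f).2 h)

lemma Irreducible.separable_map_complex {R : ℤ[X]} (hR : Irreducible R) {α : ℂ}
    (hα : aeval α R = 0) : (R.map (Int.castRingHom ℂ)).Separable := by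
  have h1 := (hR.map_rat_irreducible hα).separable.map (f := algebraMap ℚ ℂ)
  rwa [Polynomial.map_map, RingHom.ext_int ((algebraMap ℚ ℂ).comp _) (Int.castRingHom ℂ)] at h1

lemma Irreducible.nodup_complex_roots {R : ℤ[X]} (hR : Irreducible R) {α : ℂ}
    (hα : aeval α R = 0) : (R.map (Int.castRingHom ℂ)).roots.Nodup :=
  nodup_roots (hR.separable_map_complex hα)

lemma mem_complex_roots {R : ℤ[X]} (hR : R ≠ 0) {α : ℂ} :
    α ∈ (R.map (Int.castRingHom ℂ)).roots ↔ aeval α R = 0 := by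
  rw [mem_roots ((Polynomial.map_ne_zero_iff (RingHom.injective_int _)).2 hR), IsRoot,
    aeval_eq_eval_map]

lemma natDegree_map_complex (R : ℤ[X]) : (R.map (Int.castRingHom ℂ)).natDegree = R.natDegree :=
  natDegree_map_eq_of_injective (RingHom.injective_int _) _

lemma card_complex_roots (R : ℤ[X]) :
    (R.map (Int.castRingHom ℂ)).roots.card = R.natDegree := by
  rw [← (IsAlgClosed.splits _).natDegree_eq_card_roots, natDegree_map_complex]

lemma map_complex_eq_prod_roots (R : ℤ[X]) :
    R.map (Int.castRingHom ℂ) = C (R.leadingCoeff : ℂ) *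
      ((R.map (Int.castRingHom ℂ)).roots.map fun a => X - C a).prod := by
  have h := (IsAlgClosed.splits (R.map (Int.castRingHom ℂ))).eq_prod_roots
  rw [leadingCoeff_map_of_injective (RingHom.injective_int _)] at h
  exact h

/-- A complex number algebraic over `ℚ` is a root of an irreducible integer polynomial. -/
lemma exists_irreducible_int_of_isAlgebraic {δ : ℂ} (hδ : IsAlgebraic ℚ δ) :
    ∃ R : ℤ[X], Irreducible R ∧ aeval δ R = 0 := by
  obtain ⟨f, hf0, hf⟩ := (IsFractionRing.isAlgebraic_iff ℤ ℚ ℂ).2 hδ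
  have hfu : ¬ IsUnit f := by
    intro hu
    have := hu.map (aeval δ : ℤ[X] →ₐ[ℤ] ℂ)
    rw [hf] at this
    exact not_isUnit_zero this
  by_contra! hcon
  have := UniqueFactorizationMonoid.induction_on_prime (P := fun f : ℤ[X] => f ≠ 0 → aeval δ f ≠ 0)
    f (fun h => absurd rfl h) (fun u hu _ h0 => by
      have := hu.map (aeval δ : ℤ[X] →ₐ[ℤ] ℂ)
      rw [h0] at this
      exact not_isUnit_zero this) (fun a p ha hp ih _ h0 => by
      rw [map_mul, mul_eq_zero] at h0
      exact h0.elim (hcon p hp.irreducible) (ih ha))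
  exact this hf0 hf

/-! ### Multiplicities -/

/-- The power map is unramified away from zero: multiplicities at `α` of `G(T ^ p)` are
multiplicities of `G` at `α ^ p`. -/
lemma X_sub_C_pow_dvd_of_dvd_comp {G : ℂ[X]} {α : ℂ} (hα : α ≠ 0) {p k : ℕ} (hp : 0 < p)
    (h : (X - C α) ^ k ∣ G.comp (X ^ p)) : (X - C (α ^ p)) ^ k ∣ G := by
  rcases eq_or_ne G 0 with rfl | hG
  · exact dvd_zero _
  obtain ⟨U, hU, hnd⟩ := exists_eq_pow_rootMultiplicity_mul_and_not_dvd G hG (α ^ p)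
  set a := rootMultiplicity (α ^ p) G
  by_cases hak : k ≤ a
  · rw [hU]; exact Dvd.dvd.mul_right (pow_dvd_pow _ hak) _
  exfalso
  obtain ⟨W, hW⟩ : X - C α ∣ (X ^ p - C (α ^ p) : ℂ[X]) := by
    rw [dvd_iff_isRoot]; simp
  have hWα : W.eval α ≠ 0 := by
    have h1 := congrArg (fun f => (derivative f).eval α) hW
    simp only [derivative_sub, derivative_X_pow, derivative_C, sub_zero, derivative_mul,
      derivative_X, eval_add, eval_mul, eval_sub, eval_X, eval_C, sub_self, zero_mul, add_zero,
      one_mul, eval_pow] at h1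
    rw [← h1]
    exact mul_ne_zero (Nat.cast_ne_zero.2 hp.ne') (pow_ne_zero _ hα)
  have h2 : G.comp (X ^ p) = (X - C α) ^ a * (W ^ a * U.comp (X ^ p)) := by
    conv_lhs => rw [hU]
    simp only [mul_comp, pow_comp, sub_comp, X_comp, C_comp]
    rw [hW, mul_pow, mul_assoc]
  rw [h2] at h
  have h3 : (X - C α) ^ (a + 1) ∣ (X - C α) ^ a * (W ^ a * U.comp (X ^ p)) :=
    (pow_dvd_pow _ (by omega)).trans h
  rw [pow_succ, mul_dvd_mul_iff_left (pow_ne_zero _ (X_sub_C_ne_zero α)), dvd_iff_isRoot] at h3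
  simp only [IsRoot, eval_mul, eval_pow, eval_comp, eval_X, mul_eq_zero] at h3
  rcases h3 with h3 | h3
  · exact hWα (eq_zero_of_pow_eq_zero h3)
  · exact hnd (dvd_iff_isRoot.2 h3)

lemma X_sub_C_pow_dvd_iff_taylor {P : ℂ[X]} {γ : ℂ} {m : ℕ} :
    (X - C γ) ^ m ∣ P ↔ ∀ l < m, (taylor γ P).coeff l = 0 := by
  rw [← X_pow_dvd_iff]
  constructor
  · rintro ⟨g, rfl⟩
    rw [taylor_mul, taylor_pow, map_sub, taylor_X, taylor_C, add_sub_cancel_right]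
    exact dvd_mul_right _ _
  · rintro ⟨g, hg⟩
    refine ⟨taylor (-γ) g, taylor_injective γ ?_⟩
    rw [taylor_mul, taylor_pow, map_sub, taylor_X, taylor_C, add_sub_cancel_right, taylor_taylor,
      add_neg_cancel, taylor_zero, hg]

/-- If the divided derivatives of `P` of order `< t` vanish to order `k ≥ 1` at `γ`, then `P`
vanishes to order `k + t - 1`. -/
lemma X_sub_C_pow_dvd_of_dvd_hasseDeriv {P : ℂ[X]} {γ : ℂ} {t k : ℕ} (ht : 0 < t) (hk : 0 < k)
    (h : ∀ j < t, (X - C γ) ^ k ∣ hasseDeriv j P) : (X - C γ) ^ (k + t - 1) ∣ P := by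
  rw [X_sub_C_pow_dvd_iff_taylor]
  intro l hl
  -- write `l = i + j` with `i < k` and `j < t`
  obtain ⟨i, j, hi, hj, rfl⟩ : ∃ i j, i < k ∧ j < t ∧ l = i + j := by
    by_cases hlk : l < k
    · exact ⟨l, 0, hlk, ht, rfl⟩
    · exact ⟨k - 1, l - (k - 1), by omega, by omega, by omega⟩
  have h1 := X_sub_C_pow_dvd_iff_taylor.1 (h j hj) i hi
  rw [taylor_coeff, ← LinearMap.comp_apply, hasseDeriv_comp, LinearMap.smul_apply, eval_smul,
    ← taylor_coeff, nsmul_eq_mul, mul_eq_zero] at h1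
  refine h1.resolve_left ?_
  exact_mod_cast (Nat.choose_pos (by omega)).ne'

lemma Irreducible.pow_dvd_of_X_sub_C_pow_dvd {V P : ℤ[X]} (hV : Irreducible V) {γ : ℂ}
    (hγ : aeval γ V = 0) (hP : P ≠ 0) {m : ℕ}
    (h : (X - C γ) ^ m ∣ P.map (Int.castRingHom ℂ)) : V ^ m ∣ P := by
  obtain ⟨W, hW, hnd⟩ :=
    (FiniteMultiplicity.of_not_isUnit hV.not_isUnit hP).exists_eq_pow_mul_and_not_dvd
  set f := multiplicity V P
  by_cases hfm : m ≤ f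
  · rw [hW]; exact Dvd.dvd.mul_right (pow_dvd_pow _ hfm) _
  exfalso
  have hγW : aeval γ W ≠ 0 := fun h0 => hnd ((hV.dvd_iff_aeval hγ W).2 h0)
  obtain ⟨V₁, hV₁⟩ : X - C γ ∣ V.map (Int.castRingHom ℂ) := by
    rw [dvd_iff_isRoot, IsRoot, ← aeval_eq_eval_map, hγ]
  have hV₁γ : V₁.eval γ ≠ 0 := by
    intro h0
    have h2 := (hV.separable_map_complex hγ).squarefree (X - C γ)
      (by rw [hV₁]; exact mul_dvd_mul_left _ (dvd_iff_isRoot.2 h0))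
    exact not_isUnit_X_sub_C γ h2
  rw [hW, Polynomial.map_mul, Polynomial.map_pow, hV₁, mul_pow, mul_assoc] at h
  have h3 := (pow_dvd_pow (X - C γ) (show f + 1 ≤ m by omega)).trans h
  rw [pow_succ, mul_dvd_mul_iff_left (pow_ne_zero _ (X_sub_C_ne_zero γ)), dvd_iff_isRoot] at h3
  simp only [IsRoot, eval_mul, eval_pow, mul_eq_zero, ← aeval_eq_eval_map] at h3
  rcases h3 with h3 | h3
  · exact hV₁γ (eq_zero_of_pow_eq_zero h3)
  · exact hγW h3

/-- If `R ^ k` divides all the `P^{[j]}(T ^ p)` with `j < t`, the minimal polynomial of the `p`-th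
power of a root of `R` divides `P` at least `k + t - 1` times. -/
theorem pow_dvd_of_pow_dvd_hasseDeriv_comp {P R V : ℤ[X]} (hP : P ≠ 0)
    (hV : Irreducible V) {α : ℂ} (hα0 : α ≠ 0) (hα : aeval α R = 0) {p k t : ℕ} (hp : 0 < p)
    (hk : 0 < k) (ht : 0 < t) (hVα : aeval (α ^ p) V = 0)
    (h : ∀ j < t, R ^ k ∣ (hasseDeriv j P).comp (X ^ p)) : V ^ (k + t - 1) ∣ P := by
  refine hV.pow_dvd_of_X_sub_C_pow_dvd hVα hP (X_sub_C_pow_dvd_of_dvd_hasseDeriv ht hk ?_)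
  intro j hj
  refine X_sub_C_pow_dvd_of_dvd_comp hα0 hp ?_
  have h1 : X - C α ∣ R.map (Int.castRingHom ℂ) := by
    rw [dvd_iff_isRoot, IsRoot, ← aeval_eq_eval_map, hα]
  have h2 := Polynomial.map_dvd (Int.castRingHom ℂ) (h j hj)
  rw [Polynomial.map_pow, Polynomial.map_comp, Polynomial.map_pow, map_X] at h2
  have h3 : (hasseDeriv j P).map (Int.castRingHom ℂ) =
      hasseDeriv j (P.map (Int.castRingHom ℂ)) := by
    ext k; simp [hasseDeriv_coeff]
  rw [h3] at h2
  exact (pow_dvd_pow_of_dvd h1 k).trans h2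

/-! ### Mahler measure of a power -/

/-- If the roots of `V` are the `e`-th powers of the roots of a primitive `R`, the leading
coefficient of `V` is divisible by the `e`-th power of that of `R`. By Gauss' lemma over the
algebraic integers, `∏ R(ζ T)`, over the `e`-th roots of unity `ζ`, is not divisible by any
rational prime. -/
lemma leadingCoeff_pow_dvd_of_roots_eq {R V : ℤ[X]} (hR : R.IsPrimitive) {e : ℕ} (he : 0 < e)
    (hroots : (V.map (Int.castRingHom ℂ)).roots =
      (R.map (Int.castRingHom ℂ)).roots.map (· ^ e)) (hV : V ≠ 0) :
    R.leadingCoeff ^ e ∣ V.leadingCoeff := by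
  set S := integralClosure ℤ ℂ
  set φ : S →+* ℂ := S.toSubring.subtype
  have hφ : Function.Injective φ := Subtype.val_injective
  set ζ := Complex.exp (2 * Real.pi * Complex.I / e)
  have hζ : IsPrimitiveRoot ζ e := Complex.isPrimitiveRoot_exp e he.ne'
  let z : S := ⟨ζ, hζ.isIntegral he⟩
  have hz : z ^ e = 1 := Subtype.ext hζ.pow_eq_one
  have hφz : φ z = ζ := rfl
  set ι := algebraMap ℤ S
  have hφι : φ.comp ι = Int.castRingHom ℂ := RingHom.ext_int _ _
  set a := R.leadingCoeff
  set v := V.leadingCoeff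
  let Y : S[X] := ∏ k ∈ Finset.range e, (R.map ι).comp (C (z ^ k) * X)
  let w : S := ∏ k ∈ Finset.range e, z ^ k
  have hkey : C (ι v) * Y = C (ι (a ^ e) * w ^ R.natDegree) * (V.map ι).comp (X ^ e) := by
    apply Polynomial.map_injective φ hφ
    have hcomp : ∀ c : ℤ, φ (ι c) = c := fun c => by
      rw [← RingHom.comp_apply, hφι]; rfl
    simp only [Y, Polynomial.map_mul, Polynomial.map_prod, Polynomial.map_comp, Polynomial.map_map,
      Polynomial.map_C, Polynomial.map_X, Polynomial.map_pow, hφι, hcomp, map_pow, map_mul, hφz]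
    have h1 : ∀ α : ℂ, ∏ k ∈ Finset.range e, (C (ζ ^ k) * X - C α) =
        C (φ w) * (X ^ e - C (α ^ e)) := by
      intro α
      rw [X_pow_sub_C_eq_prod hζ.inv he (rfl : α ^ e = α ^ e)]
      simp only [w, map_prod, map_pow, hφz, ← Finset.prod_mul_distrib]
      refine Finset.prod_congr rfl fun k _ => ?_
      have hz0 : ζ ^ k ≠ 0 := pow_ne_zero _ (hζ.ne_zero he.ne')
      rw [mul_sub, ← C_pow, ← C_mul, inv_pow, mul_inv_cancel_left₀ hz0]
    have h2 : ∀ m : Multiset ℂ, ∏ k ∈ Finset.range e,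
        ((m.map fun α => X - C α).prod.comp (C (ζ ^ k) * X)) =
        C (φ w) ^ Multiset.card m * ((m.map fun α => X - C (α ^ e)).prod.comp (X ^ e)) := by
      intro m
      induction m using Multiset.induction_on with
      | empty => simp
      | cons α m ih =>
        simp only [Multiset.map_cons, Multiset.prod_cons, mul_comp, Finset.prod_mul_distrib, ih,
          Multiset.card_cons, sub_comp, X_comp, C_comp, h1]
        ring
    simp only [C_pow] at h2
    rw [map_complex_eq_prod_roots V, hroots]
    conv_lhs =>
      enter [2, 2, k]
      rw [map_complex_eq_prod_roots R, mul_comp, C_comp]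
    rw [Finset.prod_mul_distrib, h2, Finset.prod_const, Finset.card_range, card_complex_roots]
    simp only [mul_comp, C_comp, Multiset.map_map, Function.comp_def, C_pow]
    simp only [a, v]
    ring
  have hv : v ≠ 0 := leadingCoeff_ne_zero.2 hV
  have ha : a ^ e ≠ 0 := pow_ne_zero _ (leadingCoeff_ne_zero.2 hR.ne_zero)
  obtain ⟨g, v', a', hg, hcop, hv', ha'⟩ := Int.exists_gcd_one' (m := v) (n := a ^ e)
    (Int.gcd_pos_of_ne_zero_left _ hv)
  have hg0 : (g : ℤ) ≠ 0 := by exact_mod_cast hg.ne'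
  have hι : Function.Injective ι := RingHom.injective_int ι
  have hkey2 : C (ι v') * Y = C (ι a' * w ^ R.natDegree) * (V.map ι).comp (X ^ e) := by
    have h0 : (C (ι (g : ℤ)) : S[X]) ≠ 0 := C_ne_zero.2 ((map_ne_zero_iff ι hι).2 hg0)
    apply mul_left_cancel₀ h0
    simp only [hv', ha', map_mul] at hkey ⊢
    linear_combination hkey
  by_cases hu : IsUnit a'
  · rw [hv', ha']
    exact mul_dvd_mul (hu.dvd) dvd_rfl
  exfalso
  obtain ⟨q, hq, hqa⟩ := Nat.exists_prime_and_dvd (mt Int.isUnit_iff_natAbs_eq.2 hu)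
  have hqa' : (q : ℤ) ∣ a' := Int.natCast_dvd.2 hqa
  have hqv' : ¬ (q : ℤ) ∣ v' := by
    intro h
    have := Int.dvd_coe_gcd h hqa'
    rw [hcop] at this
    exact hq.one_lt.ne' (by exact_mod_cast Int.eq_one_of_dvd_one (by positivity) this)
  -- a maximal ideal of the ring of algebraic integers above `q`
  have hqS : Ideal.span {(ι q : S)} ≠ ⊤ := by
    rw [Ne, Ideal.span_singleton_eq_top]
    intro hunit
    obtain ⟨y, hy⟩ := hunit.exists_right_inv
    have h1 : IsIntegral ℤ ((1 : ℚ) / q) := by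
      rw [← isIntegral_algebraMap_iff (algebraMap ℚ ℂ).injective]
      have hq0 : (q : ℂ) ≠ 0 := by exact_mod_cast hq.ne_zero
      have h2 : (y : ℂ) = algebraMap ℚ ℂ ((1 : ℚ) / q) := by
        have h3 := congrArg φ hy
        rw [map_mul, map_one] at h3
        have h4 : φ (ι q) = (q : ℂ) := by
          rw [← RingHom.comp_apply, hφι]; simp
        rw [h4] at h3
        have h5 : (y : ℂ) = 1 / q := by
          rw [eq_div_iff hq0, mul_comm]; exact h3
        rw [h5]; simp
      rw [← h2]
      exact y.2
    obtain ⟨m, hm⟩ := IsIntegrallyClosed.isIntegral_iff.1 h1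
    have h6 : (m : ℚ) * q = 1 := by
      have : (m : ℚ) = 1 / q := hm
      rw [this, one_div_mul_cancel]
      exact_mod_cast hq.ne_zero
    have h7 : (q : ℤ) ∣ 1 := ⟨m, by rw [mul_comm]; exact_mod_cast h6.symm⟩
    exact hq.one_lt.ne' (by exact_mod_cast Int.eq_one_of_dvd_one (by positivity) h7)
  obtain ⟨M, hM, hqM⟩ := Ideal.exists_le_maximal _ hqS
  obtain ⟨F, _, π, hπq⟩ : ∃ (F : Type) (_ : Field F) (π : S →+* F), π (ι q) = 0 :=
    ⟨S ⧸ M, Ideal.Quotient.field M, Ideal.Quotient.mk M,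
      Ideal.Quotient.eq_zero_iff_mem.2 (hqM (Ideal.mem_span_singleton_self _))⟩
  have hπ : ∀ c : ℤ, ¬ (q : ℤ) ∣ c → π (ι c) ≠ 0 := by
    intro c hc h0
    have hcopr : IsCoprime (q : ℤ) c :=
      (Nat.prime_iff_prime_int.1 hq).irreducible.coprime_iff_not_dvd.2 hc
    obtain ⟨r, s, hrs⟩ := hcopr
    have := congrArg (fun t => π (ι t)) hrs
    simp only [map_add, map_mul, hπq, h0, map_one, mul_zero, add_zero] at this
    exact zero_ne_one this
  have hlhs : (C (ι v') * Y).map π = 0 := by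
    rw [hkey2, Polynomial.map_mul, Polynomial.map_C]
    obtain ⟨b, hb⟩ := hqa'
    rw [hb]
    simp only [map_mul, hπq, zero_mul, C_0]
  rw [Polynomial.map_mul, Polynomial.map_C, mul_eq_zero, C_eq_zero, Polynomial.map_prod] at hlhs
  rcases hlhs with h0 | h0
  · exact hπ v' hqv' h0
  obtain ⟨k, -, h0⟩ := Finset.prod_eq_zero_iff.1 h0
  -- a coefficient of `R` prime to `q`
  obtain ⟨i, hi⟩ : ∃ i, ¬ (q : ℤ) ∣ R.coeff i := by
    by_contra! hcon
    have := hR q ((C_dvd_iff_dvd_coeff _ _).2 hcon)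
    exact (Nat.prime_iff_prime_int.1 hq).not_isUnit this
  have h1 := congrArg (fun f => f.coeff i) h0
  simp only [Polynomial.coeff_map, comp_C_mul_X_coeff, coeff_zero, map_mul, mul_eq_zero] at h1
  rcases h1 with h1 | h1
  · exact hπ _ hi h1
  · have h2 : π z ^ e = 1 := by rw [← map_pow, hz, map_one]
    have h3 : π z = 0 := by
      simp only [map_pow] at h1
      exact eq_zero_of_pow_eq_zero (eq_zero_of_pow_eq_zero h1)
    rw [h3, zero_pow he.ne'] at h2
    exact zero_ne_one h2

/-- If `α` is a rational function of `α ^ e`, the Mahler measure of the minimal polynomial of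
`α ^ e` is at least the `e`-th power of that of `α`. -/
theorem intMahler_pow_le {R V : ℤ[X]} (hR : Irreducible R) (hV : Irreducible V) {α : ℂ}
    (hα : aeval α R = 0) {e : ℕ} (he : 0 < e) (hVα : aeval (α ^ e) V = 0) {g : ℚ[X]}
    (hg : aeval (α ^ e) g = α) :
    V.natDegree = R.natDegree ∧ intMahler R ^ e ≤ intMahler V := by
  have hgR : ∀ x : ℂ, aeval x R = 0 → aeval (x ^ e) g = x := by
    intro x hx
    have := hR.aeval_eq_zero_of_root hα hx (f := g.comp (X ^ e) - X) (by simp [aeval_comp, hg])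
    simpa [aeval_comp, sub_eq_zero] using this
  have hroots : (V.map (Int.castRingHom ℂ)).roots =
      (R.map (Int.castRingHom ℂ)).roots.map (· ^ e) := by
    rw [Multiset.Nodup.ext (hV.nodup_complex_roots hVα)]
    · intro y
      rw [mem_complex_roots hV.ne_zero, Multiset.mem_map]
      constructor
      · intro hy
        refine ⟨aeval y g, ?_, ?_⟩
        · rw [mem_complex_roots hR.ne_zero]
          have := hV.aeval_eq_zero_of_root hVα hy
            (f := (R.map (Int.castRingHom ℚ)).comp g) (by
              rw [aeval_comp, hg, aeval_map_rat, hα])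
          rwa [aeval_comp, aeval_map_rat] at this
        · have := hV.aeval_eq_zero_of_root hVα hy (f := g ^ e - X) (by simp [hg])
          simpa [sub_eq_zero] using this
      · rintro ⟨x, hx, rfl⟩
        rw [mem_complex_roots hR.ne_zero] at hx
        have := hR.aeval_eq_zero_of_root hα hx
          (f := (V.map (Int.castRingHom ℚ)).comp (X ^ e)) (by
            rw [aeval_comp, map_pow, aeval_X, aeval_map_rat, hVα])
        rwa [aeval_comp, map_pow, aeval_X, aeval_map_rat] at this
    · refine Multiset.Nodup.map_on ?_ (hR.nodup_complex_roots hα)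
      intro x hx y hy hxy
      rw [mem_complex_roots hR.ne_zero] at hx hy
      rw [← hgR x hx, ← hgR y hy, hxy]
  refine ⟨?_, ?_⟩
  · rw [← card_complex_roots, hroots, Multiset.card_map, card_complex_roots]
  have hRp := hR.isPrimitive (hR.natDegree_ne_zero_of_aeval_eq_zero hα)
  have hlead := leadingCoeff_pow_dvd_of_roots_eq hRp he hroots hV.ne_zero
  have hle : |R.leadingCoeff| ^ e ≤ |V.leadingCoeff| := by
    rw [← abs_pow]
    exact Int.le_of_dvd (abs_pos.2 (leadingCoeff_ne_zero.2 hV.ne_zero))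
      ((abs_dvd_abs _ _).2 hlead)
  unfold intMahler
  rw [mahlerMeasure_eq_leadingCoeff_mul_prod_roots, mahlerMeasure_eq_leadingCoeff_mul_prod_roots,
    hroots, leadingCoeff_map_of_injective (RingHom.injective_int _),
    leadingCoeff_map_of_injective (RingHom.injective_int _), mul_pow, Multiset.map_map,
    ← Multiset.prod_map_pow]
  have hpow : ∀ a : ℂ, max 1 ‖a‖ ^ e = max 1 ‖a ^ e‖ := by
    intro a
    rw [norm_pow]
    rcases le_total 1 ‖a‖ with h | h
    · rw [max_eq_right h, max_eq_right (one_le_pow₀ h)]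
    · rw [max_eq_left h, max_eq_left (pow_le_one₀ (norm_nonneg _) h), one_pow]
  simp only [hpow, Function.comp_def]
  refine mul_le_mul_of_nonneg_right ?_ ?_
  · simp only [eq_intCast, Complex.norm_intCast]
    exact_mod_cast hle
  · refine Multiset.prod_nonneg fun x hx => ?_
    obtain ⟨y, -, rfl⟩ := Multiset.mem_map.1 hx
    positivity

section

open IntermediateField

/-! ### A lower bound for the Mahler measure -/

lemma norm_le_intMahler {R : ℤ[X]} (hR : R ≠ 0) {x : ℂ} (hx : aeval x R = 0) :
    ‖x‖ ≤ intMahler R := by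
  obtain ⟨G, hG⟩ : X - C x ∣ R.map (Int.castRingHom ℂ) := by
    rw [dvd_iff_isRoot, IsRoot, ← aeval_eq_eval_map, hx]
  have hlead : G.leadingCoeff = (R.leadingCoeff : ℂ) := by
    have := congrArg leadingCoeff hG
    rw [leadingCoeff_map_of_injective (RingHom.injective_int _), leadingCoeff_mul,
      leadingCoeff_X_sub_C, one_mul] at this
    exact this.symm
  have h1 : 1 ≤ G.mahlerMeasure := by
    refine one_le_mahlerMeasure_of_one_le_norm_leadingCoeff ?_
    rw [hlead, Complex.norm_intCast]
    exact_mod_cast Int.one_le_abs (leadingCoeff_ne_zero.2 hR)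
  unfold intMahler
  rw [hG, mahlerMeasure_mul, mahlerMeasure_X_sub_C]
  calc ‖x‖ ≤ max 1 ‖x‖ := le_max_right _ _
    _ ≤ max 1 ‖x‖ * G.mahlerMeasure := le_mul_of_one_le_right (by positivity) h1

lemma exists_sum_pow_prime_eq {S ι : Type*} [CommRing S] {p : ℕ} (hp : p.Prime) (s : Finset ι)
    (f : ι → S) : ∃ r, (∑ i ∈ s, f i) ^ p = ∑ i ∈ s, f i ^ p + p * r := by
  classical
  induction s using Finset.induction_on with
  | empty => exact ⟨0, by simp [hp.ne_zero]⟩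
  | insert i s hi ih =>
    obtain ⟨r, hr⟩ := ih
    obtain ⟨r', hr'⟩ := exists_add_pow_prime_eq hp (f i) (∑ j ∈ s, f j)
    refine ⟨r + f i * (∑ j ∈ s, f j) * r', ?_⟩
    rw [Finset.sum_insert hi, Finset.sum_insert hi, hr', hr]
    ring

/-- Congruence of power sums: for an algebraic integer `x` with conjugates `x_i`, the rational
integers `∑ x_i ^ p` and `∑ x_i` are congruent modulo `p`. -/
lemma exists_sum_embeddings_eq_int {K : Type*} [Field K] [Algebra ℚ K] [FiniteDimensional ℚ K]
    {x : K} (hx : IsIntegral ℤ x) : ∃ m : ℤ, ∑ σ : K →ₐ[ℚ] ℂ, σ x = m := by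
  have h1 : IsIntegral ℤ (Algebra.trace ℚ K x) := Algebra.isIntegral_trace hx
  obtain ⟨m, hm⟩ := IsIntegrallyClosed.isIntegral_iff.1 h1
  refine ⟨m, ?_⟩
  rw [← trace_eq_sum_embeddings ℂ, ← hm]
  simp

lemma int_dvd_of_eq_mul_integral {p : ℕ} (hp : p ≠ 0) {m : ℤ} {r : ℂ} (hr : IsIntegral ℤ r)
    (h : (m : ℂ) = p * r) : (p : ℤ) ∣ m := by
  have hp0 : (p : ℂ) ≠ 0 := by exact_mod_cast hp
  have hp1 : (p : ℚ) ≠ 0 := by exact_mod_cast hp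
  have h2 : r = algebraMap ℚ ℂ ((m : ℚ) / p) := by
    rw [map_div₀]
    simp only [map_intCast, map_natCast]
    rw [h, mul_div_cancel_left₀ _ hp0]
  rw [h2, isIntegral_algebraMap_iff (algebraMap ℚ ℂ).injective] at hr
  obtain ⟨y, hy⟩ := IsIntegrallyClosed.isIntegral_iff.1 hr
  have hy' : (y : ℚ) = m / p := hy
  rw [eq_div_iff hp1] at hy'
  exact ⟨y, by rw [mul_comm]; exact_mod_cast hy'.symm⟩

lemma int_dvd_sum_embeddings_sub {K : Type*} [Field K] [Algebra ℚ K] [FiniteDimensional ℚ K]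
    {x : K} (hx : IsIntegral ℤ x) {p : ℕ} (hp : p.Prime) {m m' : ℤ}
    (hm : ∑ σ : K →ₐ[ℚ] ℂ, σ x = m) (hm' : ∑ σ : K →ₐ[ℚ] ℂ, σ x ^ p = m') :
    (p : ℤ) ∣ m' - m := by
  let f : (K →ₐ[ℚ] ℂ) → integralClosure ℤ ℂ := fun σ => ⟨σ x, hx.map (σ.restrictScalars ℤ)⟩
  obtain ⟨r, hr⟩ := exists_sum_pow_prime_eq hp Finset.univ f
  have hr' := congrArg (integralClosure ℤ ℂ).val hr
  simp only [map_pow, map_sum, map_add, map_mul, map_natCast] at hr'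
  have h1 : (p : ℤ) ∣ m ^ p - m' := by
    refine int_dvd_of_eq_mul_integral hp.ne_zero r.2 ?_
    have h2 : (m : ℂ) ^ p = m' + p * (r : ℂ) := by
      rw [← hm, ← hm']; exact hr'
    push_cast
    rw [h2]; ring
  have h2 : (p : ℤ) ∣ m ^ p - m := by
    have := Fact.mk hp
    rw [← ZMod.intCast_zmod_eq_zero_iff_dvd]
    push_cast
    rw [ZMod.pow_card, sub_self]
  have := dvd_sub h2 h1
  simpa using this

/-- **A Dobrowolski type lower bound.** If no root of the irreducible integer polynomial `R` of
degree `d` is zero or a root of unity, its Mahler measure is at least `2 ^ (1 / (16 d²))`. When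
this fails for a monic `R`, comparing the power sums of the roots with those of their `p`-th
powers, modulo a prime `p` between `4d` and `8d`, shows that the `p`-th power permutes the
roots. -/
theorem two_le_intMahler_pow {R : ℤ[X]} (hR : Irreducible R) {δ : ℂ} (hδ : aeval δ R = 0)
    (hδ0 : δ ≠ 0) (hδ1 : ∀ m : ℕ, 0 < m → δ ^ m ≠ 1) :
    2 ≤ intMahler R ^ (16 * R.natDegree ^ 2) := by
  set d := R.natDegree with hd
  have hd0 : d ≠ 0 := hR.natDegree_ne_zero_of_aeval_eq_zero hδ
  have hM1 := one_le_intMahler hR.ne_zero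
  by_cases hlead : 2 ≤ |R.leadingCoeff|
  · have h1 : (2 : ℝ) ≤ intMahler R := by
      have h2 := leadingCoeff_le_mahlerMeasure (R.map (Int.castRingHom ℂ))
      rw [leadingCoeff_map_of_injective (RingHom.injective_int _), eq_intCast,
        Complex.norm_intCast] at h2
      exact le_trans (by exact_mod_cast hlead) h2
    exact h1.trans (le_self_pow₀ hM1 (by positivity))
  by_contra! hlt
  have hl0 := leadingCoeff_ne_zero.2 hR.ne_zero
  have habs : |R.leadingCoeff| = 1 := le_antisymm (by omega) (Int.one_le_abs hl0)
  -- the roots are algebraic integers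
  have hint : IsIntegral ℤ δ := by
    refine ⟨C R.leadingCoeff * R, ?_, ?_⟩
    · unfold Monic
      rw [leadingCoeff_mul, leadingCoeff_C]
      rcases (abs_eq (by norm_num : (0 : ℤ) ≤ 1)).1 habs with h | h <;> rw [h] <;> norm_num
    · rw [← aeval_def, map_mul, hδ, mul_zero]
  have hintQ : IsIntegral ℚ δ := hint.tower_top
  let K := ℚ⟮δ⟯
  have : FiniteDimensional ℚ K := adjoin.finiteDimensional hintQ
  let x : K := AdjoinSimple.gen ℚ δ
  have hxint : IsIntegral ℤ x := by
    rw [← isIntegral_algebraMap_iff (algebraMap K ℂ).injective]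
    exact hint
  have hσ : ∀ σ : K →ₐ[ℚ] ℂ, aeval (σ x) R = 0 := by
    intro σ
    have h1 : aeval x R = 0 := by
      apply (algebraMap K ℂ).injective
      rw [← aeval_algebraMap_apply, map_zero]
      exact hδ
    have h2 := congrArg σ h1
    rw [map_zero] at h2
    rw [← h2]
    exact (aeval_algHom_apply (σ.restrictScalars ℤ) x R)
  have hcard : Fintype.card (K →ₐ[ℚ] ℂ) = d := by
    rw [AlgHom.card, adjoin.finrank hintQ, ← minpoly.eq_of_irreducible
      (hR.map_rat_irreducible hδ) (by rw [aeval_map_rat, hδ]), natDegree_mul_C, hd,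
      natDegree_map_eq_of_injective (RingHom.injective_int _)]
    exact inv_ne_zero (leadingCoeff_ne_zero.2 (hR.map_rat_irreducible hδ).ne_zero)
  have hnorm : ∀ σ : K →ₐ[ℚ] ℂ, ‖σ x‖ ≤ intMahler R :=
    fun σ => norm_le_intMahler hR.ne_zero (hσ σ)
  obtain ⟨p, hp, hp4, hp8⟩ := Nat.exists_prime_lt_and_le_two_mul (4 * d) (by omega)
  -- the power sums of the roots and of their `p`-th powers agree
  have hsum : ∀ j < 2 * d, ∑ σ : K →ₐ[ℚ] ℂ, (σ x ^ p) ^ j = ∑ σ : K →ₐ[ℚ] ℂ, σ x ^ j := by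
    intro j hj
    have hbound : ∀ i ≤ 16 * d ^ 2, ‖∑ σ : K →ₐ[ℚ] ℂ, σ x ^ i‖ < 2 * d := by
      intro i hi
      have h1 : ∀ σ ∈ (Finset.univ : Finset (K →ₐ[ℚ] ℂ)), ‖σ x ^ i‖ ≤
          intMahler R ^ (16 * d ^ 2) := by
        intro σ _
        rw [norm_pow]
        exact (pow_le_pow_left₀ (norm_nonneg _) (hnorm σ) i).trans (pow_le_pow_right₀ hM1 hi)
      refine ((norm_sum_le _ _).trans (Finset.sum_le_card_nsmul _ _ _ h1)).trans_lt ?_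
      rw [Finset.card_univ, hcard, nsmul_eq_mul, mul_comm]
      have : (0 : ℝ) < d := by exact_mod_cast Nat.pos_of_ne_zero hd0
      gcongr
    obtain ⟨m, hm⟩ := exists_sum_embeddings_eq_int (hxint.pow j)
    obtain ⟨m', hm'⟩ := exists_sum_embeddings_eq_int (hxint.pow (p * j))
    have hdvd := int_dvd_sum_embeddings_sub (hxint.pow j) hp hm (m' := m') (by
      rw [← hm']
      refine Finset.sum_congr rfl fun σ _ => ?_
      rw [map_pow, map_pow, ← pow_mul, mul_comm])
    simp only [map_pow] at hm hm'
    have hb1 := hbound j (by nlinarith)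
    have hb2 := hbound (p * j) (by nlinarith)
    rw [hm, Complex.norm_intCast] at hb1
    rw [hm', Complex.norm_intCast] at hb2
    have hb1' : |m| < 2 * d := by exact_mod_cast hb1
    have hb2' : |m'| < 2 * d := by exact_mod_cast hb2
    have hmm : m' - m = 0 := by
      refine Int.eq_zero_of_abs_lt_dvd hdvd ?_
      have := abs_sub m' m
      have : (4 * d : ℤ) < p := by exact_mod_cast hp4
      omega
    simp only [← pow_mul]
    rw [hm', hm, sub_eq_zero.1 hmm]
  -- hence `δ` is the `p`-th power of a conjugate
  have hexists : ∃ σ : K →ₐ[ℚ] ℂ, σ x ^ p = δ := by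
    by_contra! hcon
    classical
    let A : Finset ℂ := Finset.univ.image (fun σ : K →ₐ[ℚ] ℂ => σ x) ∪
      Finset.univ.image (fun σ : K →ₐ[ℚ] ℂ => σ x ^ p)
    let f : ℂ[X] := ∏ y ∈ A.erase δ, (X - C y)
    have hδA : δ ∈ A := Finset.mem_union_left _
      (Finset.mem_image.2 ⟨K.val, Finset.mem_univ _, rfl⟩)
    have hfdeg : f.natDegree < 2 * d := by
      rw [natDegree_prod_of_monic _ _ fun y _ => monic_X_sub_C y]
      simp only [natDegree_X_sub_C, Finset.sum_const, smul_eq_mul, mul_one]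
      rw [Finset.card_erase_of_mem hδA]
      have h1 : A.card ≤ d + d := by
        refine (Finset.card_union_le _ _).trans (add_le_add ?_ ?_) <;>
        · refine Finset.card_image_le.trans ?_
          rw [Finset.card_univ, hcard]
      omega
    have hfev : ∀ y ∈ A, y ≠ δ → f.eval y = 0 := by
      intro y hy hyδ
      rw [eval_prod]
      exact Finset.prod_eq_zero (Finset.mem_erase.2 ⟨hyδ, hy⟩) (by simp)
    have hfδ : f.eval δ ≠ 0 := by
      rw [eval_prod, Finset.prod_ne_zero_iff]
      intro y hy
      simpa [sub_eq_zero] using (Finset.mem_erase.1 hy).1.symm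
    have hfsum : ∑ σ : K →ₐ[ℚ] ℂ, f.eval (σ x ^ p) = ∑ σ : K →ₐ[ℚ] ℂ, f.eval (σ x) := by
      simp_rw [eval_eq_sum_range' hfdeg]
      rw [Finset.sum_comm, Finset.sum_comm (t := Finset.range (2 * d))]
      refine Finset.sum_congr rfl fun j hj => ?_
      rw [← Finset.mul_sum, ← Finset.mul_sum, hsum j (Finset.mem_range.1 hj)]
    have hleft : ∑ σ : K →ₐ[ℚ] ℂ, f.eval (σ x ^ p) = 0 := Finset.sum_eq_zero fun σ _ =>
      hfev _ (Finset.mem_union_right _ (Finset.mem_image.2 ⟨σ, Finset.mem_univ _, rfl⟩)) (hcon σ)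
    have hright : ∑ σ : K →ₐ[ℚ] ℂ, f.eval (σ x) = f.eval δ := by
      refine Finset.sum_eq_single K.val (fun σ _ hσ1 => ?_)
        (fun h => absurd (Finset.mem_univ _) h)
      refine hfev _ (Finset.mem_union_left _ (Finset.mem_image.2 ⟨σ, Finset.mem_univ _, rfl⟩)) ?_
      intro h
      apply hσ1
      refine IntermediateField.algHom_ext_of_eq_adjoin ℚ (S := K) (s := {δ}) rfl ?_
      rintro y rfl
      exact h
    exact hfδ (by rw [← hright, ← hfsum, hleft])
  obtain ⟨σ, hσδ⟩ := hexists
  -- the roots are permuted by the `p`-th power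
  have hstep : ∀ y : ℂ, aeval y R = 0 → aeval (y ^ p) R = 0 := by
    intro y hy
    have := hR.aeval_eq_zero_of_root (hσ σ) hy
      (f := (R.map (Int.castRingHom ℚ)).comp (X ^ p)) (by
        rw [aeval_comp, map_pow, aeval_X, aeval_map_rat, hσδ, hδ])
    rwa [aeval_comp, map_pow, aeval_X, aeval_map_rat] at this
  have hall : ∀ k : ℕ, aeval (δ ^ p ^ k) R = 0 := by
    intro k
    induction k with
    | zero => simpa using hδ
    | succ k ih => rw [pow_succ, pow_mul]; exact hstep _ ih
  have hfin : Set.Finite {y : ℂ | aeval y R = 0} := by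
    refine ((R.map (Int.castRingHom ℂ)).roots.toFinset.finite_toSet).subset fun y hy => ?_
    simpa using (mem_complex_roots hR.ne_zero).2 hy
  obtain ⟨k, -, l, -, hkl, heq⟩ := Set.infinite_univ.exists_ne_map_eq_of_mapsTo
    (f := fun k : ℕ => δ ^ p ^ k) (fun k _ => hall k) hfin
  have key : ∀ k l : ℕ, k < l → δ ^ p ^ k = δ ^ p ^ l → False := by
    intro k l hkl heq
    have h1 := Nat.pow_lt_pow_right hp.one_lt hkl
    refine hδ1 (p ^ l - p ^ k) (by omega) ?_
    have h2 : δ ^ p ^ k * δ ^ (p ^ l - p ^ k) = δ ^ p ^ k * 1 := by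
      rw [← pow_add, mul_one, Nat.add_sub_cancel' h1.le, heq]
    exact mul_left_cancel₀ (pow_ne_zero _ hδ0) h2
  rcases lt_or_gt_of_ne hkl with h | h
  · exact key k l h heq
  · exact key l k h heq.symm

/-! ### Roots of a number inside its own field -/

lemma mem_adjoin_simple_iff_aeval {α : ℂ} (hα : IsAlgebraic ℚ α) {x : ℂ} :
    x ∈ ℚ⟮α⟯ ↔ ∃ g : ℚ[X], aeval α g = x := by
  rw [← IntermediateField.mem_toSubalgebra, adjoin_simple_toSubalgebra_of_isAlgebraic hα,
    Algebra.adjoin_singleton_eq_range_aeval]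
  rfl

lemma isAlgebraic_of_aeval_int {R : ℤ[X]} (hR : R ≠ 0) {α : ℂ} (hα : aeval α R = 0) :
    IsAlgebraic ℚ α :=
  ⟨R.map (Int.castRingHom ℚ), (Polynomial.map_ne_zero_iff (RingHom.injective_int _)).2 hR, by
    rw [aeval_map_rat, hα]⟩

/-- If `γ` has a `p`-th root in a field for each prime `p` of a finite set, it has a `∏ p`-th root
in that field. -/
lemma exists_pow_prod_eq {K : Type*} [Field K] {γ : K} (hγ : γ ≠ 0) (T : Finset ℕ)
    (hT : ∀ p ∈ T, p.Prime) (h : ∀ p ∈ T, ∃ α : K, α ^ p = γ) : ∃ δ : K, δ ^ (∏ p ∈ T, p) = γ := by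
  classical
  induction T using Finset.induction_on with
  | empty => exact ⟨γ, by simp⟩
  | insert p T hpT ih =>
    obtain ⟨δ, hδ⟩ := ih (fun q hq => hT q (Finset.mem_insert_of_mem hq))
      (fun q hq => h q (Finset.mem_insert_of_mem hq))
    obtain ⟨α, hα⟩ := h p (Finset.mem_insert_self _ _)
    set A := ∏ q ∈ T, q
    have hcop : IsCoprime (A : ℤ) (p : ℤ) := by
      rw [Nat.isCoprime_iff_coprime]
      refine Nat.Coprime.prod_left fun q hq => ?_
      refine (Nat.coprime_primes (hT q (Finset.mem_insert_of_mem hq))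
        (hT p (Finset.mem_insert_self _ _))).2 ?_
      rintro rfl
      exact hpT hq
    obtain ⟨u, v, huv⟩ := hcop
    refine ⟨α ^ u * δ ^ v, ?_⟩
    have hp0 : p ≠ 0 := (hT p (Finset.mem_insert_self _ _)).ne_zero
    rw [Finset.prod_insert hpT, mul_pow, ← zpow_natCast, ← zpow_natCast, ← zpow_mul, ← zpow_mul]
    have e1 : α ^ (u * ((p * A : ℕ) : ℤ)) = γ ^ (u * A) := by
      rw [← hα, ← zpow_natCast α p, ← zpow_mul]
      push_cast
      ring_nf
    have hA0 : A ≠ 0 := Finset.prod_ne_zero_iff.2 fun q hq =>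
      (hT q (Finset.mem_insert_of_mem hq)).ne_zero
    have e2 : δ ^ (v * ((p * A : ℕ) : ℤ)) = γ ^ (v * p) := by
      rw [← hδ, ← zpow_natCast δ A, ← zpow_mul]
      push_cast
      ring_nf
    rw [e1, e2, ← zpow_add₀ hγ, huv, zpow_one]

/-- A root `γ` of `V` which is neither zero nor a root of unity is a `p`-th power in `ℚ(γ)` for
few primes `p` only. -/
theorem two_pow_card_le_of_roots_mem {V : ℤ[X]} (hV : Irreducible V) {γ : ℂ}
    (hγ : aeval γ V = 0) (hγ0 : γ ≠ 0) (hγ1 : ∀ m : ℕ, 0 < m → γ ^ m ≠ 1) (T : Finset ℕ)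
    (hT : ∀ p ∈ T, p.Prime) (h : ∀ p ∈ T, ∃ g : ℚ[X], aeval γ g ^ p = γ) :
    (2 : ℝ) ^ 2 ^ T.card ≤ intMahler V ^ (16 * V.natDegree ^ 2) := by
  have halg := isAlgebraic_of_aeval_int hV.ne_zero hγ
  let γ' : ℚ⟮γ⟯ := AdjoinSimple.gen ℚ γ
  have hγ'0 : γ' ≠ 0 := fun h0 => hγ0 (congrArg Subtype.val h0)
  obtain ⟨δ', hδ'⟩ := exists_pow_prod_eq (K := ℚ⟮γ⟯) hγ'0 T hT (by
    intro p hp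
    obtain ⟨g, hg⟩ := h p hp
    exact ⟨⟨aeval γ g, (mem_adjoin_simple_iff_aeval halg).2 ⟨g, rfl⟩⟩, Subtype.ext hg⟩)
  set A := ∏ p ∈ T, p
  have hA0 : 0 < A := Finset.prod_pos fun p hp => (hT p hp).pos
  set δ : ℂ := δ'.1
  have hδ : δ ^ A = γ := congrArg Subtype.val hδ'
  obtain ⟨g, hg⟩ := (mem_adjoin_simple_iff_aeval halg).1 δ'.2
  have hδalg : IsAlgebraic ℚ δ := by
    refine IsAlgebraic.of_pow hA0 ?_
    rw [hδ]; exact halg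
  obtain ⟨R, hR, hRδ⟩ := exists_irreducible_int_of_isAlgebraic hδalg
  obtain ⟨hdeg, hM⟩ := intMahler_pow_le hR hV hRδ hA0 (by rw [hδ, hγ]) (g := g) (by rw [hδ, hg])
  have hδ0 : δ ≠ 0 := by
    intro h0
    rw [h0, zero_pow hA0.ne'] at hδ
    exact hγ0 hδ.symm
  have hlow := two_le_intMahler_pow hR hRδ hδ0 (by
    intro m hm h1
    apply hγ1 m hm
    rw [← hδ, ← pow_mul, mul_comm, pow_mul, h1, one_pow])
  rw [hdeg]
  have hcard : 2 ^ T.card ≤ A := by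
    rw [← Finset.prod_const]
    exact Finset.prod_le_prod' fun p hp => (hT p hp).two_le
  calc (2 : ℝ) ^ 2 ^ T.card ≤ 2 ^ A := pow_le_pow_right₀ one_le_two hcard
    _ ≤ (intMahler R ^ (16 * R.natDegree ^ 2)) ^ A := by gcongr
    _ = (intMahler R ^ A) ^ (16 * R.natDegree ^ 2) := by rw [← pow_mul, ← pow_mul, mul_comm]
    _ ≤ _ := by
      have := zero_le_one.trans (one_le_intMahler hR.ne_zero)
      gcongr

/-! ### Primes for which the power map preserves the field -/

/-- The prime `p` is good for the irreducible polynomial `R` if it does not divide the degree of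
`R` and if the field generated by a root of `R` contains no primitive `p`-th root of unity. -/
def IsGoodPrime (R : ℤ[X]) (p : ℕ) : Prop :=
  p.Prime ∧ ¬ p ∣ R.natDegree ∧
    ∀ f : ℚ[X], R.map (Int.castRingHom ℚ) ∣ f ^ p - 1 → R.map (Int.castRingHom ℚ) ∣ f - 1

lemma IsGoodPrime.aeval_eq_one {R : ℤ[X]} {p : ℕ} (hp : IsGoodPrime R p) (hR : Irreducible R)
    {α : ℂ} (hα : aeval α R = 0) {f : ℚ[X]} (h : aeval α f ^ p = 1) : aeval α f = 1 := by
  have := hp.2.2 f ((hR.map_rat_dvd_iff hα _).2 (by simp [h]))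
  rw [hR.map_rat_dvd_iff hα] at this
  simpa [sub_eq_zero] using this

lemma finrank_mul_finrank_adjoin_simple {F E : Type*} [Field F] [Field E] [Algebra F E]
    (K : IntermediateField F E) {α : E} (hle : K ≤ F⟮α⟯) :
    Module.finrank F K * Module.finrank K K⟮α⟯ = Module.finrank F F⟮α⟯ := by
  have hL : (K⟮α⟯).restrictScalars F = F⟮α⟯ := by
    rw [IntermediateField.restrictScalars_adjoin]
    refine le_antisymm (adjoin_le_iff.2 ?_) (adjoin.mono _ _ _ Set.subset_union_right)
    rintro y (hy | rfl)
    · exact hle hy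
    · exact mem_adjoin_simple_self F _
  rw [Module.finrank_mul_finrank, ← hL]
  rfl

/-- For a good prime `p`, the field `ℚ(α ^ p)` is `ℚ(α)`. -/
theorem IsGoodPrime.exists_aeval_pow_eq {R : ℤ[X]} {p : ℕ} (hp : IsGoodPrime R p)
    (hR : Irreducible R) {α : ℂ} (hα : aeval α R = 0) (hα0 : α ≠ 0) :
    ∃ g : ℚ[X], aeval (α ^ p) g = α := by
  have halg := isAlgebraic_of_aeval_int hR.ne_zero hα
  have halgp : IsAlgebraic ℚ (α ^ p) := halg.pow p
  rw [← mem_adjoin_simple_iff_aeval halgp]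
  set K₀ := ℚ⟮α ^ p⟯ with hK₀
  have hle : K₀ ≤ ℚ⟮α⟯ := adjoin_simple_le_iff.2 (pow_mem (mem_adjoin_simple_self ℚ α) p)
  let c : K₀ := AdjoinSimple.gen ℚ (α ^ p)
  by_cases hb : ∃ b : K₀, b ^ p = c
  · obtain ⟨b, hb⟩ := hb
    have hb' : (b : ℂ) ^ p = α ^ p := congrArg Subtype.val hb
    have hb0 : (b : ℂ) ≠ 0 := by
      intro h0
      rw [h0, zero_pow hp.1.ne_zero] at hb'
      exact pow_ne_zero p hα0 hb'.symm
    obtain ⟨f, hf⟩ := (mem_adjoin_simple_iff_aeval halg).1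
      (div_mem (mem_adjoin_simple_self ℚ α) (hle b.2))
    have h1 := hp.aeval_eq_one hR hα (f := f) (by
      rw [hf, div_pow, hb', div_self (pow_ne_zero p hα0)])
    rw [hf, div_eq_one_iff_eq hb0] at h1
    rw [h1]
    exact b.2
  · exfalso
    push Not at hb
    have hirr := X_pow_sub_C_irreducible_of_prime hp.1 hb
    have hmin := minpoly.eq_of_irreducible_of_monic (x := α) hirr (by
      simp only [map_sub, map_pow, aeval_X, aeval_C]
      exact sub_eq_zero.2 rfl) (monic_X_pow_sub_C _ hp.1.ne_zero)
    have hint : IsIntegral K₀ α := halg.isIntegral.tower_top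
    have hfr : Module.finrank K₀ K₀⟮α⟯ = p := by
      rw [adjoin.finrank hint, ← hmin, natDegree_X_pow_sub_C]
    have hmul := finrank_mul_finrank_adjoin_simple K₀ hle
    rw [hfr, adjoin.finrank halg.isIntegral, ← minpoly.eq_of_irreducible
      (hR.map_rat_irreducible hα) (by rw [aeval_map_rat, hα]), natDegree_mul_C
      (inv_ne_zero (leadingCoeff_ne_zero.2 (hR.map_rat_irreducible hα).ne_zero)),
      natDegree_map_eq_of_injective (RingHom.injective_int _)] at hmul
    exact hp.2.1 (Dvd.intro_left _ hmul)

/-- Few odd primes fail to be good. -/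
theorem two_pow_card_not_isGoodPrime_le {R : ℤ[X]} (hR : Irreducible R) {α : ℂ}
    (hα : aeval α R = 0) (T : Finset ℕ) (hT : ∀ p ∈ T, p.Prime ∧ p ≠ 2)
    (h : ∀ p ∈ T, ¬ IsGoodPrime R p) : 2 ^ T.card ≤ R.natDegree ^ 2 := by
  classical
  have hd := hR.natDegree_ne_zero_of_aeval_eq_zero hα
  have halg := isAlgebraic_of_aeval_int hR.ne_zero hα
  set T₁ := T.filter (· ∣ R.natDegree)
  set T₂ := T.filter (fun p => ¬ p ∣ R.natDegree)
  have hcard : T₁.card + T₂.card = T.card := Finset.card_filter_add_card_filter_not _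
  have h1 : 2 ^ T₁.card ≤ R.natDegree := by
    have h3 : ∏ p ∈ T₁, p ∣ R.natDegree :=
      Finset.prod_primes_dvd _ (fun p hp => (hT p (Finset.mem_filter.1 hp).1).1.prime)
        (fun p hp => (Finset.mem_filter.1 hp).2)
    refine le_trans ?_ (Nat.le_of_dvd (Nat.pos_of_ne_zero hd) h3)
    rw [← Finset.prod_const]
    exact Finset.prod_le_prod' fun p hp => (hT p (Finset.mem_filter.1 hp).1).1.two_le
  have : FiniteDimensional ℚ ℚ⟮α⟯ := adjoin.finiteDimensional halg.isIntegral
  have h2 : 2 ^ T₂.card ≤ R.natDegree := by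
    -- a primitive root of unity of order the product of the primes in `T₂`
    have hprim : ∀ p ∈ T₂, ∃ z : ℚ⟮α⟯, IsPrimitiveRoot z p := by
      intro p hp
      obtain ⟨hpT, hpd⟩ := Finset.mem_filter.1 hp
      have hpp := (hT p hpT).1
      have := h p hpT
      unfold IsGoodPrime at this
      push Not at this
      obtain ⟨f, hf1, hf2⟩ := this hpp hpd
      rw [hR.map_rat_dvd_iff hα] at hf1 hf2
      refine ⟨⟨aeval α f, (mem_adjoin_simple_iff_aeval halg).2 ⟨f, rfl⟩⟩, ?_⟩
      have e1 : aeval α f ^ p = 1 := by simpa [sub_eq_zero] using hf1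
      have e2 : aeval α f ≠ 1 := by simpa [sub_eq_zero] using hf2
      have := Fact.mk hpp
      refine IsPrimitiveRoot.iff_orderOf.2 (orderOf_eq_prime (Subtype.ext e1) ?_)
      intro h0
      exact e2 (congrArg Subtype.val h0)
    have hprod : ∀ U ⊆ T₂, ∃ z : ℚ⟮α⟯, orderOf z = ∏ p ∈ U, p := by
      intro U
      induction U using Finset.induction_on with
      | empty => exact fun _ => ⟨1, by simp⟩
      | insert p U hpU ih =>
        intro hU
        obtain ⟨z, hz⟩ := ih ((Finset.subset_insert _ _).trans hU)
        have hpT := hU (Finset.mem_insert_self _ _)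
        obtain ⟨y, hy⟩ := hprim p hpT
        refine ⟨y * z, ?_⟩
        rw [Finset.prod_insert hpU, (Commute.all y z).orderOf_mul_eq_mul_orderOf_of_coprime,
          ← hy.eq_orderOf, hz]
        rw [← hy.eq_orderOf, hz]
        refine Nat.Coprime.prod_right fun q hq => ?_
        have hqT := hU (Finset.mem_insert_of_mem hq)
        refine (Nat.coprime_primes (hT p (Finset.mem_filter.1 hpT).1).1
          (hT q (Finset.mem_filter.1 hqT).1).1).2 ?_
        rintro rfl
        exact hpU hq
    have htot : ∀ U ⊆ T₂, 2 ^ U.card ≤ Nat.totient (∏ p ∈ U, p) := by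
      intro U
      induction U using Finset.induction_on with
      | empty => simp
      | insert p U hpU ih =>
        intro hU
        have hpT := hU (Finset.mem_insert_self _ _)
        obtain ⟨hpp, hp2⟩ := hT p (Finset.mem_filter.1 hpT).1
        rw [Finset.prod_insert hpU, Finset.card_insert_of_notMem hpU, pow_succ', Nat.totient_mul,
          Nat.totient_prime hpp]
        · exact Nat.mul_le_mul (by have := hpp.two_le; omega)
            (ih ((Finset.subset_insert _ _).trans hU))
        · refine Nat.Coprime.prod_right fun q hq => ?_
          have hqT := hU (Finset.mem_insert_of_mem hq)
          refine (Nat.coprime_primes hpp (hT q (Finset.mem_filter.1 hqT).1).1).2 ?_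
          rintro rfl
          exact hpU hq
    obtain ⟨z, hz⟩ := hprod T₂ subset_rfl
    have hpos : 0 < ∏ p ∈ T₂, p :=
      Finset.prod_pos fun p hp => (hT p (Finset.mem_filter.1 hp).1).1.pos
    have hzp : IsPrimitiveRoot z (∏ p ∈ T₂, p) := IsPrimitiveRoot.iff_orderOf.2 hz
    have h4 := minpoly.natDegree_le (A := ℚ) z
    rw [← cyclotomic_eq_minpoly_rat hzp hpos, natDegree_cyclotomic, adjoin.finrank halg.isIntegral,
      ← minpoly.eq_of_irreducible (hR.map_rat_irreducible hα) (by rw [aeval_map_rat, hα]),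
      natDegree_mul_C
      (inv_ne_zero (leadingCoeff_ne_zero.2 (hR.map_rat_irreducible hα).ne_zero)),
      natDegree_map_eq_of_injective (RingHom.injective_int _)] at h4
    exact (htot T₂ subset_rfl).trans h4
  rw [← hcard, pow_add, sq]
  exact Nat.mul_le_mul h1 h2

end

section

open UniqueFactorizationMonoid

/-! ### Counting the minimal polynomials of powers -/

lemma prod_normalizedFactors_pow_count {P : ℤ[X]} (hP : P ≠ 0) :
    Associated (∏ V ∈ (normalizedFactors P).toFinset, V ^ (normalizedFactors P).count V) P := by
  rw [← Finset.prod_multiset_count]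
  exact prod_normalizedFactors hP

lemma intMahler_prod {ι : Type*} (s : Finset ι) (f : ι → ℤ[X]) :
    intMahler (∏ i ∈ s, f i) = ∏ i ∈ s, intMahler (f i) := by
  classical
  induction s using Finset.induction_on with
  | empty => simp [intMahler_one]
  | insert i s hi ih => rw [Finset.prod_insert hi, Finset.prod_insert hi, intMahler_mul, ih]

lemma normalizedFactors_ne_zero {P V : ℤ[X]} (hV : V ∈ (normalizedFactors P).toFinset) : V ≠ 0 :=
  (irreducible_of_normalized_factor V (Multiset.mem_toFinset.1 hV)).ne_zero

lemma sum_count_mul_natDegree {P : ℤ[X]} (hP : P ≠ 0) :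
    ∑ V ∈ (normalizedFactors P).toFinset, (normalizedFactors P).count V * V.natDegree =
      P.natDegree := by
  have h := natDegree_eq_of_degree_eq (degree_eq_degree_of_associated
    (prod_normalizedFactors_pow_count hP))
  rw [natDegree_prod _ _ fun V hV => pow_ne_zero _ (normalizedFactors_ne_zero hV)] at h
  rw [← h]
  exact Finset.sum_congr rfl fun V _ => (natDegree_pow _ _).symm

lemma sum_count_mul_log_intMahler_le {P : ℤ[X]} (hP : P ≠ 0) :
    ∑ V ∈ (normalizedFactors P).toFinset, (normalizedFactors P).count V * Real.log (intMahler V) ≤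
      Real.log (intMahler P) := by
  have h1 := intMahler_le_of_dvd hP (prod_normalizedFactors_pow_count hP).dvd
  rw [intMahler_prod] at h1
  have hpos : ∀ V ∈ (normalizedFactors P).toFinset, 0 < intMahler V := fun V hV =>
    zero_lt_one.trans_le (one_le_intMahler (normalizedFactors_ne_zero hV))
  have h2 := Real.log_le_log (Finset.prod_pos fun V hV => by
    rw [intMahler_pow]; exact pow_pos (hpos V hV) _) h1
  rw [Real.log_prod fun V hV => by rw [intMahler_pow]; exact (pow_pos (hpos V hV) _).ne'] at h2
  refine le_trans (le_of_eq (Finset.sum_congr rfl fun V _ => ?_)) h2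
  rw [intMahler_pow, Real.log_pow]

lemma exists_normalizedFactor_root {P : ℤ[X]} (hP : P ≠ 0) {γ : ℂ} (hγ : aeval γ P = 0) :
    ∃ V ∈ (normalizedFactors P).toFinset, aeval γ V = 0 := by
  obtain ⟨u, hu⟩ := prod_normalizedFactors_pow_count hP
  have h1 := congrArg (aeval γ) hu
  rw [map_mul, hγ, mul_eq_zero] at h1
  rcases h1 with h1 | h1
  · rw [map_prod, Finset.prod_eq_zero_iff] at h1
    obtain ⟨V, hV, h2⟩ := h1
    refine ⟨V, hV, ?_⟩
    rw [map_pow] at h2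
    exact eq_zero_of_pow_eq_zero h2
  · exact absurd h1 (u.isUnit.map (aeval γ : ℤ[X] →ₐ[ℤ] ℂ)).ne_zero

/-- Two irreducible polynomials for which `p` is good, and whose `p`-th powers of roots have the
same minimal polynomial, are associated. -/
lemma IsGoodPrime.associated {R R' V : ℤ[X]} {p : ℕ} (hR : Irreducible R) (hR' : Irreducible R')
    (hV : Irreducible V) (hp : IsGoodPrime R p) (hp' : IsGoodPrime R' p) {α α' : ℂ}
    (hα : aeval α R = 0) (hα' : aeval α' R' = 0) (hα0 : α ≠ 0) (hα0' : α' ≠ 0)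
    (hVα : aeval (α ^ p) V = 0) (hVα' : aeval (α' ^ p) V = 0) : Associated R R' := by
  obtain ⟨g', hg'⟩ := hp'.exists_aeval_pow_eq hR' hα' hα0'
  set γ := α ^ p
  -- the root `x'` of `R'` with `x' ^ p = γ`
  set x' := aeval γ g'
  have h1 : x' ^ p = γ := by
    have := hV.aeval_eq_zero_of_root hVα' hVα (f := g' ^ p - X) (by simp [hg'])
    simpa [sub_eq_zero] using this
  have h2 : aeval x' R' = 0 := by
    have := hV.aeval_eq_zero_of_root hVα' hVα (f := (R'.map (Int.castRingHom ℚ)).comp g') (by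
      rw [aeval_comp, hg', aeval_map_rat, hα'])
    rwa [aeval_comp, aeval_map_rat] at this
  have halg := isAlgebraic_of_aeval_int hR.ne_zero hα
  have hx'mem : x' ∈ IntermediateField.adjoin ℚ {α} :=
    (mem_adjoin_simple_iff_aeval halg).2 ⟨g'.comp (X ^ p), by
      rw [aeval_comp, map_pow, aeval_X]⟩
  obtain ⟨f, hf⟩ := (mem_adjoin_simple_iff_aeval halg).1
    (div_mem hx'mem (IntermediateField.mem_adjoin_simple_self ℚ α))
  have h3 := hp.aeval_eq_one hR hα (f := f) (by
    rw [hf, div_pow, h1, div_self (pow_ne_zero _ hα0)])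
  rw [hf, div_eq_one_iff_eq hα0] at h3
  rw [h3] at h2
  exact associated_of_dvd_dvd ((hR.dvd_iff_aeval hα _).2 h2) ((hR'.dvd_iff_aeval h2 _).2 hα)

/-- **Counting.** Let `R ^ k_R` divide all `P^{[j]}(T ^ p)` with `j < t` and `p ∈ ps`, for the
polynomials `R` of a finite set `L`. The minimal polynomials `V` of the `p`-th powers of the roots
of the `R ∈ L` divide `P` to the power `k_R + t - 1`, and each `V` arises at most `r₀` times from a
good prime. -/
theorem sum_good_primes_le {P : ℤ[X]} (hP : P ≠ 0) (L : Finset ℤ[X]) (k : ℤ[X] → ℕ) {t : ℕ}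
    (ht : 0 < t) (ps : Finset ℕ)
    (hL : ∀ R ∈ L, Irreducible R ∧ 0 < k R ∧
      ∃ α : ℂ, aeval α R = 0 ∧ α ≠ 0 ∧ ∀ m : ℕ, 0 < m → α ^ m ≠ 1)
    (hass : ∀ R ∈ L, ∀ R' ∈ L, Associated R R' → R = R')
    (hdvd : ∀ R ∈ L, ∀ p ∈ ps, ∀ j < t, R ^ k R ∣ (hasseDeriv j P).comp (X ^ p)) {r₀ : ℕ}
    (hr₀ : ∀ r : ℕ, (2 : ℝ) ^ 2 ^ r ≤ intMahler P ^ (16 * P.natDegree ^ 2) → r ≤ r₀)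
    (w : ℤ[X] → ℝ) (hw : ∀ V, V ≠ 0 → 0 ≤ w V) (u : ℤ[X] → ℕ → ℝ)
    (hu : ∀ R p V, R ≠ 0 → V ≠ 0 → V.natDegree = R.natDegree → intMahler R ^ p ≤ intMahler V →
      u R p ≤ w V) [∀ R, DecidablePred (IsGoodPrime R)] :
    ∑ R ∈ L, ∑ p ∈ ps with IsGoodPrime R p, ((k R + t - 1 : ℕ) : ℝ) * u R p ≤
      r₀ * ∑ V ∈ (normalizedFactors P).toFinset, (normalizedFactors P).count V * w V := by
  classical
  choose! hirr hk α hα hα0 hα1 using hL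
  have hroot : ∀ R ∈ L, ∀ p ∈ ps, p.Prime → aeval (α R ^ p) P = 0 := by
    intro R hR p hp hpp
    have h1 := hdvd R hR p hp 0 ht
    rw [hasseDeriv_zero'] at h1
    obtain ⟨G, hG⟩ := (dvd_pow_self R (hk R hR).ne').trans h1
    have h2 := congrArg (aeval (α R)) hG
    rw [map_mul, hα R hR, zero_mul, aeval_comp, map_pow, aeval_X] at h2
    exact h2
  have hex : ∀ q : ℤ[X] × ℕ, q.1 ∈ L → q.2 ∈ ps → q.2.Prime →
      ∃ V ∈ (normalizedFactors P).toFinset, aeval (α q.1 ^ q.2) V = 0 :=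
    fun q h1 h2 h3 => exists_normalizedFactor_root hP (hroot _ h1 _ h2 h3)
  choose! v hv1 hv2 using hex
  set Ω := L.sigma fun R => ps.filter (IsGoodPrime R) with hΩ
  have hmem : ∀ q ∈ Ω, q.1 ∈ L ∧ q.2 ∈ ps ∧ IsGoodPrime q.1 q.2 := by
    intro q hq
    rw [hΩ, Finset.mem_sigma, Finset.mem_filter] at hq
    exact hq
  have hvirr : ∀ V ∈ (normalizedFactors P).toFinset, Irreducible V := fun V hV =>
    irreducible_of_normalized_factor V (Multiset.mem_toFinset.1 hV)
  rw [Finset.sum_sigma', ← hΩ]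
  have hstep1 : ∀ q ∈ Ω, ((k q.1 + t - 1 : ℕ) : ℝ) * u q.1 q.2 ≤
      (normalizedFactors P).count (v (q.1, q.2)) * w (v (q.1, q.2)) := by
    intro q hq
    obtain ⟨hq1, hq2, hq3⟩ := hmem q hq
    have hV := hv1 (q.1, q.2) hq1 hq2 hq3.1
    have hVα := hv2 (q.1, q.2) hq1 hq2 hq3.1
    obtain ⟨g, hg⟩ := hq3.exists_aeval_pow_eq (hirr _ hq1) (hα _ hq1) (hα0 _ hq1)
    obtain ⟨hdeg, hM⟩ := intMahler_pow_le (hirr _ hq1) (hvirr _ hV) (hα _ hq1) hq3.1.pos hVα hg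
    have h1 := hu q.1 q.2 _ (hirr _ hq1).ne_zero (hvirr _ hV).ne_zero hdeg hM
    have h2 := pow_dvd_of_pow_dvd_hasseDeriv_comp hP (hvirr _ hV) (hα0 _ hq1) (hα _ hq1) hq3.1.pos
      (hk _ hq1) ht hVα (hdvd _ hq1 _ hq2)
    have h3 : k q.1 + t - 1 ≤ (normalizedFactors P).count (v (q.1, q.2)) := by
      rw [pow_dvd_iff_le_emultiplicity, emultiplicity_eq_count_normalizedFactors (hvirr _ hV) hP,
        normalize_normalized_factor _ (Multiset.mem_toFinset.1 hV)] at h2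
      exact_mod_cast h2
    have h4 : (k q.1 + t - 1 : ℕ) * u q.1 q.2 ≤ (k q.1 + t - 1 : ℕ) * w (v (q.1, q.2)) := by gcongr
    refine h4.trans ?_
    have := hw _ (hvirr _ hV).ne_zero
    gcongr
  refine (Finset.sum_le_sum hstep1).trans ?_
  have hmaps : ∀ q ∈ Ω, v (q.1, q.2) ∈ (normalizedFactors P).toFinset := fun q hq =>
    hv1 (q.1, q.2) (hmem q hq).1 (hmem q hq).2.1 (hmem q hq).2.2.1
  rw [← Finset.sum_fiberwise_of_maps_to hmaps, Finset.mul_sum]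
  refine Finset.sum_le_sum fun V hV => ?_
  have hconst : ∀ q ∈ Ω.filter (fun q => v (q.1, q.2) = V),
      (normalizedFactors P).count (v (q.1, q.2)) * w (v (q.1, q.2)) =
        (normalizedFactors P).count V * w V := by
    intro q hq
    rw [(Finset.mem_filter.1 hq).2]
  rw [Finset.sum_congr rfl hconst, Finset.sum_const, nsmul_eq_mul]
  have hwV := hw V (hvirr V hV).ne_zero
  refine mul_le_mul_of_nonneg_right ?_ (by positivity)
  rw [Nat.cast_le]
  set Φ := Ω.filter (fun q => v (q.1, q.2) = V)
  -- for a given prime there is at most one pair above `V`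
  have hinj : Set.InjOn (fun q : (_ : ℤ[X]) × ℕ => q.2) (Φ : Set ((_ : ℤ[X]) × ℕ)) := by
    rintro ⟨R, p⟩ hq ⟨R', p'⟩ hq' (rfl : p = p')
    obtain ⟨hqΩ, hqV⟩ := Finset.mem_filter.1 (Finset.mem_coe.1 hq)
    obtain ⟨hqΩ', hqV'⟩ := Finset.mem_filter.1 (Finset.mem_coe.1 hq')
    obtain ⟨h1, h2, h3⟩ := hmem _ hqΩ
    obtain ⟨h1', h2', h3'⟩ := hmem _ hqΩ'
    have e1 := hv2 (R, p) h1 h2 h3.1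
    have e2 := hv2 (R', p) h1' h2' h3'.1
    simp only at hqV hqV' h1 h1' h3 h3'
    rw [hqV] at e1
    rw [hqV'] at e2
    have := hass R h1 R' h1' (h3.associated (hirr _ h1) (hirr _ h1') (hvirr V hV) h3' (hα _ h1)
      (hα _ h1') (hα0 _ h1) (hα0 _ h1') e1 e2)
    rw [this]
  rw [← Finset.card_image_of_injOn hinj]
  rcases Φ.eq_empty_or_nonempty with he | ⟨q₀, hq₀⟩
  · rw [he]; simp
  obtain ⟨hq₀Ω, hq₀V⟩ := Finset.mem_filter.1 hq₀
  obtain ⟨h1, h2, h3⟩ := hmem _ hq₀Ω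
  set γ := α q₀.1 ^ q₀.2
  have hγ : aeval γ V = 0 := by rw [← hq₀V]; exact hv2 (q₀.1, q₀.2) h1 h2 h3.1
  refine hr₀ _ ((two_pow_card_le_of_roots_mem (hvirr V hV) hγ (pow_ne_zero _ (hα0 _ h1))
    (fun m hm => ?_) _ ?_ ?_).trans ?_)
  · rw [← pow_mul]
    exact hα1 _ h1 _ (Nat.mul_pos h3.1.pos hm)
  · intro p hp
    obtain ⟨q, hq, rfl⟩ := Finset.mem_image.1 hp
    exact (hmem q (Finset.mem_filter.1 hq).1).2.2.1
  · intro p hp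
    obtain ⟨q, hq, rfl⟩ := Finset.mem_image.1 hp
    obtain ⟨hqΩ, hqV⟩ := Finset.mem_filter.1 hq
    obtain ⟨e1, e2, e3⟩ := hmem q hqΩ
    obtain ⟨g, hg⟩ := e3.exists_aeval_pow_eq (hirr _ e1) (hα _ e1) (hα0 _ e1)
    have e4 : aeval (α q.1 ^ q.2) V = 0 := by rw [← hqV]; exact hv2 (q.1, q.2) e1 e2 e3.1
    refine ⟨g, ?_⟩
    have := (hvirr V hV).aeval_eq_zero_of_root e4 hγ (f := g ^ q.2 - X) (by simp [hg])
    simpa [sub_eq_zero] using this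
  · have hVP : V ∣ P := dvd_of_mem_normalizedFactors (Multiset.mem_toFinset.1 hV)
    have hM := intMahler_le_of_dvd hP hVP
    have hd := natDegree_le_of_dvd hVP hP
    have h0 := one_le_intMahler (hvirr V hV).ne_zero
    calc intMahler V ^ (16 * V.natDegree ^ 2) ≤ intMahler V ^ (16 * P.natDegree ^ 2) :=
          pow_le_pow_right₀ h0 (by gcongr)
      _ ≤ _ := by gcongr

/-! ### Powers of a number close to a root of unity -/

/-- A nontrivial `b`-th root of unity is at distance at least `1 / b` from `1`. -/
lemma inv_le_norm_one_sub_of_pow_eq_one {ω : ℂ} {b : ℕ} (hb : 0 < b) (hω : ω ^ b = 1)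
    (hω1 : ω ≠ 1) : (b : ℝ)⁻¹ ≤ ‖1 - ω‖ := by
  have hnorm : ‖ω‖ = 1 := Complex.norm_eq_one_of_pow_eq_one hω hb.ne'
  have hgeom : ∑ k ∈ Finset.range b, ω ^ k = 0 := by
    have h1 := geom_sum_mul ω b
    rw [hω, sub_self, mul_eq_zero] at h1
    exact h1.resolve_right (sub_ne_zero.2 hω1)
  have hk : ∀ k : ℕ, ‖1 - ω ^ k‖ ≤ k * ‖1 - ω‖ := by
    intro k
    rw [← mul_neg_geom_sum, norm_mul, mul_comm]
    gcongr
    refine (norm_sum_le _ _).trans ?_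
    simp [hnorm]
  have h2 : (b : ℝ) ≤ b * (b * ‖1 - ω‖) := by
    have h3 : ((b : ℕ) : ℂ) = ∑ k ∈ Finset.range b, (1 - ω ^ k) := by
      rw [Finset.sum_sub_distrib, hgeom]; simp
    have h4 : (b : ℝ) = ‖∑ k ∈ Finset.range b, (1 - ω ^ k)‖ := by
      rw [← h3, Complex.norm_natCast]
    rw [h4]
    refine (norm_sum_le _ _).trans ?_
    rw [← h4]
    refine (Finset.sum_le_card_nsmul _ _ (b * ‖1 - ω‖) fun k hk' => ?_).trans ?_
    · refine (hk k).trans ?_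
      have := (Finset.mem_range.1 hk').le
      gcongr
    · rw [Finset.card_range, nsmul_eq_mul]
  have hb' : (0 : ℝ) < b := by exact_mod_cast hb
  rw [inv_le_iff_one_le_mul₀' hb']
  exact le_of_mul_le_mul_left (by linarith) hb'

/-- The root of unity `ρ`, of order `D`, is the only one of order at most `B` which can lie within
`κ` of `ξ`. -/
structure IsNearestRootOfUnity (ξ ρ : ℂ) (D B : ℕ) (κ : ℝ) : Prop where
  pos : 0 < D
  primitive : IsPrimitiveRoot ρ D
  le_norm_sub : ∀ θ : ℂ, ∀ m : ℕ, 0 < m → m ≤ B → θ ^ m = 1 → θ ≠ ρ → κ ≤ ‖ξ - θ‖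

lemma inv_sq_le_norm_sub_of_pow_eq_one {θ ρ : ℂ} {m m' B : ℕ} (hm : 0 < m) (hm' : 0 < m')
    (hmB : m ≤ B) (hmB' : m' ≤ B) (hθ : θ ^ m = 1) (hρ : ρ ^ m' = 1) (hne : θ ≠ ρ) :
    ((B : ℝ) ^ 2)⁻¹ ≤ ‖θ - ρ‖ := by
  have hn : ‖θ‖ = 1 := Complex.norm_eq_one_of_pow_eq_one hθ hm.ne'
  have hθ0 : θ ≠ 0 := by rintro rfl; simp at hn
  have h1 : ‖θ - ρ‖ = ‖1 - ρ / θ‖ := by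
    rw [show θ - ρ = θ * (1 - ρ / θ) by field_simp, norm_mul, hn, one_mul]
  have h2 := inv_le_norm_one_sub_of_pow_eq_one (ω := ρ / θ) (Nat.mul_pos hm hm')
    (by rw [div_pow, pow_mul θ, hθ, mul_comm, pow_mul, hρ]; simp)
    (by rw [Ne, div_eq_one_iff_eq hθ0]; exact hne.symm)
  rw [h1]
  refine le_trans (inv_anti₀ (by positivity) ?_) h2
  rw [sq]
  exact_mod_cast Nat.mul_le_mul hmB hmB'

lemma exists_isNearestRootOfUnity (ξ : ℂ) {B : ℕ} (hB : 0 < B) :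
    ∃ (ρ : ℂ) (D : ℕ), D ≤ B ∧ IsNearestRootOfUnity ξ ρ D B (2 * (B : ℝ) ^ 2)⁻¹ := by
  by_cases h : ∃ θ : ℂ, (∃ m : ℕ, 0 < m ∧ m ≤ B ∧ θ ^ m = 1) ∧ ‖ξ - θ‖ < (2 * (B : ℝ) ^ 2)⁻¹
  · obtain ⟨ρ, ⟨m, hm, hmB, hρ⟩, hlt⟩ := h
    have hfin : IsOfFinOrder ρ := isOfFinOrder_iff_pow_eq_one.2 ⟨m, hm, hρ⟩
    refine ⟨ρ, orderOf ρ, (Nat.le_of_dvd hm (orderOf_dvd_of_pow_eq_one hρ)).trans hmB,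
      hfin.orderOf_pos, IsPrimitiveRoot.orderOf ρ, ?_⟩
    intro θ m' hm' hmB' hθ hne
    by_contra! hlt'
    have h1 := inv_sq_le_norm_sub_of_pow_eq_one hm' hm hmB' hmB hθ hρ hne
    have h2 : ‖θ - ρ‖ ≤ ‖ξ - ρ‖ + ‖ξ - θ‖ := by
      rw [show θ - ρ = (ξ - ρ) - (ξ - θ) by ring]
      exact norm_sub_le _ _
    rw [mul_inv] at hlt hlt'
    linarith
  · push Not at h
    exact ⟨1, 1, hB, one_pos, IsPrimitiveRoot.one, fun θ m hm hmB hθ _ => h θ ⟨m, hm, hmB, hθ⟩⟩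

/-- A root of unity very close to `ξ` is the nearest one. -/
lemma isNearestRootOfUnity_of_norm_sub_lt {ξ ρ : ℂ} {D B : ℕ} (hD : 0 < D) (hDB : D ≤ B)
    (hρ : IsPrimitiveRoot ρ D) (h : ‖ξ - ρ‖ < (2 * (B : ℝ) ^ 2)⁻¹) :
    IsNearestRootOfUnity ξ ρ D B (2 * (B : ℝ) ^ 2)⁻¹ := by
  refine ⟨hD, hρ, ?_⟩
  intro θ m' hm' hmB' hθ hne
  have h1 := inv_sq_le_norm_sub_of_pow_eq_one hm' hD hmB' hDB hθ hρ.pow_eq_one hne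
  have h2 : ‖θ - ρ‖ ≤ ‖ξ - ρ‖ + ‖ξ - θ‖ := by
    rw [show θ - ρ = (ξ - ρ) - (ξ - θ) by ring]
    exact norm_sub_le _ _
  rw [mul_inv] at h ⊢
  linarith

namespace IsNearestRootOfUnity

variable {ξ ρ : ℂ} {D B : ℕ} {κ δ : ℝ}

/-- `ξ ^ i` is at distance at least `κ ^ i` from any root of unity other than `ρ ^ i`. -/
lemma le_norm_pow_sub (h : IsNearestRootOfUnity ξ ρ D B κ) (hκ0 : 0 ≤ κ) (hκ1 : κ ≤ 1)
    (hδρ : δ ≤ ‖ξ - ρ‖) {i m : ℕ} (hi : 0 < i) (hm : 0 < m)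
    (him : i * m ≤ B) {ζ : ℂ} (hζ : ζ ^ m = 1) :
    κ ^ i * (if ρ ^ i = ζ then δ else 1) ≤ ‖ξ ^ i - ζ‖ := by
  obtain ⟨θ₀, hθ₀⟩ := IsAlgClosed.exists_pow_nat_eq ζ hi
  have hη := Complex.isPrimitiveRoot_exp i hi.ne'
  set η := Complex.exp (2 * Real.pi * Complex.I / i)
  have hζ0 : ζ ≠ 0 := by
    rintro rfl
    rw [zero_pow hm.ne'] at hζ
    exact zero_ne_one hζ
  have hθ₀0 : θ₀ ≠ 0 := by
    rintro rfl
    rw [zero_pow hi.ne'] at hθ₀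
    exact hζ0 hθ₀.symm
  have hprod : ξ ^ i - ζ = ∏ k ∈ Finset.range i, (ξ - η ^ k * θ₀) := by
    have := congrArg (eval ξ) (X_pow_sub_C_eq_prod hη hi hθ₀)
    simpa [eval_prod] using this
  have hpow : ∀ k : ℕ, (η ^ k * θ₀) ^ i = ζ := by
    intro k
    rw [mul_pow, hθ₀, ← pow_mul, mul_comm k i, pow_mul, hη.pow_eq_one, one_pow, one_mul]
  have hpow' : ∀ k : ℕ, (η ^ k * θ₀) ^ (i * m) = 1 := by
    intro k
    rw [pow_mul, hpow, hζ]
  have hκk : ∀ k : ℕ, η ^ k * θ₀ ≠ ρ → κ ≤ ‖ξ - η ^ k * θ₀‖ := fun k hk =>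
    h.le_norm_sub _ _ (Nat.mul_pos hi hm) him (hpow' k) hk
  rw [hprod, norm_prod]
  by_cases hex : ∃ k ∈ Finset.range i, η ^ k * θ₀ = ρ
  · obtain ⟨k₀, hk₀, hk₀ρ⟩ := hex
    have hρζ : ρ ^ i = ζ := by rw [← hk₀ρ, hpow]
    rw [if_pos hρζ, ← Finset.mul_prod_erase _ _ hk₀, hk₀ρ, mul_comm]
    refine mul_le_mul hδρ ?_ (by positivity) (norm_nonneg _)
    have h1 : κ ^ i ≤ κ ^ ((Finset.range i).erase k₀).card := by
      refine pow_le_pow_of_le_one hκ0 hκ1 ?_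
      exact (Finset.card_erase_le).trans (by simp)
    refine h1.trans ?_
    rw [← Finset.prod_const]
    refine Finset.prod_le_prod (fun _ _ => hκ0) fun k hk => hκk k ?_
    intro hkρ
    obtain ⟨hne, hki⟩ := Finset.mem_erase.1 hk
    apply hne
    refine hη.pow_inj (Finset.mem_range.1 hki) (Finset.mem_range.1 hk₀) ?_
    exact mul_right_cancel₀ hθ₀0 (hkρ.trans hk₀ρ.symm)
  · push Not at hex
    have hρζ : ρ ^ i ≠ ζ := by
      intro hρζ
      have : NeZero i := ⟨hi.ne'⟩
      have h1 : (ρ / θ₀) ^ i = 1 := by rw [div_pow, hρζ, hθ₀, div_self hζ0]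
      obtain ⟨k, hk, hkρ⟩ := hη.eq_pow_of_pow_eq_one h1
      refine hex k (Finset.mem_range.2 hk) ?_
      rw [hkρ, div_mul_cancel₀ _ hθ₀0]
    rw [if_neg hρζ, mul_one]
    calc κ ^ i = ∏ _k ∈ Finset.range i, κ := by simp
      _ ≤ _ := Finset.prod_le_prod (fun _ _ => hκ0) fun k hk => hκk k (hex k hk)

/-- Values of a cyclotomic polynomial at `ξ ^ i`, for `i` prime to `D`: they are not small unless
the order is `D`. -/
lemma le_norm_aeval_cyclotomic (h : IsNearestRootOfUnity ξ ρ D B κ) (hκ0 : 0 ≤ κ) (hκ1 : κ ≤ 1)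
    (hδ0 : 0 ≤ δ) (hδρ : δ ≤ ‖ξ - ρ‖) (hδ1 : δ ≤ 1) {i m : ℕ} (hi : 0 < i) (hm : 0 < m)
    (him : i * m ≤ B) (hiD : i.Coprime D) :
    κ ^ (i * m.totient) * (if m = D then δ else 1) ≤ ‖aeval (ξ ^ i) (cyclotomic m ℤ)‖ := by
  have hprim : IsPrimitiveRoot (Complex.exp (2 * Real.pi * Complex.I / m)) m :=
    Complex.isPrimitiveRoot_exp m hm.ne'
  have h1 : aeval (ξ ^ i) (cyclotomic m ℤ) = ∏ ζ ∈ primitiveRoots m ℂ, (ξ ^ i - ζ) := by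
    rw [aeval_eq_eval_map, map_cyclotomic, cyclotomic_eq_prod_X_sub_primitiveRoots hprim,
      eval_prod]
    simp
  rw [h1, norm_prod]
  have hstep : ∀ ζ ∈ primitiveRoots m ℂ, κ ^ i * (if ρ ^ i = ζ then δ else 1) ≤ ‖ξ ^ i - ζ‖ :=
    fun ζ hζ => h.le_norm_pow_sub hκ0 hκ1 hδρ hi hm him
      (isPrimitiveRoot_of_mem_primitiveRoots hζ).pow_eq_one
  refine le_trans ?_ (Finset.prod_le_prod (fun ζ _ => ?_) hstep)
  · rw [Finset.prod_mul_distrib, Finset.prod_const, hprim.card_primitiveRoots, ← pow_mul,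
      Finset.prod_ite_eq]
    refine mul_le_mul_of_nonneg_left ?_ (by positivity)
    by_cases hmD : m = D
    · rw [if_pos hmD]
      split_ifs
      · exact le_rfl
      · exact hδ1
    · rw [if_neg hmD, if_neg]
      intro hmem
      have h2 := isPrimitiveRoot_of_mem_primitiveRoots hmem
      have h3 := h.primitive.pow_of_coprime i hiD
      exact hmD (h2.unique h3)
  · split_ifs <;> positivity

/-- Distances between powers of `ξ`. -/
lemma prod_norm_pow_sub_ge (h : IsNearestRootOfUnity ξ ρ D B κ) (hκ0 : 0 < κ) (hκ1 : κ ≤ 1)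
    (hδ0 : 0 ≤ δ) (hδρ : δ ≤ ‖ξ - ρ‖) (hδ1 : δ ≤ 1) {A : ℝ} (hA : 1 ≤ A) (hξ : A⁻¹ ≤ ‖ξ‖)
    {I : Finset ℕ} {N : ℕ} (hN : N ≤ B) (hI : ∀ i ∈ I, i ≤ N) {i : ℕ} (hi : i ∈ I) :
    (κ / A) ^ (N * I.card) * δ ^ (N / D) ≤ ∏ j ∈ I with j < i, ‖ξ ^ i - ξ ^ j‖ := by
  have hA0 : 0 < A := by linarith
  have hκA : 0 ≤ κ / A := by positivity
  have hκA1 : κ / A ≤ 1 := by rw [div_le_one hA0]; linarith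
  have hstep : ∀ j ∈ I.filter (· < i),
      (κ / A) ^ N * (if D ∣ i - j then δ else 1) ≤ ‖ξ ^ i - ξ ^ j‖ := by
    intro j hj
    obtain ⟨hjI, hji⟩ := Finset.mem_filter.1 hj
    have hiN := hI i hi
    have h1 := h.le_norm_pow_sub hκ0.le hκ1 hδρ (i := i - j) (m := 1) (ζ := 1) (by omega)
      one_pos (by omega) (one_pow 1)
    have h2 : ‖ξ ^ i - ξ ^ j‖ = ‖ξ‖ ^ j * ‖ξ ^ (i - j) - 1‖ := by
      rw [← norm_pow, ← norm_mul, mul_sub, mul_one, ← pow_add, Nat.add_sub_cancel' hji.le]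
    rw [h2]
    have h3 : (A⁻¹) ^ N ≤ ‖ξ‖ ^ j :=
      (pow_le_pow_of_le_one (by positivity) (inv_le_one_of_one_le₀ hA) (by omega)).trans
        (pow_le_pow_left₀ (by positivity) hξ j)
    have h4 : κ ^ N ≤ κ ^ (i - j) := pow_le_pow_of_le_one hκ0.le hκ1 (by omega)
    rw [div_eq_mul_inv, mul_pow, mul_comm (κ ^ N), mul_assoc]
    refine mul_le_mul h3 (le_trans ?_ h1) ?_ (by positivity)
    · simp only [h.primitive.pow_eq_one_iff_dvd]
      gcongr
    · split_ifs <;> positivity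
  refine le_trans ?_ (Finset.prod_le_prod (fun j _ => ?_) hstep)
  · rw [Finset.prod_mul_distrib, Finset.prod_const, ← pow_mul, Finset.prod_ite, Finset.prod_const,
      Finset.prod_const_one, mul_one]
    refine mul_le_mul ?_ ?_ (by positivity) (by positivity)
    · exact pow_le_pow_of_le_one hκA hκA1 (Nat.mul_le_mul_left _ (Finset.card_filter_le _ _))
    · refine pow_le_pow_of_le_one hδ0 hδ1 ?_
      -- the differences `i - j` are distinct multiples of `D` up to `N`
      have hinj : Set.InjOn (fun j => (i - j) / D)
          (((I.filter (· < i)).filter (fun j => D ∣ i - j) : Finset ℕ) : Set ℕ) := by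
        intro j hj j' hj' he
        simp only [Finset.coe_filter, Finset.mem_filter, Set.mem_ofPred_eq] at hj hj'
        obtain ⟨⟨-, hji⟩, c, hc⟩ := hj
        obtain ⟨⟨-, hji'⟩, c', hc'⟩ := hj'
        simp only [hc, hc', Nat.mul_div_cancel_left _ h.pos] at he
        subst he
        omega
      rw [← Finset.card_image_of_injOn hinj]
      have hsub : (((I.filter (· < i)).filter (fun j => D ∣ i - j)).image
          (fun j => (i - j) / D)) ⊆ Finset.Ioc 0 (N / D) := by
        intro y hy
        obtain ⟨j, hj, rfl⟩ := Finset.mem_image.1 hy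
        simp only [Finset.mem_filter] at hj
        obtain ⟨⟨-, hji⟩, hd⟩ := hj
        have hiN := hI i hi
        rw [Finset.mem_Ioc]
        exact ⟨Nat.div_pos (Nat.le_of_dvd (by omega) hd) h.pos, Nat.div_le_div_right (by omega)⟩
      exact (Finset.card_le_card hsub).trans (by simp)
  · split_ifs <;> positivity

end IsNearestRootOfUnity

/-! ### Smallness of the greatest common divisor at powers of a number -/

lemma prod_fin_orderEmbOfFin (I : Finset ℕ) (f : ℕ → ℝ) :
    ∏ i : Fin I.card, f (I.orderEmbOfFin rfl i) = ∏ i ∈ I, f i := by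
  rw [← Finset.prod_coe_sort I f]
  exact Equiv.prod_comp (I.orderIsoOfFin rfl).toEquiv fun i : I => f i

lemma prod_filter_orderEmbOfFin (I : Finset ℕ) (f : ℕ → ℝ) (i : Fin I.card) :
    ∏ j ∈ Finset.univ.filter (· < i), f (I.orderEmbOfFin rfl j) =
      ∏ j ∈ I with j < I.orderEmbOfFin rfl i, f j := by
  rw [Finset.prod_filter, Finset.prod_filter, ← prod_fin_orderEmbOfFin]
  simp

/-- **The common divisor is small at powers of `ξ`.** The numerical hypotheses express that the
gain `s |I| N₀` from the small Taylor coefficients dominates the size of the determinant and the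
discriminant of the points. -/
theorem prod_norm_aeval_gcd_le {ι : Type*} [Fintype ι] {F E : ι → ℤ[X]} {Q : ℤ[X]}
    {V : ι → ℚ[X]} (hFE : ∀ f, F f = Q * E f) (hQ : Q ≠ 0)
    (hV : ∑ f, V f * (E f).map (Int.castRingHom ℚ) = 1) (f₀ : ι) (hF₀ : F f₀ ≠ 0) {d s : ℕ}
    (hs : 0 < s) (hd : ∀ f, (F f).natDegree ≤ d) {h : ℝ} (h0 : 0 ≤ h)
    (hh : ∀ f, F f ≠ 0 → intMahler (F f) ≤ Real.exp h) {ξ : ℂ} {I : Finset ℕ}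
    (hId : I.card * s ≤ d) {c N₀ : ℝ}
    (hdiff : ∀ i ∈ I, Real.exp (-c) ≤ ∏ j ∈ I with j < i, ‖ξ ^ i - ξ ^ j‖)
    (hη : ∀ f, ∀ i ∈ I, ∀ k < d, ∀ l < s,
      ‖(taylor (ξ ^ i) (X ^ k * (F f).map (Int.castRingHom ℂ))).coeff l‖ ≤ Real.exp (-N₀))
    (hnum1 : 2 * d * (Real.log (2 * d) + d + h) ≤ s * I.card * N₀ / 4)
    (hnum2 : s * c ≤ N₀ / 4) :
    ∏ i ∈ I, ‖aeval (ξ ^ i) Q‖ ≤ Real.exp (-(I.card * N₀ / 2)) := by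
  have hEF : ∀ f, E f ∣ F f := fun f => ⟨Q, by rw [hFE, mul_comm]⟩
  have hE0 : ∀ f, F f = 0 → E f = 0 := by
    intro f hf
    rw [hFE, mul_eq_zero] at hf
    exact hf.resolve_left hQ
  have hEd : ∀ f, (E f).natDegree ≤ d := by
    intro f
    by_cases hf : F f = 0
    · rw [hE0 f hf]; simp
    · exact (natDegree_le_of_dvd (hEF f) hf).trans (hd f)
  have hH1 : (1 : ℝ) ≤ 2 ^ d * Real.exp h :=
    one_le_mul_of_one_le_of_one_le (one_le_pow₀ one_le_two) (Real.one_le_exp h0)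
  have hmain := prod_eval_gcd_le E V hV hEd f₀ (by
      intro h0; rw [hFE, h0, mul_zero] at hF₀; exact hF₀ rfl)
    (Q.map (Int.castRingHom ℂ)) hId (fun i => ξ ^ (I.orderEmbOfFin rfl i))
    (η := Real.exp (-N₀)) (H := 2 ^ d * Real.exp h) hH1 (Real.exp_pos _).le ?_ ?_
  rotate_left
  · intro f i k hk l hl
    have := hη f _ (I.orderEmbOfFin_mem rfl i) k hk l hl
    rwa [hFE, Polynomial.map_mul] at this
  · intro f j
    by_cases hf : F f = 0
    · rw [hE0 f hf]; simpa using zero_le_one.trans hH1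
    · refine (abs_coeff_le_of_dvd hf (hEF f) j).trans ?_
      have := hh f hf
      have := hd f
      have := zero_le_one.trans (one_le_intMahler hf)
      gcongr
      exact one_le_two
  set a := I.card
  set q := ∏ i ∈ I, ‖aeval (ξ ^ i) Q‖ with hq
  have hq0 : 0 ≤ q := Finset.prod_nonneg fun _ _ => norm_nonneg _
  have hlower : (q * Real.exp (-(a * s * c))) ^ s ≤ ∏ i : Fin a,
      (‖(Q.map (Int.castRingHom ℂ)).eval (ξ ^ I.orderEmbOfFin rfl i)‖ *
        ∏ j ∈ Finset.univ.filter (· < i),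
          ‖ξ ^ I.orderEmbOfFin rfl i - ξ ^ I.orderEmbOfFin rfl j‖ ^ s) ^ s := by
    rw [Finset.prod_pow]
    refine pow_le_pow_left₀ (by positivity) ?_ s
    rw [Finset.prod_mul_distrib]
    have e1 : ∏ i : Fin a, ‖(Q.map (Int.castRingHom ℂ)).eval (ξ ^ I.orderEmbOfFin rfl i)‖ = q := by
      rw [hq, ← prod_fin_orderEmbOfFin I (fun i => ‖aeval (ξ ^ i) Q‖)]
      simp only [aeval_eq_eval_map]
      rfl
    rw [e1]
    refine mul_le_mul_of_nonneg_left ?_ hq0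
    have e2 : Real.exp (-(a * s * c)) = ∏ _i : Fin a, Real.exp (-c) ^ s := by
      rw [Finset.prod_const, Finset.card_univ, Fintype.card_fin, ← Real.exp_nat_mul,
        ← Real.exp_nat_mul]
      ring_nf
    rw [e2]
    refine Finset.prod_le_prod (fun _ _ => by positivity) fun i _ => ?_
    rw [Finset.prod_pow]
    refine pow_le_pow_left₀ (Real.exp_pos _).le ?_ s
    rw [prod_filter_orderEmbOfFin I (fun j => ‖ξ ^ I.orderEmbOfFin rfl i - ξ ^ j‖)]
    exact hdiff _ (I.orderEmbOfFin_mem rfl i)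
  have hupper : ((2 * d).factorial : ℝ) * (Real.exp (-N₀) ^ (a * s) *
      (2 ^ d * Real.exp h) ^ (2 * d)) ≤
      Real.exp (2 * d * (Real.log (2 * d) + d + h) - s * a * N₀) := by
    have f1 : ((2 * d).factorial : ℝ) ≤ Real.exp (2 * d * Real.log (2 * d)) := by
      rcases Nat.eq_zero_or_pos d with hd0 | hd0
      · rw [hd0]; simp
      · have h1 : ((2 * d).factorial : ℝ) ≤ ((2 * d : ℕ) : ℝ) ^ (2 * d) := by
          exact_mod_cast Nat.factorial_le_pow _
        refine h1.trans (le_of_eq ?_)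
        have h2 : (0 : ℝ) < 2 * d := by positivity
        push_cast
        rw [mul_comm (2 * (d : ℝ)) (Real.log _), Real.exp_mul, Real.exp_log h2]
        exact_mod_cast rfl
    have f2 : (2 : ℝ) ^ d ≤ Real.exp d := by
      have h1 : (2 : ℝ) ≤ Real.exp 1 := by
        have := Real.add_one_le_exp 1; linarith
      calc (2 : ℝ) ^ d ≤ Real.exp 1 ^ d := pow_le_pow_left₀ zero_le_two h1 d
        _ = Real.exp d := by rw [← Real.exp_nat_mul, mul_one]
    have f3 : (2 ^ d * Real.exp h : ℝ) ^ (2 * d) ≤ Real.exp (2 * d * (d + h)) := by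
      calc (2 ^ d * Real.exp h : ℝ) ^ (2 * d) ≤ (Real.exp d * Real.exp h) ^ (2 * d) := by gcongr
        _ = _ := by
          rw [← Real.exp_add, ← Real.exp_nat_mul]; push_cast; rfl
    have f4 : Real.exp (-N₀) ^ (a * s) = Real.exp (-(s * a * N₀)) := by
      rw [← Real.exp_nat_mul]; push_cast; ring_nf
    rw [f4]
    calc _ ≤ Real.exp (2 * d * Real.log (2 * d)) * (Real.exp (-(s * a * N₀)) *
          Real.exp (2 * d * (d + h))) := by gcongr
      _ = _ := by rw [← Real.exp_add, ← Real.exp_add]; ring_nf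
  have hfin := hlower.trans (hmain.trans hupper)
  have hs0 : (0 : ℝ) < s := by exact_mod_cast hs
  have hfin2 : (q * Real.exp (-(a * s * c))) ^ s ≤ Real.exp (-(3 / 4 * (a * N₀))) ^ s := by
    refine hfin.trans ?_
    rw [← Real.exp_nat_mul, Real.exp_le_exp]
    linarith
  have hfin3 := le_of_pow_le_pow_left₀ hs.ne' (Real.exp_pos _).le hfin2
  rw [Real.exp_neg, ← div_eq_mul_inv, div_le_iff₀ (Real.exp_pos _), ← Real.exp_add] at hfin3
  refine hfin3.trans (Real.exp_le_exp.2 ?_)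
  have : (a : ℝ) * (s * c) ≤ a * (N₀ / 4) := by gcongr
  linarith

/-! ### Totients, primes and growth of powers -/

lemma le_totient_sq_of_odd (m : ℕ) : Odd m → m ≤ m.totient ^ 2 := by
  induction m using Nat.recOnPosPrimePosCoprime with
  | prime_pow p k hp hk =>
    intro hodd
    have hp3 : 3 ≤ p := by
      rcases hp.two_le.lt_or_eq with h | h
      · exact h
      · rw [← h] at hodd
        exact absurd hodd (by simp [hk.ne', Nat.even_pow])
    rw [Nat.totient_prime_pow hp hk]
    obtain ⟨k, rfl⟩ : ∃ j, k = j + 1 := ⟨k - 1, by omega⟩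
    obtain ⟨q, rfl⟩ : ∃ q, p = q + 1 := ⟨p - 1, by omega⟩
    simp only [Nat.add_sub_cancel]
    have h1 : 1 ≤ (q + 1) ^ k := Nat.one_le_pow _ _ (by omega)
    have h2 : q + 1 ≤ q ^ 2 := by nlinarith
    calc (q + 1) ^ (k + 1) = (q + 1) ^ k * (q + 1) := pow_succ _ _
      _ ≤ ((q + 1) ^ k * (q + 1) ^ k) * q ^ 2 := by gcongr; nlinarith
      _ = _ := by ring
  | zero => intro h; exact absurd h (by simp)
  | one => simp
  | coprime a b _ _ hab iha ihb =>
    intro h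
    obtain ⟨ha, hb⟩ := Nat.odd_mul.1 h
    rw [Nat.totient_mul hab, mul_pow]
    exact Nat.mul_le_mul (iha ha) (ihb hb)

lemma le_two_mul_totient_sq (m : ℕ) : m ≤ 2 * m.totient ^ 2 := by
  rcases Nat.eq_zero_or_pos m with rfl | hm
  · simp
  obtain ⟨k, r, hr, rfl⟩ := Nat.exists_eq_two_pow_mul_odd hm.ne'
  rcases Nat.eq_zero_or_pos k with rfl | hk
  · have := le_totient_sq_of_odd r hr
    simp only [pow_zero, one_mul]
    omega
  · have hcop : Nat.Coprime (2 ^ k) r := (Nat.coprime_pow_left_iff hk _ _).2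
      (Nat.coprime_two_left.2 hr)
    rw [Nat.totient_mul hcop, Nat.totient_prime_pow Nat.prime_two hk, mul_pow]
    obtain ⟨k, rfl⟩ : ∃ j, k = j + 1 := ⟨k - 1, by omega⟩
    simp only [Nat.add_one_sub_one, mul_one]
    have h1 : 1 ≤ 2 ^ k := Nat.one_le_two_pow
    have h2 := le_totient_sq_of_odd r hr
    calc 2 ^ (k + 1) * r = 2 * (2 ^ k * r) := by ring
      _ ≤ 2 * ((2 ^ k * 2 ^ k) * r.totient ^ 2) := by gcongr; nlinarith
      _ = _ := by ring

lemma eventually_mul_rpow_le (C : ℝ) {a b : ℝ} (h : a < b) :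
    ∀ᶠ n : ℕ in atTop, C * (n : ℝ) ^ a ≤ (n : ℝ) ^ b := by
  have h1 := (tendsto_rpow_atTop (sub_pos.2 h)).comp tendsto_natCast_atTop_atTop
    |>.eventually_ge_atTop C
  filter_upwards [h1, eventually_gt_atTop 0] with n hn hn0
  have hn0' : (0 : ℝ) < n := by exact_mod_cast hn0
  calc C * (n : ℝ) ^ a ≤ (n : ℝ) ^ (b - a) * (n : ℝ) ^ a := by
        gcongr; exact hn
    _ = (n : ℝ) ^ b := by rw [← Real.rpow_add hn0', sub_add_cancel]

lemma eventually_mul_log_le (C : ℝ) {r : ℝ} (hr : 0 < r) :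
    ∀ᶠ n : ℕ in atTop, C * Real.log n ≤ (n : ℝ) ^ r := by
  have h1 := ((isLittleO_log_rpow_atTop (half_pos hr)).bound one_pos)
  have h2 := tendsto_natCast_atTop_atTop (R := ℝ).eventually h1
  filter_upwards [h2, eventually_mul_rpow_le |C| (half_lt_self hr), eventually_ge_atTop 1]
    with n h3 h4 hn
  have hlog : 0 ≤ Real.log n := Real.log_natCast_nonneg n
  rw [one_mul, Real.norm_of_nonneg hlog, Real.norm_of_nonneg (by positivity)] at h3
  refine le_trans ?_ h4
  calc C * Real.log n ≤ |C| * Real.log n := by gcongr; exact le_abs_self C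
    _ ≤ _ := by gcongr

lemma eventually_rpow_le_primeCounting {r : ℝ} (hr : 0 < r) :
    ∀ᶠ x : ℝ in atTop, x ^ (1 - r) ≤ (Nat.primeCounting ⌊x⌋₊ : ℝ) := by
  have h1 := (isLittleO_log_rpow_atTop hr).bound (c := 1 / 4) (by norm_num)
  have h2 := (isLittleO_log_rpow_atTop one_pos).bound (c := 1 / 16) (by norm_num)
  filter_upwards [h1, h2, eventually_ge_atTop 6] with x h1 h2 hx
  have hlog : 0 < Real.log x := Real.log_pos (by linarith)
  have hx0 : 0 < x := by linarith
  rw [Real.norm_of_nonneg hlog.le, Real.norm_of_nonneg (by positivity)] at h1 h2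
  rw [Real.rpow_one] at h2
  refine le_trans ?_ (Chebyshev.pi_ge' (by linarith))
  have h3 : Real.log (x + 2) ≤ 2 * Real.log x := by
    rw [← Real.log_rpow hx0]
    refine Real.log_le_log (by linarith) ?_
    rw [Real.rpow_two]
    nlinarith
  have h4 : (0.69 : ℝ) < Real.log 2 := by have := Real.log_two_gt_d9; linarith
  rw [le_div_iff₀ hlog]
  calc x ^ (1 - r) * Real.log x ≤ x ^ (1 - r) * (1 / 4 * x ^ r) := by gcongr
    _ = x / 4 := by
      rw [mul_left_comm, ← Real.rpow_add hx0, sub_add_cancel, Real.rpow_one]; ring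
    _ ≤ _ := by nlinarith

/-- There are at least `n ^ (a - δ)` primes up to `n ^ a`, even after removing a set of at most
`n ^ (a - δ)` of them. -/
lemma eventually_card_primes_sdiff {a δ : ℝ} (ha : 0 < a) (hδ : 0 < δ) :
    ∀ᶠ n : ℕ in atTop, ∀ T : Finset ℕ, (T.card : ℝ) ≤ (n : ℝ) ^ (a - δ) →
      (n : ℝ) ^ (a - δ) ≤
        ((((Finset.range (⌊(n : ℝ) ^ a⌋₊ + 1)).filter Nat.Prime) \ T).card : ℝ) := by
  have h1 := ((tendsto_rpow_atTop ha).comp tendsto_natCast_atTop_atTop).eventually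
    (eventually_rpow_le_primeCounting (r := δ / 2 / a) (by positivity))
  have h2 := eventually_mul_rpow_le 2 (show a - δ < a - δ / 2 by linarith)
  filter_upwards [h1, h2] with n h1 h2 T hT
  simp only [Function.comp_apply] at h1
  rw [← Real.rpow_mul (by positivity), show a * (1 - δ / 2 / a) = a - δ / 2 by field_simp,
    Nat.primeCounting, Nat.primeCounting', Nat.count_eq_card_filter_range] at h1
  have h3 := Finset.le_card_sdiff T ((Finset.range (⌊(n : ℝ) ^ a⌋₊ + 1)).filter Nat.Prime)
  have h4 : ((((Finset.range (⌊(n : ℝ) ^ a⌋₊ + 1)).filter Nat.Prime).card : ℕ) : ℝ) ≤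
      (((Finset.range (⌊(n : ℝ) ^ a⌋₊ + 1)).filter Nat.Prime) \ T).card + T.card := by
    exact_mod_cast Nat.sub_le_iff_le_add.1 h3
  linarith

lemma two_pow_card_le_of_primes_dvd {T : Finset ℕ} {m : ℕ} (hm : 0 < m)
    (hT : ∀ p ∈ T, p.Prime ∧ p ∣ m) : 2 ^ T.card ≤ m := by
  have h1 : ∏ p ∈ T, p ∣ m :=
    Finset.prod_primes_dvd m (fun p hp => (hT p hp).1.prime) fun p hp => (hT p hp).2
  refine le_trans ?_ (Nat.le_of_dvd hm h1)
  rw [← Finset.prod_const]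
  exact Finset.prod_le_prod' fun p hp => (hT p hp).1.two_le

/-! ### Polynomials which are small at powers of a number -/

/-- The hypothesis on the auxiliary polynomial of level `n`, with the height replaced by a bound for
the coefficients. -/
structure IsAuxiliaryPoly (ξ : ℂ) (β σ τ ν : ℝ) (n : ℕ) (P : ℤ[X]) : Prop where
  ne_zero : P ≠ 0
  natDegree_le : P.natDegree ≤ n
  abs_coeff_le : ∀ j, |(P.coeff j : ℝ)| ≤ Real.exp ((n : ℝ) ^ β)
  norm_lt : ∀ i j : ℕ, 1 ≤ i → (i : ℝ) ≤ (n : ℝ) ^ σ → (j : ℝ) < (n : ℝ) ^ τ →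
    ‖aeval (ξ ^ i) (hasseDeriv j P)‖ < Real.exp (-(n : ℝ) ^ ν)

lemma one_le_content {P : ℤ[X]} (hP : P ≠ 0) : 1 ≤ P.content := by
  have h1 : 0 ≤ P.content := Int.nonneg_of_normalize_eq_self normalize_content
  have h2 : P.content ≠ 0 := by rwa [Ne, content_eq_zero_iff]
  omega

lemma isAuxiliaryPoly_primPart {ξ : ℂ} {β σ τ ν : ℝ} {n : ℕ} {P : ℤ[X]} (hP : P ≠ 0)
    (hdeg : P.natDegree ≤ n) (hH : polyHeight P ≤ Real.exp ((n : ℝ) ^ β))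
    (hval : ∀ i j : ℕ, 1 ≤ i → (i : ℝ) ≤ (n : ℝ) ^ σ → (j : ℝ) < (n : ℝ) ^ τ →
      ‖aeval (ξ ^ i) (hasseDeriv j P)‖ < Real.exp (-(n : ℝ) ^ ν)) :
    IsAuxiliaryPoly ξ β σ τ ν n P.primPart := by
  have hc := one_le_content hP
  have hc' : (1 : ℝ) ≤ P.content := by exact_mod_cast hc
  have hc0 : (0 : ℝ) < P.content := by linarith
  refine ⟨(isPrimitive_primPart P).ne_zero, by rwa [natDegree_primPart], fun j => ?_,
    fun i j hi hiσ hj => ?_⟩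
  · refine le_trans ?_ hH
    rw [polyHeight, le_div_iff₀ hc0]
    have h1 := P.le_supNorm j
    have h2 : P.coeff j = P.content * P.primPart.coeff j := by
      conv_lhs => rw [eq_C_content_mul_primPart P, coeff_C_mul]
    rw [Int.norm_eq_abs, h2] at h1
    push_cast at h1
    rwa [abs_mul, abs_of_pos hc0, mul_comm] at h1
  · refine lt_of_le_of_lt ?_ (hval i j hi hiσ hj)
    have h1 : hasseDeriv j P = P.content • hasseDeriv j P.primPart := by
      conv_lhs => rw [eq_C_content_mul_primPart P, ← smul_eq_C_mul, map_smul]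
    rw [h1, map_zsmul, zsmul_eq_mul, norm_mul, Complex.norm_intCast, abs_of_pos hc0]
    exact le_mul_of_one_le_left (norm_nonneg _) hc'

lemma polyHeight_of_isPrimitive {S : ℤ[X]} (hS : S.IsPrimitive) : polyHeight S = S.supNorm := by
  rw [polyHeight, hS.content_eq_one]; simp

lemma natDegree_hasseDeriv_comp_le (P : ℤ[X]) (j p : ℕ) :
    ((hasseDeriv j P).comp (X ^ p)).natDegree ≤ P.natDegree * p := by
  rw [natDegree_comp, natDegree_X_pow]
  exact Nat.mul_le_mul_right _ ((natDegree_hasseDeriv_le P j).trans (Nat.sub_le _ _))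

lemma abs_coeff_hasseDeriv_comp_le {P : ℤ[X]} {n : ℕ} (hd : P.natDegree ≤ n) {H : ℝ}
    (hH : ∀ j, |(P.coeff j : ℝ)| ≤ H) {p : ℕ} (hp : 0 < p) (j l : ℕ) :
    |(((hasseDeriv j P).comp (X ^ p)).coeff l : ℝ)| ≤ 2 ^ n * H := by
  have hH0 : 0 ≤ H := (abs_nonneg _).trans (hH 0)
  rw [← expand_eq_comp_X_pow, coeff_expand hp]
  split_ifs
  · rw [hasseDeriv_coeff]
    push_cast
    rw [abs_mul]
    by_cases hl : l / p + j ≤ n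
    · refine mul_le_mul ?_ (hH _) (abs_nonneg _) (by positivity)
      rw [abs_of_nonneg (by positivity)]
      refine le_trans (b := ((2 ^ (l / p + j) : ℕ) : ℝ)) ?_ ?_
      · exact_mod_cast Nat.choose_le_two_pow _ _
      · push_cast
        exact pow_le_pow_right₀ one_le_two hl
    · rw [coeff_eq_zero_of_natDegree_lt (by omega)]
      simp only [Int.cast_zero, abs_zero, mul_zero]
      positivity
  · simp only [Int.cast_zero, abs_zero]
    positivity

/-- An irreducible factor of a primitive polynomial is `X`, or cyclotomic, or has a nonzero root
which is not a root of unity. -/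
lemma eq_X_or_cyclotomic_or_exists_root {Q R : ℤ[X]} (hQ : Q.IsPrimitive)
    (hR : R ∈ normalizedFactors Q) :
    R = X ∨ (∃ m : ℕ, 0 < m ∧ R = cyclotomic m ℤ) ∨
      ∃ α : ℂ, aeval α R = 0 ∧ α ≠ 0 ∧ ∀ m : ℕ, 0 < m → α ^ m ≠ 1 := by
  have hirr := irreducible_of_normalized_factor R hR
  have hprim := isPrimitive_of_dvd hQ (dvd_of_mem_normalizedFactors hR)
  have hnorm := normalize_normalized_factor R hR
  have hdeg : R.natDegree ≠ 0 := by
    intro h0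
    obtain ⟨c, rfl⟩ : ∃ c, R = C c := ⟨_, eq_C_of_natDegree_eq_zero h0⟩
    exact hirr.not_isUnit (isUnit_C.2 (hprim c dvd_rfl))
  obtain ⟨α, hα⟩ : ∃ α : ℂ, aeval α R = 0 := by
    have h1 : (R.map (Int.castRingHom ℂ)).degree ≠ 0 := by
      rw [degree_map_eq_of_injective (RingHom.injective_int _)]
      intro h0
      exact hdeg (natDegree_eq_of_degree_eq_some h0)
    obtain ⟨α, hα⟩ := Complex.exists_root (f := R.map (Int.castRingHom ℂ)) (by
      rw [degree_map_eq_of_injective (RingHom.injective_int _)]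
      exact natDegree_pos_iff_degree_pos.1 (Nat.pos_of_ne_zero hdeg))
    exact ⟨α, by rwa [aeval_eq_eval_map]⟩
  -- a monic irreducible polynomial with the same root as `R` is equal to `R`
  have key : ∀ T : ℤ[X], T.Monic → Irreducible T → aeval α T = 0 → R = T := by
    intro T hT hTirr hTα
    have h1 : R ∣ T := (hirr.dvd_iff_aeval hα T).2 hTα
    have h2 := (hirr.associated_of_dvd hTirr h1)
    rw [← hnorm, ← hT.normalize_eq_self]
    exact normalize_eq_normalize h2.dvd h2.symm.dvd
  by_cases hα0 : α = 0
  · left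
    exact key X monic_X irreducible_X (by simp [hα0])
  by_cases hm : ∃ m : ℕ, 0 < m ∧ α ^ m = 1
  · right; left
    have hfin : IsOfFinOrder α := isOfFinOrder_iff_pow_eq_one.2 hm
    refine ⟨orderOf α, hfin.orderOf_pos, key _ (cyclotomic.monic _ _)
      (cyclotomic.irreducible hfin.orderOf_pos) ?_⟩
    have h1 := (IsPrimitiveRoot.orderOf α).isRoot_cyclotomic hfin.orderOf_pos
    rwa [aeval_eq_eval_map, map_cyclotomic]
  · right; right
    push Not at hm
    exact ⟨α, hα, hα0, hm⟩

/-! ### Taylor coefficients at powers of a number -/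

lemma map_hasseDeriv {R S : Type*} [Semiring R] [Semiring S] (f : R →+* S) (j : ℕ) (P : R[X]) :
    (hasseDeriv j P).map f = hasseDeriv j (P.map f) := by
  ext l
  simp [hasseDeriv_coeff]

lemma norm_aeval_of_associated {F G : ℤ[X]} (h : Associated F G) (x : ℂ) :
    ‖aeval x F‖ = ‖aeval x G‖ := by
  obtain ⟨u, rfl⟩ := h
  obtain ⟨r, hr, hu⟩ := Polynomial.isUnit_iff.1 u.isUnit
  rw [map_mul, norm_mul, ← hu, aeval_C]
  rcases Int.isUnit_iff.1 hr with rfl | rfl <;> simp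

lemma two_add_norm_pow_le {ξ : ℂ} {A : ℝ} (hA : 2 + ‖ξ‖ ≤ A) {i : ℕ} (hi : 0 < i) :
    2 + ‖ξ ^ i‖ ≤ A ^ i := by
  have h1 := pow_add_pow_le (zero_le_two (α := ℝ)) (norm_nonneg ξ) hi.ne'
  have h2 : (2 : ℝ) ≤ 2 ^ i := le_self_pow₀ one_le_two hi.ne'
  rw [norm_pow]
  calc 2 + ‖ξ‖ ^ i ≤ 2 ^ i + ‖ξ‖ ^ i := by gcongr
    _ ≤ (2 + ‖ξ‖) ^ i := h1
    _ ≤ A ^ i := by gcongr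

/-- Taylor coefficients of the polynomials `T ^ k * P^{[j]}(T ^ p)` at `ξ ^ i`. -/
lemma IsAuxiliaryPoly.norm_taylor_coeff_le {ξ : ℂ} {β σ τ ν : ℝ} {n : ℕ} {P : ℤ[X]}
    (hP : IsAuxiliaryPoly ξ β σ τ ν n P) {A Λ : ℝ} (hA : 2 + ‖ξ‖ ≤ A) (hΛ : A ≤ Real.exp Λ)
    {i p j s t d N : ℕ} (hi : 0 < i) (hp : 0 < p) (hip : ((i * p : ℕ) : ℝ) ≤ (n : ℝ) ^ σ)
    (ht : (t : ℝ) < (n : ℝ) ^ τ + 1) (hjs : j + s ≤ t) (hiN : i ≤ N)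
    (hipN : i * p * t ≤ N * d) (htd : 3 * t ≤ N * d)
    (hnum : 3 * Λ * (N * d) ≤ (n : ℝ) ^ ν / 2) {k l : ℕ} (hk : k < d) (hl : l < s) :
    ‖(taylor (ξ ^ i) (X ^ k * ((hasseDeriv j P).comp (X ^ p)).map (Int.castRingHom ℂ))).coeff l‖ ≤
      Real.exp (-((n : ℝ) ^ ν / 2)) := by
  have hA1 : 1 ≤ A := by linarith [norm_nonneg ξ]
  have hΛ0 : 0 ≤ Λ := Real.exp_le_exp.1 (by rw [Real.exp_zero]; linarith)
  have hmap : ((hasseDeriv j P).comp (X ^ p)).map (Int.castRingHom ℂ) =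
      (hasseDeriv j (P.map (Int.castRingHom ℂ))).comp (X ^ p) := by
    rw [Polynomial.map_comp, Polynomial.map_pow, map_X, map_hasseDeriv]
  rw [hmap]
  have h1 := truncNorm_taylor_hasseDeriv_comp_le (P.map (Int.castRingHom ℂ)) (ξ ^ i) p j k s
    (η := Real.exp (-(n : ℝ) ^ ν)) (fun m hm => by
      have hmt : (m : ℝ) < (n : ℝ) ^ τ := by
        have : (m : ℝ) + 1 ≤ t := by exact_mod_cast (by omega : m + 1 ≤ t)
        linarith
      have h2 := hP.norm_lt (i * p) m (Nat.mul_pos hi hp) hip hmt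
      rw [← map_hasseDeriv, ← aeval_eq_eval_map, ← pow_mul]
      exact h2.le)
  refine (norm_coeff_le_truncNorm hl _).trans (h1.trans ?_)
  have hx : 1 + ‖ξ ^ i‖ ≤ A ^ i := by linarith [two_add_norm_pow_le hA hi]
  have hA0 : 0 ≤ A := by linarith
  have h2 : (2 : ℝ) ≤ A := by linarith [norm_nonneg ξ]
  have e1 : (1 + ‖ξ ^ i‖) ^ k ≤ A ^ (N * d) := by
    calc (1 + ‖ξ ^ i‖) ^ k ≤ (A ^ i) ^ k := by gcongr
      _ = A ^ (i * k) := (pow_mul _ _ _).symm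
      _ ≤ A ^ (N * d) := pow_le_pow_right₀ hA1 (Nat.mul_le_mul hiN hk.le)
  have e2 : (s : ℝ) * 2 ^ (j + s) ≤ A ^ (2 * t) := by
    have h3 : (s : ℝ) ≤ 2 ^ t := by
      exact_mod_cast (by omega : s ≤ t).trans Nat.lt_two_pow_self.le
    calc (s : ℝ) * 2 ^ (j + s) ≤ 2 ^ t * 2 ^ t := by gcongr; exact one_le_two
      _ = 2 ^ (2 * t) := by rw [← pow_add, two_mul]
      _ ≤ A ^ (2 * t) := by gcongr
  have e3 : (2 * (1 + ‖ξ ^ i‖) ^ p) ^ s ≤ A ^ (t + i * p * t) := by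
    have h4 : (1 : ℝ) ≤ A * (A ^ i) ^ p := by
      rw [← pow_mul, ← pow_succ']; exact one_le_pow₀ hA1
    calc (2 * (1 + ‖ξ ^ i‖) ^ p) ^ s ≤ (A * (A ^ i) ^ p) ^ s := by gcongr
      _ ≤ (A * (A ^ i) ^ p) ^ t := pow_le_pow_right₀ h4 (by omega)
      _ = A ^ (t + i * p * t) := by rw [mul_pow, ← pow_mul, ← pow_mul, ← pow_add, mul_assoc]
  calc (1 + ‖ξ ^ i‖) ^ k * (s * (2 ^ (j + s) * Real.exp (-(n : ℝ) ^ ν)) *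
        (2 * (1 + ‖ξ ^ i‖) ^ p) ^ s)
      = (1 + ‖ξ ^ i‖) ^ k * ((s * 2 ^ (j + s)) * (2 * (1 + ‖ξ ^ i‖) ^ p) ^ s) *
        Real.exp (-(n : ℝ) ^ ν) := by ring
    _ ≤ A ^ (N * d) * (A ^ (2 * t) * A ^ (t + i * p * t)) * Real.exp (-(n : ℝ) ^ ν) := by
        gcongr
    _ = A ^ (N * d + (2 * t + (t + i * p * t))) * Real.exp (-(n : ℝ) ^ ν) := by
        rw [← pow_add, ← pow_add]
    _ ≤ A ^ (3 * (N * d)) * Real.exp (-(n : ℝ) ^ ν) := by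
        gcongr
        omega
    _ ≤ Real.exp Λ ^ (3 * (N * d)) * Real.exp (-(n : ℝ) ^ ν) := by gcongr
    _ = Real.exp (3 * Λ * (N * d) - (n : ℝ) ^ ν) := by
        rw [← Real.exp_nat_mul, ← Real.exp_add]; push_cast; ring_nf
    _ ≤ _ := Real.exp_le_exp.2 (by linarith)

lemma norm_pow_sub_pow_le {ξ ρ : ℂ} {A : ℝ} (hA : 2 ≤ A) (hξ : ‖ξ‖ ≤ A) (hρ : ‖ρ‖ ≤ A) (i : ℕ) :
    ‖ξ ^ i - ρ ^ i‖ ≤ A ^ (2 * i) * ‖ξ - ρ‖ := by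
  have hA1 : 1 ≤ A := by linarith
  rw [← (Commute.all ξ ρ).geom_sum₂_mul i, norm_mul]
  gcongr
  refine (norm_sum_le _ _).trans ?_
  refine (Finset.sum_le_card_nsmul _ _ (A ^ i) fun k hk => ?_).trans ?_
  · rw [Finset.mem_range] at hk
    rw [norm_mul, norm_pow, norm_pow]
    calc ‖ξ‖ ^ k * ‖ρ‖ ^ (i - 1 - k) ≤ A ^ k * A ^ (i - 1 - k) := by gcongr
      _ = A ^ (i - 1) := by rw [← pow_add]; congr 1; omega
      _ ≤ A ^ i := pow_le_pow_right₀ hA1 (Nat.sub_le _ _)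
  · rw [Finset.card_range, nsmul_eq_mul, two_mul, pow_add]
    gcongr
    have : (i : ℝ) ≤ 2 ^ i := by exact_mod_cast Nat.lt_two_pow_self.le
    exact this.trans (by gcongr)

lemma truncNorm_X_add_C_pow_le {s e : ℕ} (hse : s ≤ e) {y : ℂ} (hy : ‖y‖ ≤ 1) :
    truncNorm s ((X + C y) ^ e) ≤ 2 ^ e * ‖y‖ ^ (e - s) := by
  have h1 : ∀ l ∈ Finset.range s, ‖((X + C y) ^ e).coeff l‖ ≤ e.choose l * ‖y‖ ^ (e - s) := by
    intro l hl
    rw [Finset.mem_range] at hl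
    rw [coeff_X_add_C_pow, norm_mul, norm_pow, Complex.norm_natCast, mul_comm]
    gcongr 1
    exact pow_le_pow_of_le_one (norm_nonneg _) hy (by omega)
  refine (Finset.sum_le_sum h1).trans ?_
  rw [← Finset.sum_mul]
  gcongr
  have h2 : ∑ l ∈ Finset.range s, e.choose l ≤ 2 ^ e := by
    rw [← Nat.sum_range_choose]
    exact Finset.sum_le_sum_of_subset (Finset.range_subset_range.2 (by omega))
  exact_mod_cast h2

/-- Taylor coefficients of `T ^ k * Φ_m(T) ^ e` at a point `x` close to a primitive `m`-th root of
unity `ζ`. -/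
lemma truncNorm_taylor_cyclotomic_pow_le {m : ℕ} (hm : 0 < m) {ζ x : ℂ} (hζ : IsPrimitiveRoot ζ m)
    (hx : ‖x - ζ‖ ≤ 1) {s e : ℕ} (hse : s ≤ e) (k : ℕ) :
    truncNorm s (taylor x (X ^ k * (cyclotomic m ℤ ^ e).map (Int.castRingHom ℂ))) ≤
      (1 + ‖x‖) ^ k * (2 ^ e * ‖x - ζ‖ ^ (e - s) * (2 + ‖x‖) ^ (m.totient * e)) := by
  have hmem : ζ ∈ primitiveRoots m ℂ := (mem_primitiveRoots hm).2 hζ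
  have hfac : (cyclotomic m ℤ ^ e).map (Int.castRingHom ℂ) =
      (X - C ζ) ^ e * (∏ θ ∈ (primitiveRoots m ℂ).erase ζ, (X - C θ)) ^ e := by
    rw [Polynomial.map_pow, map_cyclotomic, cyclotomic_eq_prod_X_sub_primitiveRoots hζ,
      ← Finset.mul_prod_erase _ _ hmem, mul_pow]
  have htay : ∀ θ : ℂ, taylor x (X - C θ) = X + C (x - θ) := by
    intro θ; simp [taylor_apply]; ring
  have hpow : ∀ (g : ℂ[X]) (r : ℕ), taylor x (g ^ r) = taylor x g ^ r := fun g r => by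
    simp [taylor_apply]
  have hprod : truncNorm s (taylor x (∏ θ ∈ (primitiveRoots m ℂ).erase ζ, (X - C θ))) ≤
      (2 + ‖x‖) ^ m.totient := by
    have h1 : ∀ T : Finset ℂ, (∀ θ ∈ T, ‖θ‖ = 1) →
        truncNorm s (taylor x (∏ θ ∈ T, (X - C θ))) ≤ (2 + ‖x‖) ^ T.card := by
      intro T
      induction T using Finset.induction_on with
      | empty =>
        intro _
        simpa using truncNorm_C_le s 1
      | insert θ T hθ ih =>
        intro hT
        rw [Finset.prod_insert hθ, taylor_mul, Finset.card_insert_of_notMem hθ, pow_succ',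
          htay]
        refine (truncNorm_mul_le _ _ _).trans ?_
        refine mul_le_mul ((truncNorm_X_add_C_le _ _).trans ?_)
          (ih fun θ' h' => hT θ' (Finset.mem_insert_of_mem h')) (truncNorm_nonneg _ _)
          (by positivity)
        have := norm_sub_le x θ
        rw [hT θ (Finset.mem_insert_self _ _)] at this
        linarith
    refine (h1 _ fun θ hθ => ?_).trans ?_
    · exact (isPrimitiveRoot_of_mem_primitiveRoots (Finset.mem_of_mem_erase hθ)).norm'_eq_one hm.ne'
    · refine pow_le_pow_right₀ (by linarith [norm_nonneg x]) ?_
      rw [← hζ.card_primitiveRoots]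
      exact Finset.card_erase_le
  rw [hfac, taylor_mul, taylor_mul, hpow (X - C ζ), hpow (∏ θ ∈ _, _), htay]
  refine (truncNorm_mul_le _ _ _).trans ?_
  refine mul_le_mul (truncNorm_taylor_X_pow_le s x k) ?_ (truncNorm_nonneg _ _) (by positivity)
  refine (truncNorm_mul_le _ _ _).trans ?_
  refine mul_le_mul (truncNorm_X_add_C_pow_le hse hx) ?_ (truncNorm_nonneg _ _) (by positivity)
  refine (truncNorm_pow_le _ _ _).trans ?_
  rw [pow_mul]
  exact pow_le_pow_left₀ (truncNorm_nonneg _ _) hprod e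

lemma norm_taylor_cyclotomic_pow_coeff_le {ξ ρ : ℂ} {m : ℕ} (hm : 0 < m)
    (hρ : IsPrimitiveRoot ρ m) {A Λ M : ℝ} (hA : 2 + ‖ξ‖ ≤ A) (hΛ : A ≤ Real.exp Λ)
    (hM : ‖ξ - ρ‖ ≤ Real.exp (-M)) {i N d e s : ℕ} (hi : 0 < i) (hiN : i ≤ N)
    (him : i.Coprime m) (hNM : 2 * Λ * N ≤ M / 2) (hse : s ≤ e) (hed : m.totient * e ≤ d) {N₀ : ℝ}
    (hnum : 3 * Λ * (N * d) - (e - s : ℕ) * (M / 2) ≤ -N₀) {k l : ℕ} (hk : k < d) (hl : l < s) :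
    ‖(taylor (ξ ^ i) (X ^ k * (cyclotomic m ℤ ^ e).map (Int.castRingHom ℂ))).coeff l‖ ≤
      Real.exp (-N₀) := by
  have hA2 : 2 ≤ A := by linarith [norm_nonneg ξ]
  have hA1 : 1 ≤ A := by linarith
  have hΛ0 : 0 ≤ Λ := Real.exp_le_exp.1 (by rw [Real.exp_zero]; linarith)
  have hy : ‖ξ ^ i - ρ ^ i‖ ≤ Real.exp (-(M / 2)) := by
    have h1 := norm_pow_sub_pow_le (ξ := ξ) (ρ := ρ) hA2 (by linarith)
      (by rw [hρ.norm'_eq_one hm.ne']; linarith) i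
    refine h1.trans ?_
    calc A ^ (2 * i) * ‖ξ - ρ‖ ≤ Real.exp Λ ^ (2 * N) * Real.exp (-M) := by
          refine mul_le_mul ?_ hM (norm_nonneg _) (by positivity)
          exact (pow_le_pow_right₀ hA1 (Nat.mul_le_mul_left 2 hiN)).trans (by gcongr)
      _ = Real.exp (2 * Λ * N - M) := by
          rw [← Real.exp_nat_mul, ← Real.exp_add]; push_cast; ring_nf
      _ ≤ _ := Real.exp_le_exp.2 (by linarith)
  have hM0 : 0 ≤ M / 2 := le_trans (by positivity) hNM
  have hy1 : ‖ξ ^ i - ρ ^ i‖ ≤ 1 := hy.trans (by rw [Real.exp_le_one_iff]; linarith)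
  refine (norm_coeff_le_truncNorm hl _).trans ?_
  refine (truncNorm_taylor_cyclotomic_pow_le hm (hρ.pow_of_coprime i him) hy1 hse k).trans ?_
  have hx := two_add_norm_pow_le hA hi
  have hφ : 1 ≤ m.totient := Nat.totient_pos.2 hm
  have hN : 1 ≤ N := by omega
  have hed' : e ≤ N * d := by nlinarith
  calc (1 + ‖ξ ^ i‖) ^ k * (2 ^ e * ‖ξ ^ i - ρ ^ i‖ ^ (e - s) *
        (2 + ‖ξ ^ i‖) ^ (m.totient * e))
      ≤ A ^ (N * d) * (A ^ (N * d) * Real.exp (-(M / 2)) ^ (e - s) * A ^ (N * d)) := by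
        gcongr
        · calc (1 + ‖ξ ^ i‖) ^ k ≤ (A ^ i) ^ k := by gcongr; linarith
            _ = A ^ (i * k) := (pow_mul _ _ _).symm
            _ ≤ A ^ (N * d) := pow_le_pow_right₀ hA1 (Nat.mul_le_mul hiN hk.le)
        · exact (pow_le_pow_right₀ one_le_two hed').trans (by gcongr)
        · calc (2 + ‖ξ ^ i‖) ^ (m.totient * e) ≤ (A ^ i) ^ (m.totient * e) := by gcongr
            _ = A ^ (i * (m.totient * e)) := (pow_mul _ _ _).symm
            _ ≤ A ^ (N * d) := pow_le_pow_right₀ hA1 (Nat.mul_le_mul hiN hed)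
    _ = A ^ (3 * (N * d)) * Real.exp (-(M / 2)) ^ (e - s) := by ring
    _ ≤ Real.exp Λ ^ (3 * (N * d)) * Real.exp (-(M / 2)) ^ (e - s) := by gcongr
    _ = Real.exp (3 * Λ * (N * d) - (e - s : ℕ) * (M / 2)) := by
        rw [← Real.exp_nat_mul, ← Real.exp_nat_mul, ← Real.exp_add]
        congr 1
        push_cast
        ring
    _ ≤ _ := Real.exp_le_exp.2 hnum

/-! ### Distance to roots of unity -/

/-- The powers `ξ ^ i` are not too close to one another: the bound for the discriminant in the form
used with `prod_norm_aeval_gcd_le`. -/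
lemma IsNearestRootOfUnity.exp_neg_le_prod {ξ ρ : ℂ} {D B : ℕ} {κ : ℝ}
    (h : IsNearestRootOfUnity ξ ρ D B κ) (hκ0 : 0 < κ) (hκ1 : κ ≤ 1) {A Λ M : ℝ}
    (hA1 : 1 ≤ A) (hAξ : A⁻¹ ≤ ‖ξ‖) (hΛ : Real.exp (-Λ) ≤ κ / A) (hM : Real.exp (-M) ≤ ‖ξ - ρ‖)
    (hM0 : 0 ≤ M) {I : Finset ℕ} {N : ℕ} (hN : N ≤ B) (hI : ∀ i ∈ I, i ≤ N) {i : ℕ} (hi : i ∈ I) :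
    Real.exp (-(N * I.card * Λ + (N / D : ℕ) * M)) ≤ ∏ j ∈ I with j < i, ‖ξ ^ i - ξ ^ j‖ := by
  refine le_trans ?_ (h.prod_norm_pow_sub_ge hκ0 hκ1 (Real.exp_pos _).le hM
    (Real.exp_le_one_iff.2 (by linarith)) hA1 hAξ hN hI hi)
  calc Real.exp (-(N * I.card * Λ + (N / D : ℕ) * M))
      = Real.exp (-Λ) ^ (N * I.card) * Real.exp (-M) ^ (N / D) := by
        rw [← Real.exp_nat_mul, ← Real.exp_nat_mul, ← Real.exp_add]
        congr 1
        push_cast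
        ring
    _ ≤ _ := by gcongr

/-- A polynomial `P` small at powers of `ξ` prevents `-log ‖ξ - ρ‖` from lying in a certain range:
otherwise the common divisor of `P` and of a large power of a cyclotomic polynomial, which is a
smaller power of it, would be too small. -/
theorem IsNearestRootOfUnity.false_of_isAuxiliaryPoly {ξ ρ : ℂ} {m B : ℕ} {κ : ℝ}
    (hnear : IsNearestRootOfUnity ξ ρ m B κ) (hκ0 : 0 < κ) (hκ1 : κ ≤ 1)
    {β σ τ ν : ℝ} {n : ℕ} {P : ℤ[X]} (hP : IsAuxiliaryPoly ξ β σ τ ν n P)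
    {A Λ M : ℝ} (hA : 2 + ‖ξ‖ ≤ A) (hAξ : A⁻¹ ≤ ‖ξ‖) (hΛ : Real.exp (-Λ) ≤ κ / A)
    (hM : ‖ξ - ρ‖ = Real.exp (-M)) {I : Finset ℕ} (hI0 : I.Nonempty) {N d e t : ℕ}
    (hI : ∀ i ∈ I, 0 < i ∧ i ≤ N ∧ i.Coprime m) (hNσ : (N : ℝ) ≤ (n : ℝ) ^ σ)
    (hNm : N * m ≤ B) (ht0 : 0 < t) (ht : (t : ℝ) < (n : ℝ) ^ τ + 1) (hId : I.card * t ≤ d)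
    (hnd : n ≤ d) (hte : t ≤ e) (hed : m.totient * e ≤ d) (htd : 3 * t ≤ d)
    (hΛM : 2 * Λ * N ≤ M / 2) (hnum₁ : 3 * Λ * (N * d) ≤ (n : ℝ) ^ ν / 2)
    (hnum₂ : (n : ℝ) ^ ν ≤ (e - t : ℕ) * (M / 2)) {h : ℝ} (h0 : 0 ≤ h)
    (hPh : intMahler P ≤ Real.exp h)
    (hnum₃ : 2 * d * (Real.log (2 * d) + d + h) ≤ t * I.card * ((n : ℝ) ^ ν / 2) / 4)
    (hnum₄ : t * (N * I.card * Λ + (N / m : ℕ) * M) ≤ (n : ℝ) ^ ν / 2 / 4)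
    {G : ℝ} (hG0 : 0 ≤ G) (hMG : M ≤ m.totient * G)
    (hnum₅ : N * n * Λ + n * G < (n : ℝ) ^ ν / 2 / 2) : False := by
  have hA1 : 1 ≤ A := by linarith [norm_nonneg ξ]
  have hA0 : 0 < A := by linarith
  have hκΛ : Real.exp (-Λ) ≤ κ := hΛ.trans (div_le_self hκ0.le hA1)
  have hAΛ : A ≤ Real.exp Λ := by
    rw [le_div_iff₀ hA0, Real.exp_neg, inv_mul_le_iff₀ (Real.exp_pos _)] at hΛ
    exact hΛ.trans (mul_le_of_le_one_right (Real.exp_pos _).le hκ1)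
  have hΛ0 : 0 ≤ Λ := Real.exp_le_exp.1 (by rw [Real.exp_zero]; linarith)
  have hM0 : 0 ≤ M := by
    have : 0 ≤ 2 * Λ * N := by positivity
    linarith
  obtain ⟨i₁, hi₁⟩ := hI0
  have hN1 : 1 ≤ N := (hI i₁ hi₁).1.trans_le (hI i₁ hi₁).2.1
  have hNB : N ≤ B := (Nat.le_mul_of_pos_right N hnear.pos).trans hNm
  have hdN : d ≤ N * d := Nat.le_mul_of_pos_left d hN1
  have hcyc0 : cyclotomic m ℤ ^ e ≠ 0 := pow_ne_zero _ (cyclotomic_ne_zero m ℤ)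
  set F : Bool → ℤ[X] := fun b => bif b then P else cyclotomic m ℤ ^ e with hF
  obtain ⟨Q, E, V, hQ, hFE, hV⟩ := exists_primitive_gcd F true hP.ne_zero
  have hQP : Q ∣ P := ⟨E true, hFE true⟩
  have hQcyc : Q ∣ cyclotomic m ℤ ^ e := ⟨E false, hFE false⟩
  have hmain := prod_norm_aeval_gcd_le hFE hQ.ne_zero hV true hP.ne_zero (d := d) ht0 ?_ h0 ?_
    hId (fun i hi => hnear.exp_neg_le_prod hκ0 hκ1 hA1 hAξ hΛ hM.ge hM0 hNB
      (fun i hi => (hI i hi).2.1) hi) (N₀ := (n : ℝ) ^ ν / 2) ?_ hnum₃ hnum₄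
  rotate_left
  · rintro (_ | _)
    · simp only [hF, cond_false, natDegree_pow, natDegree_cyclotomic]
      rwa [mul_comm]
    · exact hP.natDegree_le.trans hnd
  · rintro (_ | _) _
    · simp only [hF, cond_false]
      refine le_trans ?_ (Real.one_le_exp h0)
      rw [intMahler_pow]
      refine pow_le_one₀ (zero_le_one.trans (one_le_intMahler (cyclotomic_ne_zero m ℤ))) ?_
      exact (cyclotomic_mahlerMeasure_eq_one (R := ℤ) m).le
    · exact hPh
  · rintro (_ | _) i hi k hk l hl
    · exact norm_taylor_cyclotomic_pow_coeff_le hnear.pos hnear.primitive hA hAΛ hM.le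
        (hI i hi).1 (hI i hi).2.1 (hI i hi).2.2 hΛM hte hed (by linarith) hk hl
    · have h1 := hP.norm_taylor_coeff_le hA hAΛ (i := i) (p := 1) (j := 0) (N := N) (s := t)
        (t := t) (d := d)
        (hI i hi).1 one_pos (by
          rw [mul_one]
          exact le_trans (by exact_mod_cast (hI i hi).2.1) hNσ) ht (by omega) (hI i hi).2.1
          (by rw [mul_one]; exact Nat.mul_le_mul (hI i hi).2.1 (by omega)) (by omega) hnum₁ hk hl
      rw [hasseDeriv_zero', pow_one, comp_X] at h1
      exact h1
  -- the common divisor is a power of the cyclotomic polynomial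
  obtain ⟨r, -, hr⟩ := (dvd_prime_pow (cyclotomic.irreducible hnear.pos).prime e).1 hQcyc
  have hrn : r * m.totient ≤ n := by
    have h1 := natDegree_le_of_dvd (hr.symm.dvd.trans hQP) hP.ne_zero
    rw [natDegree_pow, natDegree_cyclotomic] at h1
    exact h1.trans hP.natDegree_le
  have hlow : ∀ i ∈ I, Real.exp (-(N * n * Λ + n * G)) ≤ ‖aeval (ξ ^ i) Q‖ := by
    intro i hi
    obtain ⟨hi0, hiN, him⟩ := hI i hi
    rw [norm_aeval_of_associated hr, map_pow, norm_pow]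
    have h1 := hnear.le_norm_aeval_cyclotomic hκ0.le hκ1 (Real.exp_pos _).le hM.ge
      (Real.exp_le_one_iff.2 (by linarith)) hi0 hnear.pos
      ((Nat.mul_le_mul_right m hiN).trans hNm) him
    rw [if_pos rfl] at h1
    refine le_trans ?_ (pow_le_pow_left₀ (by positivity) h1 r)
    have h2 : Real.exp (-Λ) ^ (N * n) ≤ (κ ^ (i * m.totient)) ^ r := by
      have hκ' : Real.exp (-Λ) ≤ 1 := Real.exp_le_one_iff.2 (by linarith)
      calc Real.exp (-Λ) ^ (N * n) ≤ Real.exp (-Λ) ^ (i * m.totient * r) := by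
            refine pow_le_pow_of_le_one (Real.exp_pos _).le hκ' ?_
            rw [mul_assoc, mul_comm m.totient]
            exact Nat.mul_le_mul hiN hrn
        _ ≤ κ ^ (i * m.totient * r) := by gcongr
        _ = _ := pow_mul _ _ _
    have h3 : Real.exp (-(n * G)) ≤ Real.exp (-M) ^ r := by
      rw [← Real.exp_nat_mul, Real.exp_le_exp]
      have h4 : (r : ℝ) * M ≤ r * (m.totient * G) := by gcongr
      have h5 : ((r * m.totient : ℕ) : ℝ) * G ≤ n * G := by gcongr
      push_cast at h5
      linarith
    rw [mul_pow]
    calc Real.exp (-(N * n * Λ + n * G)) = Real.exp (-Λ) ^ (N * n) * Real.exp (-(n * G)) := by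
          rw [← Real.exp_nat_mul, ← Real.exp_add]; push_cast; ring_nf
      _ ≤ _ := by gcongr
  have hprod := (Finset.prod_le_prod (fun _ _ => (Real.exp_pos _).le) hlow).trans hmain
  rw [Finset.prod_const, ← Real.exp_nat_mul, Real.exp_le_exp] at hprod
  have hcard : (0 : ℝ) < I.card := by exact_mod_cast Finset.card_pos.2 ⟨i₁, hi₁⟩
  nlinarith

lemma eventually_log_mul_le {A c γ : ℝ} (hA : 0 < A) (hc : 0 < c) (hγ : 0 < γ) :
    ∀ᶠ n : ℕ in atTop, Real.log (A * (2 * (c * (n : ℝ) ^ 3) ^ 2)) ≤ (n : ℝ) ^ γ := by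
  filter_upwards [eventually_mul_log_le 12 hγ,
    eventually_mul_rpow_le (2 * Real.log (A * (2 * c ^ 2))) hγ, eventually_gt_atTop 0]
    with n h1 h2 hn
  have hn0 : (0 : ℝ) < n := by exact_mod_cast hn
  rw [Real.rpow_zero, mul_one] at h2
  have h3 : A * (2 * (c * (n : ℝ) ^ 3) ^ 2) = A * (2 * c ^ 2) * (n : ℝ) ^ 6 := by ring
  rw [h3, Real.log_mul (by positivity) (by positivity), Real.log_pow]
  push_cast
  linarith

lemma IsAuxiliaryPoly.intMahler_le {ξ : ℂ} {β σ τ ν : ℝ} {n : ℕ} {P : ℤ[X]}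
    (hP : IsAuxiliaryPoly ξ β σ τ ν n P) (hβ : 1 ≤ β) (hn : 1 ≤ n) :
    intMahler P ≤ Real.exp (2 * (n : ℝ) ^ β) := by
  have hx : (1 : ℝ) ≤ n := by exact_mod_cast hn
  have h1 : (n : ℝ) ≤ (n : ℝ) ^ β := by
    simpa using Real.rpow_le_rpow_of_exponent_le hx hβ
  refine (intMahler_le_of_abs_coeff_le hP.natDegree_le hP.abs_coeff_le).trans ?_
  rw [two_mul, Real.exp_add]
  gcongr
  exact (Real.add_one_le_exp _).trans (Real.exp_le_exp.2 h1)

lemma card_primes_sdiff_le (N : ℕ) (T : Finset ℕ) :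
    (((Finset.range (N + 1)).filter Nat.Prime) \ T).card ≤ N := by
  have : ((Finset.range (N + 1)).filter Nat.Prime) \ T ⊆ Finset.Icc 1 N := by
    intro p hp
    simp only [Finset.mem_sdiff, Finset.mem_filter, Finset.mem_range] at hp
    rw [Finset.mem_Icc]
    exact ⟨hp.1.2.one_lt.le, by omega⟩
  simpa using Finset.card_le_card this

set_option maxHeartbeats 2000000 in
/-- For large `n` no primitive `m`-th root of unity `ρ` with `φ(m) ≤ 2 n ^ (1 - τ)` is at a distance
`exp (-M)` from `ξ` with `φ(m) n ^ (ν - 1 - 2γ) ≤ M ≤ φ(m) n ^ (ν - 1 - γ)`. -/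
lemma eventually_not_norm_sub_eq_exp_neg {ξ : ℂ} (hξ0 : ξ ≠ 0) {β σ τ ν γ : ℝ} (hγ : 0 < γ)
    (hγσ : γ < σ) (hτ : 0 ≤ τ) (hτσ : τ + σ ≤ 1) (hβ : 1 + 4 * γ ≤ β)
    (hν₁ : 1 + σ + 5 * γ < ν) (hν₂ : 1 + 5 * γ + β < τ + σ + ν)
    (hP : ∀ᶠ n : ℕ in atTop, ∃ P, IsAuxiliaryPoly ξ β σ τ ν n P) :
    ∀ᶠ n : ℕ in atTop, ∀ (ρ : ℂ) (m : ℕ) (M : ℝ), 0 < m → IsPrimitiveRoot ρ m →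
      (m.totient : ℝ) ≤ 2 * (n : ℝ) ^ (1 - τ) → ‖ξ - ρ‖ = Real.exp (-M) →
      m.totient * (n : ℝ) ^ (ν - 1 - 2 * γ) ≤ M → M ≤ m.totient * (n : ℝ) ^ (ν - 1 - γ) →
      False := by
  set A := 2 + ‖ξ‖ + ‖ξ‖⁻¹ with hA
  have hξ' : 0 < ‖ξ‖ := norm_pos_iff.2 hξ0
  have hA2 : 2 + ‖ξ‖ ≤ A := by rw [hA]; linarith [inv_pos.2 hξ']
  have hA0 : 0 < A := by linarith
  have hAξ : A⁻¹ ≤ ‖ξ‖ := by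
    rw [inv_le_comm₀ hA0 hξ']
    linarith
  filter_upwards [hP, eventually_log_mul_le hA0 (c := 8) (by norm_num) hγ,
    eventually_card_primes_sdiff (a := σ) (δ := γ) (by linarith) hγ,
    eventually_mul_log_le 16 (show 0 < σ - γ by linarith),
    eventually_mul_rpow_le 7 (show 1 + 3 * γ < 1 + 4 * γ by linarith),
    eventually_mul_rpow_le 4 (show γ + σ < ν - 1 - 2 * γ by linarith),
    eventually_mul_rpow_le 12 (show 1 + σ + 5 * γ < ν by linarith),
    eventually_mul_rpow_le 2 (show ν < ν + γ by linarith),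
    eventually_mul_rpow_le 320 (show 1 + 4 * γ + β < τ + σ - γ + ν by linarith),
    eventually_mul_rpow_le 32 (show τ + 2 * σ + γ < ν by linarith),
    eventually_mul_rpow_le 32 (show τ + σ + ν - 1 - γ < ν by linarith),
    eventually_mul_rpow_le 16 (show 1 + σ + γ < ν by linarith),
    eventually_mul_rpow_le 16 (show ν - γ < ν by linarith),
    eventually_ge_atTop 2] with n ⟨P, hP⟩ hΛγ hprimes hlog hE₁ hE₂ hE₃ hE₄ hE₅ hE₆ hE₇ hE₈ hE₉ hn
  intro ρ m M hm hρ hφ hM hM₁ hM₂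
  have hn0 : (0 : ℝ) < n := by exact_mod_cast (by omega : 0 < n)
  set x := (n : ℝ) with hx
  have hx2 : 2 ≤ x := by rw [hx]; exact_mod_cast hn
  have hx1 : 1 ≤ x := by linarith
  have hadd : ∀ a b : ℝ, x ^ a * x ^ b = x ^ (a + b) := fun a b => (Real.rpow_add hn0 a b).symm
  have hmono : ∀ {a b : ℝ}, a ≤ b → x ^ a ≤ x ^ b := fun h =>
    Real.rpow_le_rpow_of_exponent_le hx1 h
  have hpos : ∀ a : ℝ, 0 < x ^ a := fun a => Real.rpow_pos_of_pos hn0 a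
  have hone : ∀ {a : ℝ}, 0 ≤ a → 1 ≤ x ^ a := fun h => Real.one_le_rpow hx1 h
  have hx1' : x ^ (1 : ℝ) = x := Real.rpow_one x
  have hφ1 : (1 : ℝ) ≤ m.totient := by exact_mod_cast Nat.totient_pos.2 hm
  have hφ0 : (0 : ℝ) < m.totient := by linarith
  have hmφ : (m.totient : ℝ) ≤ m := by exact_mod_cast Nat.totient_le m
  -- the exponent `t + q` of the cyclotomic polynomial is so large that its Taylor coefficients at
  -- the points `ξ ^ i` are at most `exp (-n ^ ν)`, while its degree stays below `d`
  set t := ⌈x ^ τ⌉₊ with htdef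
  set N := ⌊x ^ σ⌋₊ with hNdef
  set q := ⌈x ^ (1 + 3 * γ) / m.totient⌉₊ with hqdef
  set d := ⌈x ^ (1 + 4 * γ)⌉₊ with hddef
  set B := 8 * n ^ 3 with hBdef
  set Λ := Real.log (A * (2 * (8 * x ^ 3) ^ 2)) with hΛdef
  set I := ((Finset.range (N + 1)).filter Nat.Prime) \ m.primeFactors with hIdef
  have ht1 : x ^ τ ≤ t := Nat.le_ceil _
  have ht2 : (t : ℝ) < x ^ τ + 1 := Nat.ceil_lt_add_one (hpos _).le
  have ht3 : (t : ℝ) ≤ 2 * x ^ τ := by linarith [hone hτ]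
  have ht0 : 0 < t := by
    have : (0 : ℝ) < t := (hpos τ).trans_le ht1
    exact_mod_cast this
  have hN1 : (N : ℝ) ≤ x ^ σ := Nat.floor_le (hpos _).le
  have hNx : (N : ℝ) ≤ x := hN1.trans (by rw [← hx1']; simpa using hmono (by linarith : σ ≤ 1))
  have hd1 : x ^ (1 + 4 * γ) ≤ d := Nat.le_ceil _
  have hd2 : (d : ℝ) ≤ 2 * x ^ (1 + 4 * γ) := by
    have := Nat.ceil_lt_add_one (hpos (1 + 4 * γ)).le
    linarith [hone (by linarith : 0 ≤ 1 + 4 * γ)]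
  have hd0 : (0 : ℝ) < d := (hpos _).trans_le hd1
  have hq1 : x ^ (1 + 3 * γ) / m.totient ≤ q := Nat.le_ceil _
  have hq2 : (q : ℝ) ≤ x ^ (1 + 3 * γ) / m.totient + 1 :=
    (Nat.ceil_lt_add_one (by positivity)).le
  clear_value t q d
  have hx13 : x ≤ x ^ (1 + 3 * γ) := by rw [← hx1']; simpa using hmono (by linarith : 1 ≤ 1 + 3 * γ)
  have hm8 : m ≤ 8 * n ^ 2 := by
    have h1 := le_two_mul_totient_sq m
    have h2 : m.totient ≤ 2 * n := by
      have : (m.totient : ℝ) ≤ 2 * x := hφ.trans (by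
        have := hmono (by linarith : 1 - τ ≤ 1); rw [hx1'] at this; linarith)
      rw [hx] at this
      exact_mod_cast this
    nlinarith
  -- `exp (-Λ)` is the constant `κ / A` of the lower bounds for distances
  have hκ1 : (2 * (B : ℝ) ^ 2)⁻¹ ≤ 1 := by
    refine inv_le_one_of_one_le₀ ?_
    have : (1 : ℝ) ≤ B := by
      exact_mod_cast (by rw [hBdef]; have := Nat.one_le_pow 3 n (by omega); omega : 1 ≤ B)
    nlinarith
  have hB8 : (B : ℝ) = 8 * x ^ 3 := by rw [hBdef, hx]; push_cast; ring
  have hBpos : (0 : ℝ) < B := by rw [hB8]; positivity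
  have hΛκ : Real.exp (-Λ) = (2 * (B : ℝ) ^ 2)⁻¹ / A := by
    rw [hΛdef, Real.exp_neg, Real.exp_log (by positivity), hB8]
    field_simp
  have hΛ0 : 0 ≤ Λ := by
    rw [hΛdef]
    refine Real.log_nonneg ?_
    have h1 : 1 ≤ (8 * x ^ 3) ^ 2 := one_le_pow₀ (by have := one_le_pow₀ hx1 (n := 3); linarith)
    have : (1 : ℝ) * 1 ≤ A * (2 * (8 * x ^ 3) ^ 2) := by
      gcongr <;> linarith [norm_nonneg ξ]
    linarith
  clear_value Λ
  have hMbig : x ^ (ν - 1 - 2 * γ) ≤ M := (le_mul_of_one_le_left (hpos _).le hφ1).trans hM₁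
  have hΛσ : Λ * x ^ σ ≤ x ^ (γ + σ) := by rw [← hadd]; gcongr
  have hM0 : 0 ≤ M := (hpos _).le.trans hMbig
  have hnear : IsNearestRootOfUnity ξ ρ m B (2 * (B : ℝ) ^ 2)⁻¹ := by
    refine isNearestRootOfUnity_of_norm_sub_lt hm ?_ hρ ?_
    · calc m ≤ 8 * n ^ 2 := hm8
        _ ≤ 8 * n ^ 3 := by gcongr <;> omega
    · have h1 : Real.exp (-M) < Real.exp (-Λ) := by
        rw [Real.exp_lt_exp]
        have : x ^ γ ≤ x ^ (γ + σ) := hmono (by linarith)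
        linarith [hpos (γ + σ)]
      rw [hM]
      refine h1.trans_le ?_
      rw [hΛκ]
      exact div_le_self (by positivity) (by linarith [norm_nonneg ξ])
  -- the exponents `i` are the primes up to `n ^ σ` which do not divide `m`
  have hω : (m.primeFactors.card : ℝ) ≤ x ^ (σ - γ) := by
    have h1 := two_pow_card_le_of_primes_dvd hm (T := m.primeFactors) (fun p hp =>
      ⟨Nat.prime_of_mem_primeFactors hp, Nat.dvd_of_mem_primeFactors hp⟩)
    have h2 : (2 : ℝ) ^ m.primeFactors.card ≤ x ^ 5 := by
      calc (2 : ℝ) ^ m.primeFactors.card ≤ m := by exact_mod_cast h1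
        _ ≤ 8 * x ^ 2 := by rw [hx]; exact_mod_cast hm8
        _ ≤ x ^ 3 * x ^ 2 := by
          gcongr
          have := pow_le_pow_left₀ zero_le_two hx2 3
          linarith
        _ = x ^ 5 := by ring
    have h3 := Real.log_le_log (by positivity) h2
    rw [Real.log_pow, Real.log_pow] at h3
    have h4 := Real.log_two_gt_d9
    have h5 : (m.primeFactors.card : ℝ) * 0.5 ≤ m.primeFactors.card * Real.log 2 := by
      gcongr; linarith
    push_cast at h3
    have h6 : 0 ≤ Real.log x := Real.log_nonneg hx1
    linarith
  have hIcard := hprimes _ hω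
  rw [← hIdef] at hIcard
  have hIN : (I.card : ℝ) ≤ x ^ σ := le_trans (by exact_mod_cast card_primes_sdiff_le N _) hN1
  have hI0 : I.Nonempty := by
    rw [← Finset.card_pos]
    have : (0 : ℝ) < I.card := (hpos _).trans_le hIcard
    exact_mod_cast this
  have hI : ∀ i ∈ I, 0 < i ∧ i ≤ N ∧ i.Coprime m := by
    intro i hi
    simp only [hIdef, Finset.mem_sdiff, Finset.mem_filter, Finset.mem_range, Nat.mem_primeFactors,
      not_and, not_not] at hi
    obtain ⟨⟨h1, h2⟩, h3⟩ := hi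
    refine ⟨h2.pos, by omega, (Nat.Prime.coprime_iff_not_dvd h2).2 fun hdvd => ?_⟩
    exact hm.ne' (by simpa using h3 h2 hdvd)
  clear_value I N
  have hστ : x ^ σ * x ^ τ ≤ x := by
    rw [hadd, ← hx1']; simpa using hmono (by linarith : σ + τ ≤ 1)
  have hx14 : 7 * x ≤ d := by linarith
  refine hnear.false_of_isAuxiliaryPoly (by positivity) hκ1 hP hA2 hAξ hΛκ.le hM hI0
    (N := N) (d := d) (e := t + q) (t := t) hI hN1 ?_ ht0 ht2 ?_ ?_ (by omega) ?_ ?_ ?_ ?_ ?_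
    (h := 2 * x ^ β) (by positivity) (hP.intMahler_le (by linarith) (by omega)) ?_ ?_
    (G := x ^ (ν - 1 - γ)) (by positivity) hM₂ ?_
  · -- `N * m ≤ B`
    rw [hx] at hNx
    have h1 : N ≤ n := by exact_mod_cast hNx
    calc N * m ≤ n * (8 * n ^ 2) := Nat.mul_le_mul h1 hm8
      _ = B := by rw [hBdef]; ring
  · have h1 : (I.card : ℝ) * t ≤ d := by
      calc (I.card : ℝ) * t ≤ x ^ σ * (2 * x ^ τ) := by gcongr
        _ = 2 * (x ^ σ * x ^ τ) := by ring
        _ ≤ 2 * x := by linarith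
        _ ≤ d := by linarith
    exact_mod_cast h1
  · have : x ≤ d := by linarith
    rw [hx] at this
    exact_mod_cast this
  · have h1 : (m.totient : ℝ) * (t + q) ≤ d := by
      have h2 : (m.totient : ℝ) * t ≤ 4 * x := by
        calc (m.totient : ℝ) * t ≤ (2 * x ^ (1 - τ)) * (2 * x ^ τ) := by gcongr
          _ = 4 * (x ^ (1 - τ) * x ^ τ) := by ring
          _ = 4 * x := by rw [hadd, sub_add_cancel, hx1']
      have h3 : (m.totient : ℝ) * q ≤ x ^ (1 + 3 * γ) + m.totient := by
        calc (m.totient : ℝ) * q ≤ m.totient * (x ^ (1 + 3 * γ) / m.totient + 1) := by gcongr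
          _ = _ := by field_simp
      have h4 : (m.totient : ℝ) ≤ 2 * x := hφ.trans (by
        have := hmono (by linarith : 1 - τ ≤ 1); rw [hx1'] at this; linarith)
      linarith
    exact_mod_cast h1
  · have h1 : (3 : ℝ) * t ≤ d := by
      have : x ^ τ ≤ x := by rw [← hx1']; simpa using hmono (by linarith : τ ≤ 1)
      linarith
    exact_mod_cast h1
  · calc 2 * Λ * N ≤ 2 * (Λ * x ^ σ) := by rw [mul_assoc]; gcongr
      _ ≤ M / 2 := by linarith
  · calc 3 * Λ * (N * d) ≤ 3 * x ^ γ * (x ^ σ * (2 * x ^ (1 + 4 * γ))) := by gcongr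
      _ = 6 * (x ^ γ * (x ^ σ * x ^ (1 + 4 * γ))) := by ring
      _ = 6 * x ^ (1 + σ + 5 * γ) := by rw [hadd, hadd]; ring_nf
      _ ≤ x ^ ν / 2 := by linarith
  · rw [Nat.add_sub_cancel_left]
    have h1 : x ^ (ν + γ) ≤ q * M := by
      calc x ^ (ν + γ) = x ^ (1 + 3 * γ) * x ^ (ν - 1 - 2 * γ) := by rw [hadd]; ring_nf
        _ = (x ^ (1 + 3 * γ) / m.totient) * (m.totient * x ^ (ν - 1 - 2 * γ)) := by field_simp
        _ ≤ q * M := by gcongr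
    linarith
  · have hlogd : Real.log (2 * d) ≤ 2 * d :=
      (Real.log_le_sub_one_of_pos (by positivity)).trans (by linarith)
    have hxβ : x ^ (1 + 4 * γ) ≤ x ^ β := hmono hβ
    have hlogd0 : 0 ≤ Real.log (2 * d) := Real.log_nonneg (by linarith)
    calc 2 * (d : ℝ) * (Real.log (2 * d) + d + 2 * x ^ β)
        ≤ 2 * (2 * x ^ (1 + 4 * γ)) * (2 * (2 * x ^ β) + 2 * x ^ β + 2 * x ^ β) := by
          gcongr <;> linarith
      _ = 32 * (x ^ (1 + 4 * γ) * x ^ β) := by ring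
      _ = 32 * x ^ (1 + 4 * γ + β) := by rw [hadd]
      _ ≤ x ^ (τ + σ - γ + ν) / 8 := by linarith [hpos (1 + 4 * γ + β)]
      _ = x ^ τ * x ^ (σ - γ) * (x ^ ν / 2) / 4 := by
          rw [show τ + σ - γ + ν = τ + (σ - γ) + ν by ring, ← hadd, ← hadd]; ring
      _ ≤ t * I.card * (x ^ ν / 2) / 4 := by gcongr
  · have h1 : ((N / m : ℕ) : ℝ) * M ≤ x ^ σ * x ^ (ν - 1 - γ) := by
      have hm0 : (0 : ℝ) < m := by exact_mod_cast hm
      calc ((N / m : ℕ) : ℝ) * M ≤ ((N : ℝ) / m) * (m * x ^ (ν - 1 - γ)) := by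
            gcongr
            · exact Nat.cast_div_le
            · exact hM₂.trans (by gcongr)
        _ = N * x ^ (ν - 1 - γ) := by field_simp
        _ ≤ _ := by gcongr
    calc (t : ℝ) * (N * I.card * Λ + (N / m : ℕ) * M)
        ≤ (2 * x ^ τ) * (x ^ σ * x ^ σ * x ^ γ + x ^ σ * x ^ (ν - 1 - γ)) := by gcongr
      _ = 2 * (x ^ τ * (x ^ σ * (x ^ σ * x ^ γ))) + 2 * (x ^ τ * (x ^ σ * x ^ (ν - 1 - γ))) := by
          ring
      _ = 2 * x ^ (τ + 2 * σ + γ) + 2 * x ^ (τ + σ + ν - 1 - γ) := by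
          simp only [hadd]; ring_nf
      _ ≤ x ^ ν / 2 / 4 := by linarith
  · calc (N : ℝ) * x * Λ + x * x ^ (ν - 1 - γ)
        ≤ x ^ σ * x ^ (1 : ℝ) * x ^ γ + x ^ (1 : ℝ) * x ^ (ν - 1 - γ) := by rw [hx1']; gcongr
      _ = x ^ (1 + σ + γ) + x ^ (ν - γ) := by simp only [hadd]; ring_nf
      _ < x ^ ν / 2 / 2 := by linarith [hpos ν]

/-- **Distance to roots of unity.** If it were violated for some `n`, then the first larger `n` for
which the bound holds again would contradict `eventually_not_norm_sub_eq_exp_neg`. -/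
theorem eventually_exp_neg_le_norm_sub {ξ : ℂ} (hξ0 : ξ ≠ 0)
    (hξ : ∀ k : ℕ, 0 < k → ξ ^ k ≠ 1) {β σ τ ν γ : ℝ} (hγ : 0 < γ)
    (hγσ : γ < σ) (hτ : 0 ≤ τ) (hτσ : τ + σ ≤ 1) (hβ : 1 + 4 * γ ≤ β)
    (hν₁ : 1 + σ + 5 * γ < ν) (hν₂ : 1 + 5 * γ + β < τ + σ + ν)
    (hP : ∀ᶠ n : ℕ in atTop, ∃ P, IsAuxiliaryPoly ξ β σ τ ν n P) :
    ∀ᶠ n : ℕ in atTop, ∀ (ρ : ℂ) (m : ℕ), 0 < m → IsPrimitiveRoot ρ m →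
      (m.totient : ℝ) ≤ 2 * (n : ℝ) ^ (1 - τ) →
      Real.exp (-(m.totient * (n : ℝ) ^ (ν - 1 - γ))) ≤ ‖ξ - ρ‖ := by
  obtain ⟨n₀, hn₀⟩ := eventually_atTop.1 ((eventually_not_norm_sub_eq_exp_neg hξ0 hγ hγσ hτ hτσ hβ hν₁ hν₂
    hP).and (eventually_mul_rpow_le (2 ^ (ν - 1 - γ)) (show ν - 1 - 2 * γ < ν - 1 - γ by linarith)))
  filter_upwards [eventually_ge_atTop (n₀ + 1)] with n hn ρ m hm hρ hφ
  by_contra! hlt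
  have hne : ξ ≠ ρ := by
    rintro rfl
    exact hξ m hm hρ.pow_eq_one
  have hpos : 0 < ‖ξ - ρ‖ := norm_pos_iff.2 (sub_ne_zero.2 hne)
  set M := -Real.log ‖ξ - ρ‖ with hMdef
  have hM : ‖ξ - ρ‖ = Real.exp (-M) := by rw [hMdef, neg_neg, Real.exp_log hpos]
  have hφ1 : (1 : ℝ) ≤ m.totient := by exact_mod_cast Nat.totient_pos.2 hm
  have hφ0 : (0 : ℝ) < m.totient := by linarith
  rw [hM, Real.exp_lt_exp, neg_lt_neg_iff] at hlt
  have hκ0 : 0 < ν - 1 - γ := by linarith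
  have hex : ∃ k : ℕ, M ≤ m.totient * ((n + k : ℕ) : ℝ) ^ (ν - 1 - γ) := by
    have h1 := (((tendsto_rpow_atTop hκ0).comp tendsto_natCast_atTop_atTop).eventually_ge_atTop
      M).and (eventually_ge_atTop n)
    obtain ⟨k, hk, hkn⟩ := h1.exists
    refine ⟨k - n, ?_⟩
    rw [Nat.add_sub_cancel' hkn]
    exact hk.trans (le_mul_of_one_le_left (Real.rpow_nonneg (Nat.cast_nonneg k) _) hφ1)
  classical
  set k := Nat.find hex with hk
  have hk1 := Nat.find_spec hex
  rw [← hk] at hk1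
  have hk0 : k ≠ 0 := by
    intro h0
    rw [h0, add_zero] at hk1
    linarith
  have hk2 := Nat.find_min hex (m := k - 1) (by omega)
  rw [not_le] at hk2
  obtain ⟨hA, hB⟩ := hn₀ (n + k) (by omega)
  refine hA ρ m M hm hρ ?_ hM ?_ hk1
  · refine hφ.trans ?_
    gcongr
    · linarith
    · omega
  · refine le_trans ?_ hk2.le
    gcongr
    -- `(n' - 1) ^ a ≥ (n' / 2) ^ a`
    have h2 : ((n + k : ℕ) : ℝ) / 2 ≤ ((n + (k - 1) : ℕ) : ℝ) := by
      have : n + k ≤ 2 * (n + (k - 1)) := by omega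
      rw [div_le_iff₀ two_pos]
      have h3 : ((n + k : ℕ) : ℝ) ≤ ((2 * (n + (k - 1)) : ℕ) : ℝ) := by exact_mod_cast this
      push_cast at h3 ⊢
      linarith
    refine le_trans ?_ (Real.rpow_le_rpow (by positivity) h2 hκ0.le)
    rw [Real.div_rpow (by positivity) zero_le_two, le_div_iff₀ (by positivity), mul_comm]
    exact hB

/-! ### The common divisor of the polynomials `P^{[j]}(T ^ p)` -/

/-- The polynomials `P^{[j]}(T ^ p)`, for `p` in `ps` and `j < t'`, have a common divisor which is
small at the points `ξ ^ i`. -/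
theorem IsAuxiliaryPoly.exists_small_gcd {ξ ρ : ℂ} {D B : ℕ} {κ : ℝ}
    (hnear : IsNearestRootOfUnity ξ ρ D B κ) (hκ0 : 0 < κ) (hκ1 : κ ≤ 1)
    {β σ τ ν : ℝ} {n : ℕ} {P : ℤ[X]} (hP : IsAuxiliaryPoly ξ β σ τ ν n P)
    {A Λ M : ℝ} (hA : 2 + ‖ξ‖ ≤ A) (hAξ : A⁻¹ ≤ ‖ξ‖) (hΛ : Real.exp (-Λ) ≤ κ / A)
    (hM : Real.exp (-M) ≤ ‖ξ - ρ‖) (hM0 : 0 ≤ M) {I : Finset ℕ} {N N₁ d s t t' : ℕ} (hN1 : 1 ≤ N)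
    (hI : ∀ i ∈ I, 0 < i ∧ i ≤ N) (hNB : N ≤ B) {ps : Finset ℕ} (hps0 : ps.Nonempty)
    (hps : ∀ p ∈ ps, 0 < p ∧ p ≤ N₁) (hNN : ((N * N₁ : ℕ) : ℝ) ≤ (n : ℝ) ^ σ)
    (hs0 : 0 < s) (ht0 : 0 < t') (hst : s + t' ≤ t + 1) (ht : (t : ℝ) < (n : ℝ) ^ τ + 1)
    (hId : I.card * s ≤ d) (hnd : n * N₁ ≤ d) (htd : N₁ * (3 * t) ≤ d)
    (hnum₁ : 3 * Λ * (N * d) ≤ (n : ℝ) ^ ν / 2)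
    {h : ℝ} (h0 : (d : ℝ) + n + (n : ℝ) ^ β ≤ h)
    (hnum₃ : 2 * d * (Real.log (2 * d) + d + h) ≤ s * I.card * ((n : ℝ) ^ ν / 2) / 4)
    (hnum₄ : s * (N * I.card * Λ + (N / D : ℕ) * M) ≤ (n : ℝ) ^ ν / 2 / 4) :
    ∃ Q : ℤ[X], Q.IsPrimitive ∧ Q.natDegree ≤ d ∧
      (∀ p ∈ ps, ∀ j < t', Q ∣ (hasseDeriv j P).comp (X ^ p)) ∧
      ∏ i ∈ I, ‖aeval (ξ ^ i) Q‖ ≤ Real.exp (-(I.card * ((n : ℝ) ^ ν / 2) / 2)) := by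
  have hA1 : 1 ≤ A := by linarith [norm_nonneg ξ]
  have hA0 : 0 < A := by linarith
  have hAΛ : A ≤ Real.exp Λ := by
    rw [le_div_iff₀ hA0, Real.exp_neg, inv_mul_le_iff₀ (Real.exp_pos _)] at hΛ
    exact hΛ.trans (mul_le_of_le_one_right (Real.exp_pos _).le hκ1)
  obtain ⟨p₁, hp₁⟩ := hps0
  have hN₁ : 1 ≤ N₁ := (hps p₁ hp₁).1.trans_le (hps p₁ hp₁).2
  have hdN : d ≤ N * d := Nat.le_mul_of_pos_left d hN1
  set F : ps × Fin t' → ℤ[X] := fun q => (hasseDeriv (q.2 : ℕ) P).comp (X ^ (q.1 : ℕ)) with hF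
  have hdeg : ∀ q, (F q).natDegree ≤ d := by
    rintro ⟨⟨p, hp⟩, j⟩
    refine (natDegree_hasseDeriv_comp_le P j p).trans (le_trans ?_ hnd)
    exact Nat.mul_le_mul hP.natDegree_le (hps p hp).2
  set q₀ : ps × Fin t' := (⟨p₁, hp₁⟩, ⟨0, ht0⟩)
  have hF₀ : F q₀ ≠ 0 := by
    simp only [hF, q₀, hasseDeriv_zero']
    rw [← expand_eq_comp_X_pow]
    exact (expand_ne_zero (hps p₁ hp₁).1).2 hP.ne_zero
  obtain ⟨Q, E, V, hQ, hFE, hV⟩ := exists_primitive_gcd F q₀ hF₀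
  have hQF : ∀ q, Q ∣ F q := fun q => ⟨E q, hFE q⟩
  have h00 : 0 ≤ h := le_trans (by positivity) h0
  refine ⟨Q, hQ, (natDegree_le_of_dvd (hQF q₀) hF₀).trans (hdeg q₀),
    fun p hp j hj => ?_, ?_⟩
  · have := hQF (⟨p, hp⟩, ⟨j, hj⟩)
    simpa only [hF] using this
  refine prod_norm_aeval_gcd_le hFE hQ.ne_zero hV q₀ hF₀ (d := d) hs0 hdeg h00 ?_
    hId (fun i hi => hnear.exp_neg_le_prod hκ0 hκ1 hA1 hAξ hΛ hM hM0 hNB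
      (fun i hi => (hI i hi).2) hi) (N₀ := (n : ℝ) ^ ν / 2) ?_ hnum₃ hnum₄
  · rintro ⟨⟨p, hp⟩, j⟩ -
    have hdq := hdeg (⟨p, hp⟩, j)
    have hcq := abs_coeff_hasseDeriv_comp_le hP.natDegree_le hP.abs_coeff_le (hps p hp).1 (j : ℕ)
    simp only [hF] at hdq ⊢
    refine (intMahler_le_of_abs_coeff_le hdq hcq).trans ?_
    have e1 : (d : ℝ) + 1 ≤ Real.exp d := Real.add_one_le_exp _
    have e2 : (2 : ℝ) ^ n ≤ Real.exp n := by
      have h1 : (2 : ℝ) ≤ Real.exp 1 := by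
        have := Real.add_one_le_exp 1; linarith
      calc (2 : ℝ) ^ n ≤ Real.exp 1 ^ n := pow_le_pow_left₀ zero_le_two h1 n
        _ = Real.exp n := by rw [← Real.exp_nat_mul, mul_one]
    calc ((d : ℝ) + 1) * (2 ^ n * Real.exp ((n : ℝ) ^ β))
        ≤ Real.exp d * (Real.exp n * Real.exp ((n : ℝ) ^ β)) := by gcongr
      _ = Real.exp (d + n + (n : ℝ) ^ β) := by rw [← Real.exp_add, ← Real.exp_add, add_assoc]
      _ ≤ Real.exp h := Real.exp_le_exp.2 h0
  · rintro ⟨⟨p, hp⟩, j⟩ i hi k hk l hl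
    obtain ⟨hp0, hpN⟩ := hps p hp
    refine hP.norm_taylor_coeff_le hA hAΛ (hI i hi).1 hp0 ?_ ht (s := s) (N := N) (d := d) ?_
      (hI i hi).2 ?_ ?_ hnum₁ hk hl
    · exact le_trans (by exact_mod_cast Nat.mul_le_mul (hI i hi).2 hpN) hNN
    · have := j.2
      omega
    · rw [mul_assoc]
      refine Nat.mul_le_mul (hI i hi).2 (le_trans ?_ htd)
      exact Nat.mul_le_mul hpN (by omega)
    · refine le_trans ?_ (htd.trans hdN)
      exact Nat.le_mul_of_pos_left _ hN₁

/-! ### Removing the factors with a root which is zero or a root of unity -/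

/-- The polynomial has a nonzero root which is not a root of unity. -/
def HasNontorsionRoot (R : ℤ[X]) : Prop :=
  ∃ α : ℂ, aeval α R = 0 ∧ α ≠ 0 ∧ ∀ m : ℕ, 0 < m → α ^ m ≠ 1

lemma pow_count_normalizedFactors_dvd {Q : ℤ[X]} (hQ : Q ≠ 0) (R : ℤ[X]) :
    R ^ (normalizedFactors Q).count R ∣ Q := by
  by_cases hR : R ∈ normalizedFactors Q
  · exact (Finset.dvd_prod_of_mem (fun V => V ^ (normalizedFactors Q).count V)
      (Multiset.mem_toFinset.2 hR)).trans (prod_normalizedFactors_pow_count hQ).dvd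
  · rw [Multiset.count_eq_zero_of_notMem hR, pow_zero]
    exact one_dvd Q

/-- Multiplicity of a cyclotomic polynomial in the common divisor. -/
lemma totient_mul_le_of_pow_dvd {P : ℤ[X]} (hP : P ≠ 0) {m p k t : ℕ} (hm : 0 < m) (hp : p.Prime)
    (hpm : ¬ p ∣ m) (hk : 0 < k) (ht : 0 < t)
    (h : ∀ j < t, cyclotomic m ℤ ^ k ∣ (hasseDeriv j P).comp (X ^ p)) :
    m.totient * (k + t - 1) ≤ P.natDegree := by
  have hζ := Complex.isPrimitiveRoot_exp m hm.ne'
  set ζ := Complex.exp (2 * Real.pi * Complex.I / m)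
  have hroot : ∀ θ : ℂ, IsPrimitiveRoot θ m → aeval θ (cyclotomic m ℤ) = 0 := by
    intro θ hθ
    rw [aeval_eq_eval_map, map_cyclotomic]
    exact hθ.isRoot_cyclotomic hm
  have h1 := pow_dvd_of_pow_dvd_hasseDeriv_comp hP (cyclotomic.irreducible hm)
    (hζ.ne_zero hm.ne') (hroot ζ hζ) hp.pos hk ht
    (hroot _ (hζ.pow_of_coprime p ((Nat.Prime.coprime_iff_not_dvd hp).2 hpm))) h
  have h2 := natDegree_le_of_dvd h1 hP
  rwa [natDegree_pow, natDegree_cyclotomic, mul_comm] at h2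

/-- The factors of `Q` whose roots are zero or roots of unity contribute little at `ξ ^ i`. -/
lemma IsNearestRootOfUnity.exp_neg_le_prod_torsion {ξ ρ : ℂ} {D B : ℕ} {κ : ℝ}
    (hnear : IsNearestRootOfUnity ξ ρ D B κ) (hκ1 : κ ≤ 1)
    {A Λ M : ℝ} (hA1 : 1 ≤ A) (hAξ : A⁻¹ ≤ ‖ξ‖) (hΛ0 : 0 ≤ Λ) (hΛ : Real.exp (-Λ) ≤ κ / A)
    (hM : Real.exp (-M) ≤ ‖ξ - ρ‖) (hM0 : 0 ≤ M) {Q : ℤ[X]} (hQ : Q.IsPrimitive) {N d : ℕ}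
    (hQd : Q.natDegree ≤ d) {W : ℝ} (hW0 : 0 ≤ W)
    (hcyc : ∀ m : ℕ, 0 < m → cyclotomic m ℤ ∈ normalizedFactors Q → N * m ≤ B)
    (hW : (normalizedFactors Q).count (cyclotomic D ℤ) * M ≤ W)
    {i : ℕ} (hi : 0 < i) (hiN : i ≤ N) (hiD : i.Coprime D)
    [DecidablePred HasNontorsionRoot] :
    Real.exp (-(Λ * (N * d) + W)) ≤
      ∏ R ∈ (normalizedFactors Q).toFinset with ¬ HasNontorsionRoot R,
        ‖aeval (ξ ^ i) R‖ ^ (normalizedFactors Q).count R := by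
  classical
  have hA0 : 0 < A := by linarith
  have hκ0 : 0 ≤ κ := by
    have h1 := (Real.exp_pos (-Λ)).le.trans hΛ
    have h2 := mul_nonneg h1 hA0.le
    rwa [div_mul_cancel₀ _ hA0.ne'] at h2
  have hκΛ : Real.exp (-Λ) ≤ κ := hΛ.trans (div_le_self hκ0 hA1)
  have hAΛ : Real.exp (-Λ) ≤ ‖ξ‖ := by
    refine hΛ.trans (le_trans ?_ hAξ)
    rw [div_eq_mul_inv]
    exact mul_le_of_le_one_left (by positivity) hκ1
  have hΛ1 : Real.exp (-Λ) ≤ 1 := Real.exp_le_one_iff.2 (by linarith)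
  have hM1 : Real.exp (-M) ≤ 1 := Real.exp_le_one_iff.2 (by linarith)
  set c := fun R : ℤ[X] => (normalizedFactors Q).count R
  set T := (normalizedFactors Q).toFinset.filter fun R => ¬ HasNontorsionRoot R with hT
  have hstep : ∀ R ∈ T, Real.exp (-Λ) ^ (N * (c R * R.natDegree)) *
      (if R = cyclotomic D ℤ then Real.exp (-M) ^ c R else 1) ≤ ‖aeval (ξ ^ i) R‖ ^ c R := by
    intro R hR
    obtain ⟨hRQ, hR'⟩ := Finset.mem_filter.1 hR
    rw [Multiset.mem_toFinset] at hRQ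
    have key : Real.exp (-Λ) ^ (N * R.natDegree) *
        (if R = cyclotomic D ℤ then Real.exp (-M) else 1) ≤ ‖aeval (ξ ^ i) R‖ := by
      rcases eq_X_or_cyclotomic_or_exists_root hQ hRQ with rfl | ⟨m, hm, rfl⟩ | h3
      · have h1 : (if (X : ℤ[X]) = cyclotomic D ℤ then Real.exp (-M) else 1) ≤ 1 := by
          split_ifs
          · exact hM1
          · exact le_rfl
        have h2 : Real.exp (-Λ) ^ (N * (X : ℤ[X]).natDegree) ≤ ‖ξ‖ ^ i := by
          rw [natDegree_X, mul_one]
          exact (pow_le_pow_of_le_one (Real.exp_pos _).le hΛ1 hiN).trans (by gcongr)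
        rw [aeval_X, norm_pow]
        exact (mul_le_of_le_one_right (by positivity) h1).trans h2
      · refine le_trans ?_ (hnear.le_norm_aeval_cyclotomic hκ0 hκ1 (Real.exp_pos _).le hM hM1
          hi hm ((Nat.mul_le_mul_right m hiN).trans (hcyc m hm hRQ)) hiD)
        rw [natDegree_cyclotomic]
        refine mul_le_mul ?_ ?_ (by split_ifs <;> positivity) (by positivity)
        · exact (pow_le_pow_of_le_one (Real.exp_pos _).le hΛ1
            (Nat.mul_le_mul_right _ hiN)).trans (by gcongr)
        · by_cases hmD : m = D
          · rw [if_pos hmD, if_pos (by rw [hmD])]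
          · rw [if_neg hmD]
            split_ifs
            · exact hM1
            · exact le_rfl
      · exact absurd h3 hR'
    refine le_trans (le_of_eq ?_) (pow_le_pow_left₀ (by positivity) key (c R))
    rw [mul_pow, ← pow_mul]
    congr 1
    · congr 1; ring
    · split_ifs <;> simp
  refine le_trans ?_ (Finset.prod_le_prod (fun R _ => by positivity) hstep)
  rw [Finset.prod_mul_distrib, Finset.prod_pow_eq_pow_sum, ← Finset.mul_sum, Finset.prod_ite_eq']
  rw [neg_add, Real.exp_add]
  refine mul_le_mul ?_ ?_ (Real.exp_pos _).le (by positivity)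
  · have h1 : ∑ R ∈ T, c R * R.natDegree ≤ d := by
      refine (Finset.sum_le_sum_of_subset (Finset.filter_subset _ _)).trans ?_
      exact (sum_count_mul_natDegree hQ.ne_zero).le.trans hQd
    refine le_trans (le_of_eq ?_) (pow_le_pow_of_le_one (Real.exp_pos _).le hΛ1
      (Nat.mul_le_mul_left N h1))
    rw [← Real.exp_nat_mul]
    push_cast
    ring_nf
  · split_ifs
    · rw [← Real.exp_nat_mul, Real.exp_le_exp]
      linarith
    · exact Real.exp_le_one_iff.2 (by linarith)

/-! ### The choice of an irreducible factor -/

lemma exists_le_exp_of_prod_pow_le {ι : Type*} (L : Finset ι) {f w : ι → ℝ} {k : ι → ℕ}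
    {U W : ℝ} (hU : 0 < U) (hW : 0 < W)
    (hsum : ∑ R ∈ L, k R * w R < W) (hprod : ∏ R ∈ L, f R ^ k R ≤ Real.exp (-U)) :
    ∃ R ∈ L, f R ≤ Real.exp (-(U / W * w R)) := by
  by_contra! h
  have h1 : ∏ R ∈ L, Real.exp (-(U / W * w R)) ^ k R ≤ ∏ R ∈ L, f R ^ k R :=
    Finset.prod_le_prod (fun R _ => by positivity) fun R hR =>
      pow_le_pow_left₀ (Real.exp_pos _).le (h R hR).le _
  have h2 : ∏ R ∈ L, Real.exp (-(U / W * w R)) ^ k R =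
      Real.exp (-(U / W * ∑ R ∈ L, k R * w R)) := by
    simp_rw [← Real.exp_nat_mul]
    rw [← Real.exp_sum, Finset.mul_sum, ← Finset.sum_neg_distrib]
    congr 1
    refine Finset.sum_congr rfl fun R _ => by ring
  rw [h2] at h1
  have h3 := Real.exp_le_exp.1 (h1.trans hprod)
  have h4 : U / W * ∑ R ∈ L, k R * w R < U := by
    calc U / W * ∑ R ∈ L, k R * w R < U / W * W := by gcongr
      _ = U := div_mul_cancel₀ _ hW.ne'
  linarith

/-- Bounds for the degrees and the Mahler measures of the irreducible factors, summed with
multiplicities: most primes are good, so that each irreducible factor of the common divisor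
produces many factors of `P`. -/
lemma sum_natDegree_and_log_intMahler_le {P : ℤ[X]} (hP : P ≠ 0) (L : Finset ℤ[X]) (k : ℤ[X] → ℕ)
    {t : ℕ} (ht : 0 < t) (ps : Finset ℕ)
    (hL : ∀ R ∈ L, Irreducible R ∧ 0 < k R ∧ HasNontorsionRoot R)
    (hass : ∀ R ∈ L, ∀ R' ∈ L, Associated R R' → R = R')
    (hdvd : ∀ R ∈ L, ∀ p ∈ ps, ∀ j < t, R ^ k R ∣ (hasseDeriv j P).comp (X ^ p)) {r₀ : ℕ}
    (hr₀ : ∀ r : ℕ, (2 : ℝ) ^ 2 ^ r ≤ intMahler P ^ (16 * P.natDegree ^ 2) → r ≤ r₀)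
    {y : ℝ} (hy : 0 ≤ y) (hps : ∀ p ∈ ps, p.Prime ∧ p ≠ 2 ∧ y ≤ p) (hcard : 2 * y ≤ ps.card)
    (hbad : ∀ R ∈ L, ∀ b : ℕ, 2 ^ b ≤ R.natDegree ^ 2 → (b : ℝ) ≤ y) :
    (∑ R ∈ L, ((k R + t - 1 : ℕ) : ℝ) * R.natDegree) * y ≤ r₀ * P.natDegree ∧
    (∑ R ∈ L, ((k R + t - 1 : ℕ) : ℝ) * Real.log (intMahler R)) * y ^ 2 ≤
      r₀ * Real.log (intMahler P) := by
  classical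
  have hgood : ∀ R ∈ L, y ≤ ((ps.filter (IsGoodPrime R)).card : ℝ) := by
    intro R hR
    obtain ⟨hirr, -, α, hα, -⟩ := hL R hR
    have h1 := two_pow_card_not_isGoodPrime_le hirr hα (ps.filter fun p => ¬ IsGoodPrime R p)
      (fun p hp => ⟨(hps p (Finset.mem_filter.1 hp).1).1, (hps p (Finset.mem_filter.1 hp).1).2.1⟩)
      (fun p hp => (Finset.mem_filter.1 hp).2)
    have h2 := hbad R hR _ h1
    have h3 : ((ps.filter (IsGoodPrime R)).card : ℝ) +
        (ps.filter fun p => ¬ IsGoodPrime R p).card = ps.card := by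
      exact_mod_cast Finset.card_filter_add_card_filter_not (s := ps) (IsGoodPrime R)
    linarith
  have hlog : ∀ R : ℤ[X], R ≠ 0 → 0 ≤ Real.log (intMahler R) := fun R hR =>
    Real.log_nonneg (one_le_intMahler hR)
  constructor
  · have h1 := sum_good_primes_le hP L k ht ps hL hass hdvd hr₀ (fun V => (V.natDegree : ℝ))
      (fun _ _ => by positivity) (fun R _ => (R.natDegree : ℝ))
      (fun R p V _ _ h _ => by rw [h])
    have h2 : ∑ V ∈ (normalizedFactors P).toFinset,
        ((normalizedFactors P).count V : ℝ) * V.natDegree = P.natDegree := by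
      exact_mod_cast sum_count_mul_natDegree hP
    rw [h2] at h1
    refine le_trans ?_ h1
    rw [Finset.sum_mul]
    refine Finset.sum_le_sum fun R hR => ?_
    rw [Finset.sum_const, nsmul_eq_mul, mul_comm]
    gcongr
    exact hgood R hR
  · have h1 := sum_good_primes_le hP L k ht ps hL hass hdvd hr₀ (fun V => Real.log (intMahler V))
      (fun V hV => hlog V hV) (fun R p => p * Real.log (intMahler R))
      (fun R p V hR hV _ h => by
        rw [← Real.log_pow]
        exact Real.log_le_log (pow_pos (zero_lt_one.trans_le (one_le_intMahler hR)) _) h)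
    refine le_trans ?_ (h1.trans ?_)
    · rw [Finset.sum_mul]
      refine Finset.sum_le_sum fun R hR => ?_
      have hR0 := hlog R (hL R hR).1.ne_zero
      calc ((k R + t - 1 : ℕ) : ℝ) * Real.log (intMahler R) * y ^ 2
          = y * (((k R + t - 1 : ℕ) : ℝ) * (y * Real.log (intMahler R))) := by ring
        _ ≤ (ps.filter (IsGoodPrime R)).card *
            (((k R + t - 1 : ℕ) : ℝ) * (y * Real.log (intMahler R))) := by
          gcongr
          exact hgood R hR
        _ = ∑ p ∈ ps with IsGoodPrime R p,
            ((k R + t - 1 : ℕ) : ℝ) * (y * Real.log (intMahler R)) := by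
          rw [Finset.sum_const, nsmul_eq_mul]
        _ ≤ _ := by
          refine Finset.sum_le_sum fun p hp => ?_
          gcongr
          exact (hps p (Finset.mem_filter.1 hp).1).2.2
    · gcongr
      exact sum_count_mul_log_intMahler_le hP

/-! ### A small product of values without torsion factors -/

set_option maxHeartbeats 2000000 in
/-- For large `n`, the common divisor `Q` of the polynomials `P^{[j]}(T ^ p)` is small at the points
`ξ ^ i`, and remains so when only its irreducible factors with a nonzero root which is not a root of
unity are kept. The integer `D` is the order of the root of unity nearest to `ξ`. -/
lemma eventually_exists_small_factors {ξ : ℂ} (hξ0 : ξ ≠ 0)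
    (hξ : ∀ k : ℕ, 0 < k → ξ ^ k ≠ 1) {β ε μ σ τ ν γ : ℝ} (hγ : 0 < γ) (hγε : 8 * γ ≤ ε)
    (hμ : 0 < μ) (hμσ : μ + 2 * ε < σ) (hτ : 0 ≤ τ) (hτσ : τ + σ ≤ 1) (hβ₁ : 1 + σ - μ < β)
    (hβ₂ : 2 * μ + τ < β) (hν : 1 + β + σ - 2 * μ - τ + 2 * ε < ν)
    (hP : ∀ᶠ n : ℕ in atTop, ∃ P, IsAuxiliaryPoly ξ β σ τ ν n P)
    [DecidablePred HasNontorsionRoot] :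
    ∀ᶠ n : ℕ in atTop, ∀ P : ℤ[X], IsAuxiliaryPoly ξ β σ τ ν n P → ∃ D : ℕ, 1 ≤ D ∧
      D ≤ 2 * n ^ 3 ∧ ∀ I : Finset ℕ, (n : ℝ) ^ (μ - ε) ≤ (I.card : ℝ) →
      (∀ i ∈ I, 1 ≤ i ∧ (i : ℝ) ≤ (n : ℝ) ^ μ ∧ Nat.Coprime i D) →
      ∀ ps : Finset ℕ, (∀ p ∈ ps, p.Prime ∧ (p : ℝ) ≤ (n : ℝ) ^ (σ - μ)) →
      (n : ℝ) ^ (σ - μ - γ) ≤ ps.card →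
      ∃ Q : ℤ[X], Q.IsPrimitive ∧ (Q.natDegree : ℝ) ≤ (n : ℝ) ^ 2 ∧
        (∀ p ∈ ps, ∀ j < ⌈(n : ℝ) ^ τ⌉₊ / 2 + 1, Q ∣ (hasseDeriv j P).comp (X ^ p)) ∧
        ∏ R ∈ (normalizedFactors Q).toFinset with HasNontorsionRoot R,
          (∏ i ∈ I, ‖aeval (ξ ^ i) R‖) ^ (normalizedFactors Q).count R ≤
            Real.exp (-(I.card * (n : ℝ) ^ ν / 8)) := by
  set A := 2 + ‖ξ‖ + ‖ξ‖⁻¹ with hA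
  have hξ' : 0 < ‖ξ‖ := norm_pos_iff.2 hξ0
  have hA2 : 2 + ‖ξ‖ ≤ A := by rw [hA]; linarith [inv_pos.2 hξ']
  have hA0 : 0 < A := by linarith
  have hA1 : 1 ≤ A := by linarith
  have hAξ : A⁻¹ ≤ ‖ξ‖ := by
    rw [inv_le_comm₀ hA0 hξ']
    linarith
  clear_value A
  filter_upwards [eventually_exp_neg_le_norm_sub hξ0 hξ hγ (by linarith) hτ hτσ (by linarith)
      (by linarith) (by linarith) hP,
    eventually_log_mul_le hA0 (c := 2) (by norm_num) hγ,
    eventually_mul_log_le 16 (show 0 < σ - μ - γ by linarith),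
    eventually_mul_rpow_le 6 (show τ < 1 by linarith),
    eventually_mul_rpow_le 2 (show μ + τ < 1 by linarith),
    eventually_mul_rpow_le 96 (show 1 + σ + γ < ν by linarith),
    eventually_mul_rpow_le 256 (show 1 + σ - μ + β < τ + (μ - ε) + ν by linarith),
    eventually_mul_rpow_le 32 (show τ + 2 * μ + γ < ν by linarith),
    eventually_mul_rpow_le 32 (show τ + μ + ν - 1 - γ < ν by linarith),
    eventually_mul_rpow_le 16 (show ν - γ < ν by linarith),
    eventually_ge_atTop 2] with n hdist hΛγ hlog hE₁ hE₂ hE₃ hE₄ hE₅ hE₆ hE₇ hn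
  intro P hP
  have hn0 : (0 : ℝ) < n := by exact_mod_cast (by omega : 0 < n)
  have hx2 : (2 : ℝ) ≤ n := by exact_mod_cast hn
  -- `x` stands for `n` seen as a real number
  obtain ⟨x, hx⟩ : ∃ x : ℝ, (n : ℝ) = x := ⟨_, rfl⟩
  simp only [hx] at hdist hΛγ hlog hE₁ hE₂ hE₃ hE₄ hE₅ hE₆ hE₇ hn0 hx2 ⊢
  have hx1 : 1 ≤ x := by linarith
  have hadd : ∀ a b : ℝ, x ^ a * x ^ b = x ^ (a + b) := fun a b => (Real.rpow_add hn0 a b).symm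
  have hmono : ∀ {a b : ℝ}, a ≤ b → x ^ a ≤ x ^ b := fun h =>
    Real.rpow_le_rpow_of_exponent_le hx1 h
  have hpos : ∀ a : ℝ, 0 < x ^ a := fun a => Real.rpow_pos_of_pos hn0 a
  have hone : ∀ {a : ℝ}, 0 ≤ a → 1 ≤ x ^ a := fun h => Real.one_le_rpow hx1 h
  have hx1' : x ^ (1 : ℝ) = x := Real.rpow_one x
  rw [hx1'] at hE₁ hE₂
  obtain ⟨t, htdef⟩ : ∃ t : ℕ, ⌈x ^ τ⌉₊ = t := ⟨_, rfl⟩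
  obtain ⟨N, hNdef⟩ : ∃ N : ℕ, ⌊x ^ μ⌋₊ = N := ⟨_, rfl⟩
  obtain ⟨N₁, hN₁def⟩ : ∃ N : ℕ, ⌊x ^ (σ - μ)⌋₊ = N := ⟨_, rfl⟩
  obtain ⟨B, hBdef⟩ : ∃ B : ℕ, B = 2 * n ^ 3 := ⟨_, rfl⟩
  obtain ⟨Λ, hΛdef⟩ : ∃ Λ : ℝ, Λ = Real.log (A * (2 * (2 * x ^ 3) ^ 2)) := ⟨_, rfl⟩
  rw [← hΛdef] at hΛγ
  rw [htdef]
  have ht1 : x ^ τ ≤ t := by rw [← htdef]; exact Nat.le_ceil _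
  have ht2 : (t : ℝ) < x ^ τ + 1 := by rw [← htdef]; exact Nat.ceil_lt_add_one (hpos _).le
  have ht3 : (t : ℝ) ≤ 2 * x ^ τ := by linarith [hone hτ]
  have ht0 : 0 < t := by
    have : (0 : ℝ) < t := (hpos τ).trans_le ht1
    exact_mod_cast this
  have hN : (N : ℝ) ≤ x ^ μ := by rw [← hNdef]; exact Nat.floor_le (hpos _).le
  have hNn : N ≤ n := by
    have h1 : (N : ℝ) ≤ n := by
      rw [hx, ← hx1']; exact hN.trans (hmono (by linarith : μ ≤ 1))
    exact_mod_cast h1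
  have hN1 : 1 ≤ N := by rw [← hNdef]; exact Nat.le_floor (by simpa using hone hμ.le)
  have hN₁ : (N₁ : ℝ) ≤ x ^ (σ - μ) := by rw [← hN₁def]; exact Nat.floor_le (hpos _).le
  have hN₁1 : 1 ≤ N₁ := by
    rw [← hN₁def]; exact Nat.le_floor (by simpa using hone (by linarith : 0 ≤ σ - μ))
  have hN₁n : N₁ ≤ n := by
    have h1 : (N₁ : ℝ) ≤ n := by
      rw [hx, ← hx1']; exact hN₁.trans (hmono (by linarith : σ - μ ≤ 1))
    exact_mod_cast h1
  obtain ⟨d, hddef⟩ : ∃ d : ℕ, d = n * N₁ := ⟨_, rfl⟩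
  have hd : (d : ℝ) ≤ x ^ (1 + σ - μ) := by
    rw [hddef]
    push_cast
    rw [hx]
    calc x * N₁ ≤ x ^ (1 : ℝ) * x ^ (σ - μ) := by rw [hx1']; gcongr
      _ = x ^ (1 + σ - μ) := by rw [hadd]; ring_nf
  have hnd : n ≤ d := by rw [hddef]; exact Nat.le_mul_of_pos_right n hN₁1
  have hxd : x ≤ d := by rw [← hx]; exact_mod_cast hnd
  have hd2 : (d : ℝ) ≤ x ^ 2 := by
    rw [← Real.rpow_two]; exact hd.trans (hmono (by linarith))
  have hB0 : 0 < B := by rw [hBdef]; have := Nat.one_le_pow 3 n (by omega); omega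
  have hnB : n ≤ B := by
    rw [hBdef]
    calc n = 1 * n ^ 1 := by ring
      _ ≤ 2 * n ^ 3 := Nat.mul_le_mul (by omega) (Nat.pow_le_pow_right (by omega) (by omega))
  have hB2 : (B : ℝ) = 2 * x ^ 3 := by rw [hBdef]; push_cast; rw [hx]
  obtain ⟨ρ, D, hDB, hnear⟩ := exists_isNearestRootOfUnity ξ hB0
  refine ⟨D, hnear.pos, by rw [← hBdef]; exact hDB, ?_⟩
  intro I hIcard hI ps hps hpscard
  have hBr : (1 : ℝ) ≤ B := by exact_mod_cast hB0
  have hκ1 : (2 * (B : ℝ) ^ 2)⁻¹ ≤ 1 := inv_le_one_of_one_le₀ (by nlinarith)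
  have hκ0 : 0 < (2 * (B : ℝ) ^ 2)⁻¹ := by positivity
  have hΛκ : Real.exp (-Λ) = (2 * (B : ℝ) ^ 2)⁻¹ / A := by
    rw [hΛdef, Real.exp_neg, Real.exp_log (by positivity), hB2]
    field_simp
  have hΛ0 : 0 ≤ Λ := by
    have h1 : Real.exp (-Λ) ≤ 1 := by
      rw [hΛκ]
      exact div_le_one_of_le₀ (hκ1.trans hA1) hA0.le
    rw [Real.exp_le_one_iff] at h1
    linarith
  obtain ⟨G, hG⟩ : ∃ G : ℝ, x ^ (ν - 1 - γ) = G := ⟨_, rfl⟩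
  have hG0 : 0 < G := by rw [← hG]; exact hpos _
  -- when `φ(D)` is large, the size of `M` is irrelevant: then `D > N`, and `Φ_D` does not divide
  -- the common divisor
  obtain ⟨M, hM, hM0, hMG⟩ : ∃ M : ℝ, Real.exp (-M) ≤ ‖ξ - ρ‖ ∧ 0 ≤ M ∧
      ((D.totient : ℝ) ≤ 2 * x ^ (1 - τ) → M ≤ D.totient * G) := by
    by_cases hφ : (D.totient : ℝ) ≤ 2 * x ^ (1 - τ)
    · refine ⟨D.totient * G, ?_, by positivity, fun _ => le_rfl⟩
      rw [← hG]
      exact hdist ρ D hnear.pos hnear.primitive hφ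
    · have hne : ξ ≠ ρ := by
        rintro rfl
        exact hξ D hnear.pos hnear.primitive.pow_eq_one
      have hpos' : 0 < ‖ξ - ρ‖ := norm_pos_iff.2 (sub_ne_zero.2 hne)
      refine ⟨max 0 (-Real.log ‖ξ - ρ‖), ?_, le_max_left _ _, fun h => absurd h hφ⟩
      rw [← Real.log_le_log_iff (Real.exp_pos _) hpos', Real.log_exp, neg_le]
      exact le_max_right _ _
  have hI' : ∀ i ∈ I, 0 < i ∧ i ≤ N := fun i hi =>
    ⟨(hI i hi).1, by rw [← hNdef]; exact Nat.le_floor (hI i hi).2.1⟩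
  have hIN : (I.card : ℝ) ≤ x ^ μ := by
    refine le_trans ?_ hN
    have h1 : I ⊆ Finset.Icc 1 N := fun i hi => Finset.mem_Icc.2 (hI' i hi)
    have h2 := Finset.card_le_card h1
    rw [Nat.card_Icc, Nat.add_sub_cancel] at h2
    exact_mod_cast h2
  have hps' : ∀ p ∈ ps, 0 < p ∧ p ≤ N₁ := fun p hp =>
    ⟨(hps p hp).1.pos, by rw [← hN₁def]; exact Nat.le_floor (hps p hp).2⟩
  have hps0 : ps.Nonempty := by
    rw [← Finset.card_pos]
    have : (0 : ℝ) < ps.card := (hpos _).trans_le hpscard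
    exact_mod_cast this
  obtain ⟨s, hs⟩ : ∃ s : ℕ, s = t - t / 2 := ⟨_, rfl⟩
  have hs1 : x ^ τ / 2 ≤ s := by
    have h1 : (t : ℝ) ≤ 2 * s := by exact_mod_cast (by omega : t ≤ 2 * s)
    linarith
  have hs2 : (s : ℝ) ≤ 2 * x ^ τ := le_trans (by exact_mod_cast (by omega : s ≤ t)) ht3
  have hΛNd : Λ * (N * d) ≤ x ^ (1 + σ + γ) := by
    calc Λ * (N * d) ≤ x ^ γ * (x ^ μ * x ^ (1 + σ - μ)) := by gcongr
      _ = x ^ (1 + σ + γ) := by rw [hadd, hadd]; ring_nf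
  have h3t : 3 * t ≤ n := by
    have h1 : (3 : ℝ) * t ≤ n := by rw [hx]; linarith
    exact_mod_cast h1
  have hxβ : x ^ (1 + σ - μ) ≤ x ^ β := hmono (by linarith)
  have hxβ' : x ≤ x ^ β := by
    have := hmono (by linarith : 1 ≤ β)
    rwa [hx1'] at this
  have hφx : ∀ m : ℕ, m.totient * (t / 2 + 1) ≤ n → (m.totient : ℝ) ≤ 2 * x ^ (1 - τ) := by
    intro m hm
    have h1 : (m.totient : ℝ) * (x ^ τ / 2) ≤ x := by
      have h2 : (t : ℝ) ≤ 2 * ((t / 2 + 1 : ℕ) : ℝ) := by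
        exact_mod_cast (by omega : t ≤ 2 * (t / 2 + 1))
      calc (m.totient : ℝ) * (x ^ τ / 2) ≤ m.totient * ((t / 2 + 1 : ℕ) : ℝ) := by
            gcongr; linarith
        _ ≤ x := by rw [← hx]; exact_mod_cast hm
    have h2 : x ^ (1 - τ) * x ^ τ = x := by rw [hadd, sub_add_cancel, hx1']
    have h3 : (m.totient : ℝ) * x ^ τ ≤ 2 * x ^ (1 - τ) * x ^ τ := by linarith
    exact le_of_mul_le_mul_right h3 (hpos τ)
  obtain ⟨Q, hQ, hQd, hQdvd, hQsmall⟩ := hP.exists_small_gcd hnear hκ0 hκ1 hA2 hAξ hΛκ.le hM hM0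
    hN1 hI' (hNn.trans hnB) hps0 hps' (N₁ := N₁) (d := d) (s := s) (t := t) (t' := t / 2 + 1)
    (h := 3 * x ^ β)
    (by
      push_cast
      rw [hx]
      calc (N : ℝ) * N₁ ≤ x ^ μ * x ^ (σ - μ) := by gcongr
        _ = x ^ σ := by rw [hadd]; ring_nf)
    (by omega) (by omega) (by omega) (by rw [hx]; exact ht2)
    (by
      have h1 : (I.card : ℝ) * s ≤ d := by
        calc (I.card : ℝ) * s ≤ x ^ μ * (2 * x ^ τ) := by gcongr
          _ = 2 * (x ^ μ * x ^ τ) := by ring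
          _ = 2 * x ^ (μ + τ) := by rw [hadd]
          _ ≤ d := by linarith
      exact_mod_cast h1)
    hddef.ge
    (by
      rw [hddef, mul_comm n]
      exact Nat.mul_le_mul_left _ h3t)
    (by rw [hx, mul_assoc]; linarith [hpos ν])
    (by rw [hx]; linarith)
    (by
      rw [hx]
      have hd0 : (0 : ℝ) < d := by linarith
      have hlogd : Real.log (2 * d) ≤ 2 * d :=
        (Real.log_le_sub_one_of_pos (by positivity)).trans (by linarith)
      have hlogd0 : 0 ≤ Real.log (2 * d) := Real.log_nonneg (by linarith)
      have hβ0 := hpos β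
      calc 2 * (d : ℝ) * (Real.log (2 * d) + d + 3 * x ^ β)
          ≤ 2 * x ^ (1 + σ - μ) * (2 * x ^ β + x ^ β + 3 * x ^ β) := by
            gcongr <;> linarith
        _ = 12 * (x ^ (1 + σ - μ) * x ^ β) := by ring
        _ = 12 * x ^ (1 + σ - μ + β) := by rw [hadd]
        _ ≤ x ^ (τ + (μ - ε) + ν) / 16 := by linarith [hpos (1 + σ - μ + β)]
        _ = x ^ τ / 2 * x ^ (μ - ε) * (x ^ ν / 2) / 4 := by rw [← hadd, ← hadd]; ring
        _ ≤ s * I.card * (x ^ ν / 2) / 4 := by gcongr)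
    (by
      rw [hx]
      have h1 : ((N / D : ℕ) : ℝ) * M ≤ x ^ μ * G := by
        rcases lt_or_ge N D with hND | hND
        · rw [Nat.div_eq_of_lt hND, Nat.cast_zero, zero_mul]
          positivity
        · have hD0 : (0 : ℝ) < D := by exact_mod_cast hnear.pos
          have hφD : (D.totient : ℝ) ≤ D := by exact_mod_cast Nat.totient_le D
          have h2 : (D.totient : ℝ) ≤ 2 * x ^ (1 - τ) := by
            have h3 : (D : ℝ) ≤ N := by exact_mod_cast hND
            have h4 : x ^ μ ≤ x ^ (1 - τ) := hmono (by linarith)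
            linarith [hpos (1 - τ)]
          calc ((N / D : ℕ) : ℝ) * M ≤ ((N : ℝ) / D) * (D * G) := by
                gcongr
                · exact Nat.cast_div_le
                · exact (hMG h2).trans (by gcongr)
            _ = N * G := by field_simp
            _ ≤ _ := by gcongr
      calc (s : ℝ) * (N * I.card * Λ + (N / D : ℕ) * M)
          ≤ (2 * x ^ τ) * (x ^ μ * x ^ μ * x ^ γ + x ^ μ * x ^ (ν - 1 - γ)) := by
            rw [hG]; gcongr
        _ = 2 * (x ^ τ * (x ^ μ * (x ^ μ * x ^ γ))) + 2 * (x ^ τ * (x ^ μ * x ^ (ν - 1 - γ))) := by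
            ring
        _ = 2 * x ^ (τ + 2 * μ + γ) + 2 * x ^ (τ + μ + ν - 1 - γ) := by
            simp only [hadd]; ring_nf
        _ ≤ x ^ ν / 2 / 4 := by linarith)
  rw [hx] at hQsmall
  have hQd' : (Q.natDegree : ℝ) ≤ x ^ 2 := le_trans (by exact_mod_cast hQd) hd2
  refine ⟨Q, hQ, hQd', hQdvd, ?_⟩
  -- some prime of `ps` does not divide `m`, so that `Φ_m` divides `P` to a high order
  have hmult : ∀ m : ℕ, 0 < m → cyclotomic m ℤ ∈ normalizedFactors Q →
      m.totient * ((normalizedFactors Q).count (cyclotomic m ℤ) + (t / 2 + 1) - 1) ≤ n := by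
    intro m hm hmQ
    have hφd : (m.totient : ℝ) ≤ x ^ 2 := by
      refine le_trans ?_ hQd'
      have := natDegree_le_of_dvd (dvd_of_mem_normalizedFactors hmQ) hQ.ne_zero
      rw [natDegree_cyclotomic] at this
      exact_mod_cast this
    obtain ⟨p, hp, hpm⟩ : ∃ p ∈ ps, ¬ p ∣ m := by
      by_contra! hall
      have h1 := two_pow_card_le_of_primes_dvd hm (T := ps) fun p hp => ⟨(hps p hp).1, hall p hp⟩
      have h2 : (2 : ℝ) ^ ps.card ≤ x ^ 5 := by
        calc (2 : ℝ) ^ ps.card ≤ m := by exact_mod_cast h1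
          _ ≤ 2 * (m.totient : ℝ) ^ 2 := by exact_mod_cast le_two_mul_totient_sq m
          _ ≤ x * (x ^ 2) ^ 2 := by gcongr
          _ = x ^ 5 := by ring
      have h3 := Real.log_le_log (by positivity) h2
      rw [Real.log_pow, Real.log_pow] at h3
      have h4 := Real.log_two_gt_d9
      have h5 : (ps.card : ℝ) * 0.5 ≤ ps.card * Real.log 2 := by gcongr; linarith
      push_cast at h3
      have h6 : 0 < Real.log x := Real.log_pos (by linarith)
      linarith
    refine (totient_mul_le_of_pow_dvd hP.ne_zero hm (hps p hp).1 hpm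
      (Multiset.count_pos.2 hmQ) (by omega) fun j hj => ?_).trans hP.natDegree_le
    exact (pow_count_normalizedFactors_dvd hQ.ne_zero _).trans (hQdvd p hp j hj)
  have hcyc : ∀ m : ℕ, 0 < m → cyclotomic m ℤ ∈ normalizedFactors Q → N * m ≤ B := by
    intro m hm hmQ
    have h1 := hmult m hm hmQ
    have h2 := Multiset.count_pos.2 hmQ
    have h3 : m.totient ≤ n := (Nat.le_mul_of_pos_right _ (by omega)).trans h1
    calc N * m ≤ n * (2 * n ^ 2) := by
          refine Nat.mul_le_mul hNn ((le_two_mul_totient_sq m).trans ?_)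
          gcongr
      _ = B := by rw [hBdef]; ring
  have hW : (normalizedFactors Q).count (cyclotomic D ℤ) * M ≤ x ^ (ν - γ) := by
    by_cases hmem : cyclotomic D ℤ ∈ normalizedFactors Q
    · have h1 := hmult D hnear.pos hmem
      have h2 := Multiset.count_pos.2 hmem
      set c := (normalizedFactors Q).count (cyclotomic D ℤ)
      have h3 : D.totient * (t / 2 + 1) ≤ n :=
        (Nat.mul_le_mul_left _ (by omega)).trans h1
      have h4 : D.totient * c ≤ n := (Nat.mul_le_mul_left _ (by omega)).trans h1
      calc (c : ℝ) * M ≤ c * (D.totient * G) := by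
            gcongr
            exact hMG (hφx D h3)
        _ = ((D.totient * c : ℕ) : ℝ) * G := by push_cast; ring
        _ ≤ n * G := by gcongr
        _ = x ^ (1 : ℝ) * x ^ (ν - 1 - γ) := by rw [hx1', hx, hG]
        _ = x ^ (ν - γ) := by rw [hadd]; ring_nf
    · rw [Multiset.count_eq_zero_of_notMem hmem, Nat.cast_zero, zero_mul]
      exact (hpos _).le
  have htors : ∀ i ∈ I, Real.exp (-(x ^ ν / 8)) ≤
      ∏ R ∈ (normalizedFactors Q).toFinset with ¬ HasNontorsionRoot R,
        ‖aeval (ξ ^ i) R‖ ^ (normalizedFactors Q).count R := by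
    intro i hi
    refine le_trans ?_ (hnear.exp_neg_le_prod_torsion hκ1 hA1 hAξ hΛ0 hΛκ.le hM hM0 hQ hQd
      (hpos (ν - γ)).le hcyc hW (hI' i hi).1 (hI' i hi).2 (hI i hi).2.2)
    rw [Real.exp_le_exp]
    linarith [hpos ν]
  have hsplit : ∏ i ∈ I, ‖aeval (ξ ^ i) Q‖ =
      (∏ R ∈ (normalizedFactors Q).toFinset with HasNontorsionRoot R,
        (∏ i ∈ I, ‖aeval (ξ ^ i) R‖) ^ (normalizedFactors Q).count R) *
      ∏ i ∈ I, ∏ R ∈ (normalizedFactors Q).toFinset with ¬ HasNontorsionRoot R,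
        ‖aeval (ξ ^ i) R‖ ^ (normalizedFactors Q).count R := by
    simp_rw [← Finset.prod_pow]
    rw [Finset.prod_comm, ← Finset.prod_mul_distrib]
    refine Finset.prod_congr rfl fun i _ => ?_
    rw [Finset.prod_filter_mul_prod_filter_not,
      ← norm_aeval_of_associated (prod_normalizedFactors_pow_count hQ.ne_zero), map_prod, norm_prod]
    simp only [map_pow, norm_pow]
  rw [hsplit] at hQsmall
  have hprod := Finset.prod_le_prod (fun _ _ => (Real.exp_pos _).le) htors
  rw [Finset.prod_const, ← Real.exp_nat_mul] at hprod
  have hL0 : 0 ≤ ∏ R ∈ (normalizedFactors Q).toFinset with HasNontorsionRoot R,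
      (∏ i ∈ I, ‖aeval (ξ ^ i) R‖) ^ (normalizedFactors Q).count R :=
    Finset.prod_nonneg fun R _ => pow_nonneg (Finset.prod_nonneg fun _ _ => norm_nonneg _) _
  have h1 := (mul_le_mul_of_nonneg_left hprod hL0).trans hQsmall
  rw [mul_neg, Real.exp_neg, ← div_eq_mul_inv, div_le_iff₀ (Real.exp_pos _), ← Real.exp_add] at h1
  refine h1.trans (Real.exp_le_exp.2 (le_of_eq ?_))
  ring

/-! ### The weights of the irreducible factors -/

/-- An irreducible polynomial with small values has a power with the required properties: the
number `w` measures its degree and its Mahler measure. -/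
lemma exists_pow_of_small {ξ : ℂ} {R : ℤ[X]} (hR : R.IsPrimitive) {I : Finset ℕ}
    {w K Z : ℝ} (hw : 0 < w) (hK : 0 < K) (hZ : 0 ≤ Z)
    (hsmall : ∏ i ∈ I, ‖aeval (ξ ^ i) R‖ ≤ Real.exp (-(Z * w))) {a b : ℝ} (ha : 0 ≤ a)
    (hb : 0 ≤ b) (hdeg : (R.natDegree : ℝ) ≤ w * a) (hlog : Real.log (intMahler R) ≤ w * b) :
    ∃ k : ℕ, 0 < k ∧ ((R ^ k).natDegree : ℝ) ≤ (K + w) * a ∧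
      Real.log (polyHeight (R ^ k)) ≤ (K + w) * (a + b) ∧
      ∏ i ∈ I, ‖aeval (ξ ^ i) (R ^ k)‖ ≤ Real.exp (-(Z * K)) := by
  have hk0 : 0 < ⌈K / w⌉₊ := Nat.ceil_pos.2 (by positivity)
  have hk1 : K ≤ ⌈K / w⌉₊ * w := by
    rw [← div_le_iff₀ hw]
    exact Nat.le_ceil _
  have hk2 : ⌈K / w⌉₊ * w ≤ K + w := by
    have h1 := (Nat.ceil_lt_add_one (div_pos hK hw).le).le
    calc ⌈K / w⌉₊ * w ≤ (K / w + 1) * w := by gcongr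
      _ = K + w := by field_simp
  set k := ⌈K / w⌉₊
  have hprim : (R ^ k).IsPrimitive := by
    induction k with
    | zero => rw [pow_zero]; exact isPrimitive_one
    | succ k ih => rw [pow_succ]; exact ih.mul hR
  have hdegk : ((R ^ k).natDegree : ℝ) ≤ (K + w) * a := by
    rw [natDegree_pow]
    push_cast
    calc (k : ℝ) * R.natDegree ≤ k * (w * a) := by gcongr
      _ = k * w * a := by ring
      _ ≤ (K + w) * a := by gcongr
  refine ⟨k, hk0, hdegk, ?_, ?_⟩
  · rw [polyHeight_of_isPrimitive hprim]
    obtain ⟨j, hj⟩ := (R ^ k).exists_eq_supNorm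
    have h1 := abs_coeff_le_two_pow_mul_intMahler (R ^ k) j
    have hM := one_le_intMahler hR.ne_zero
    have hpos : 0 < (R ^ k).supNorm := by
      refine lt_of_le_of_ne (supNorm_nonneg _) fun h0 => hprim.ne_zero ?_
      rwa [eq_comm, supNorm_eq_zero_iff] at h0
    rw [← Int.norm_eq_abs, ← hj, intMahler_pow] at h1
    have h2 := Real.log_le_log hpos h1
    rw [Real.log_mul (by positivity) (by positivity), Real.log_pow, Real.log_pow] at h2
    have h3 := Real.log_two_lt_d9
    have h4 : ((R ^ k).natDegree : ℝ) * Real.log 2 ≤ (R ^ k).natDegree :=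
      mul_le_of_le_one_right (by positivity) (by linarith)
    have h5 : (k : ℝ) * Real.log (intMahler R) ≤ (K + w) * b := by
      calc (k : ℝ) * Real.log (intMahler R) ≤ k * (w * b) := by gcongr
        _ = k * w * b := by ring
        _ ≤ (K + w) * b := by gcongr
    linarith
  · simp only [map_pow, norm_pow]
    rw [Finset.prod_pow]
    calc (∏ i ∈ I, ‖aeval (ξ ^ i) R‖) ^ k ≤ Real.exp (-(Z * w)) ^ k :=
          pow_le_pow_left₀ (Finset.prod_nonneg fun _ _ => norm_nonneg _) hsmall k
      _ = Real.exp (-(Z * (k * w))) := by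
          rw [← Real.exp_nat_mul]; ring_nf
      _ ≤ _ := by
          rw [Real.exp_le_exp, neg_le_neg_iff]
          gcongr

lemma eq_of_associated_of_mem_normalizedFactors {Q R R' : ℤ[X]} (hR : R ∈ normalizedFactors Q)
    (hR' : R' ∈ normalizedFactors Q) (h : Associated R R') : R = R' := by
  rw [← normalize_normalized_factor R hR, ← normalize_normalized_factor R' hR']
  exact normalize_eq_normalize h.dvd h.symm.dvd

end


set_option maxHeartbeats 2000000 in
theorem proposition9p4
    (ξ : ℂ) (hξ0 : ξ ≠ 0) (hξ : ∀ k : ℕ, 0 < k → ξ ^ k ≠ 1)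
    (β ε μ σ τ ν : ℝ)
    (hμ : 0 < μ) (hμσ : μ < σ)
    (hτ : 0 ≤ τ) (hτσ : τ ≤ 1 - σ)
    (hβ : max (1 + σ - μ) (2 * μ + τ) < β)
    (hε : 0 < 2 * ε) (hε' : 2 * ε < min μ (σ - μ))
    (hν : 1 + β + σ - 2 * μ - τ + 2 * ε < ν)
    -- for all large `n` there is a polynomial `P = P_n`; `hasseDeriv j P` is `P^{(j)} / j!`
    (hP : ∀ᶠ n : ℕ in atTop, ∃ P : ℤ[X], P ≠ 0 ∧
      P.natDegree ≤ n ∧ polyHeight P ≤ Real.exp ((n : ℝ) ^ β) ∧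
      ∀ i j : ℕ, 1 ≤ i → (i : ℝ) ≤ (n : ℝ) ^ σ → (j : ℝ) < (n : ℝ) ^ τ →
        ‖aeval (ξ ^ i) (hasseDeriv j P)‖ < Real.exp (-(n : ℝ) ^ ν)) :
    ∀ᶠ n : ℕ in atTop, ∃ D : ℕ, 1 ≤ D ∧ D ≤ 2 * n ^ 3 ∧
      ∀ I : Finset ℕ, (n : ℝ) ^ (μ - ε) ≤ (I.card : ℝ) →
        (∀ i ∈ I, 1 ≤ i ∧ (i : ℝ) ≤ (n : ℝ) ^ μ ∧ Nat.Coprime i D) →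
        ∃ S : ℤ[X], IsPrimaryPoly S ∧
          (S.natDegree : ℝ) ≤ (n : ℝ) ^ (1 - (σ - μ) - τ + 3 * ε) ∧
          Real.log (polyHeight S) ≤ (n : ℝ) ^ (β - 2 * (σ - μ) - τ + 3 * ε) ∧
          ∏ i ∈ I, ‖aeval (ξ ^ i) S‖ ≤ Real.exp (-(n : ℝ) ^ (ν + μ - τ - 2 * ε)) := by
  have hβ₁ := (le_max_left _ _).trans_lt hβ
  have hβ₂ := (le_max_right _ _).trans_lt hβ
  have hε₁ := hε'.trans_le (min_le_left _ _)
  have hε₂ := hε'.trans_le (min_le_right _ _)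
  obtain ⟨γ, hγε⟩ : ∃ γ : ℝ, ε = 8 * γ := ⟨ε / 8, by ring⟩
  have hγ : 0 < γ := by linarith
  have hP' : ∀ᶠ n : ℕ in atTop, ∃ P, IsAuxiliaryPoly ξ β σ τ ν n P := by
    filter_upwards [hP] with n ⟨P, hP0, hdeg, hH, hval⟩
    exact ⟨_, isAuxiliaryPoly_primPart hP0 hdeg hH hval⟩
  have : DecidablePred HasNontorsionRoot := Classical.decPred _
  filter_upwards [hP', eventually_exists_small_factors hξ0 hξ hγ hγε.ge hμ (by linarith) hτ
      (by linarith) hβ₁ hβ₂ hν hP',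
    eventually_card_primes_sdiff (a := σ - μ) (δ := γ / 2) (by linarith) (by linarith),
    eventually_mul_rpow_le 10 (show σ - μ - γ < σ - μ - γ / 2 by linarith),
    eventually_mul_log_le 16 (show 0 < σ - μ - γ by linarith),
    eventually_mul_log_le (4 * (2 + β)) hγ,
    eventually_mul_rpow_le 256 hγ,
    eventually_ge_atTop 2] with n ⟨P, hP⟩ hfac hprimes hE₁ hlog hlog₂ hE₂ hn
  obtain ⟨D, hD1, hD2, hD⟩ := hfac P hP
  refine ⟨D, hD1, hD2, fun I hIcard hI => ?_⟩
  have hn0 : (0 : ℝ) < n := by exact_mod_cast (by omega : 0 < n)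
  have hx2 : (2 : ℝ) ≤ n := by exact_mod_cast hn
  have hDI := hD I hIcard hI
  have hPM := hP.intMahler_le (by linarith) (by omega)
  have hPd : (P.natDegree : ℝ) ≤ n := by exact_mod_cast hP.natDegree_le
  -- `x` stands for `n` seen as a real number
  obtain ⟨x, hx⟩ : ∃ x : ℝ, (n : ℝ) = x := ⟨_, rfl⟩
  simp only [hx] at hDI hprimes hE₁ hlog hlog₂ hE₂ hn0 hx2 hPM hPd hIcard ⊢
  have hx1 : 1 ≤ x := by linarith
  have hadd : ∀ a b : ℝ, x ^ a * x ^ b = x ^ (a + b) := fun a b => (Real.rpow_add hn0 a b).symm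
  have hmono : ∀ {a b : ℝ}, a ≤ b → x ^ a ≤ x ^ b := fun h =>
    Real.rpow_le_rpow_of_exponent_le hx1 h
  have hpos : ∀ a : ℝ, 0 < x ^ a := fun a => Real.rpow_pos_of_pos hn0 a
  have hone : ∀ {a : ℝ}, 0 ≤ a → 1 ≤ x ^ a := fun h => Real.one_le_rpow hx1 h
  have hx1' : x ^ (1 : ℝ) = x := Real.rpow_one x
  have hlogx : 0 < Real.log x := Real.log_pos (by linarith)
  have hlog2 := Real.log_two_gt_d9
  rw [Real.rpow_zero, mul_one] at hE₂
  obtain ⟨y, hy⟩ : ∃ y : ℝ, x ^ (σ - μ - γ) = y := ⟨_, rfl⟩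
  have hy1 : 1 ≤ y := by rw [← hy]; exact hone (by linarith)
  obtain ⟨t, ht⟩ : ∃ t : ℕ, ⌈x ^ τ⌉₊ / 2 + 1 = t := ⟨_, rfl⟩
  have ht1 : x ^ τ ≤ 2 * t := by
    have h1 : x ^ τ ≤ ⌈x ^ τ⌉₊ := Nat.le_ceil _
    have h2 : (⌈x ^ τ⌉₊ : ℝ) ≤ 2 * t := by exact_mod_cast (by omega : ⌈x ^ τ⌉₊ ≤ 2 * t)
    linarith
  have ht0 : 0 < t := by omega
  rw [hy] at hE₁ hlog
  -- the primes used are odd and not too small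
  obtain ⟨ps, hpsdef⟩ : ∃ ps : Finset ℕ, ps = ((Finset.range (⌊x ^ (σ - μ)⌋₊ + 1)).filter Nat.Prime) \
    Finset.range (⌈y⌉₊ + 3) := ⟨_, rfl⟩
  have hcard : 2 * y ≤ (ps.card : ℝ) := by
    have h1 := hprimes (Finset.range (⌈y⌉₊ + 3)) (by
      rw [Finset.card_range]
      push_cast
      have := Nat.ceil_lt_add_one (by linarith : 0 ≤ y)
      linarith)
    rw [← hpsdef] at h1
    linarith
  have hps : ∀ p ∈ ps, p.Prime ∧ p ≠ 2 ∧ y ≤ p ∧ (p : ℝ) ≤ x ^ (σ - μ) := by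
    intro p hp
    simp only [hpsdef, Finset.mem_sdiff, Finset.mem_filter, Finset.mem_range, not_lt] at hp
    obtain ⟨⟨h1, h2⟩, h3⟩ := hp
    refine ⟨h2, by omega, ?_, ?_⟩
    · exact (Nat.le_ceil y).trans (by exact_mod_cast (by omega : ⌈y⌉₊ ≤ p))
    · exact (Nat.le_floor_iff (hpos _).le).1 (by omega)
  obtain ⟨Q, hQ, hQd, hQdvd, hQsmall⟩ := hDI ps (fun p hp => ⟨(hps p hp).1, (hps p hp).2.2.2⟩)
    (by rw [hy]; linarith)
  rw [ht] at hQdvd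
  set L := (UniqueFactorizationMonoid.normalizedFactors Q).toFinset.filter HasNontorsionRoot with hLdef
  obtain ⟨c, hc⟩ : ∃ c : ℤ[X] → ℕ, c = fun R => (UniqueFactorizationMonoid.normalizedFactors Q).count R := ⟨_, rfl⟩
  have hLmem : ∀ R ∈ L, R ∈ UniqueFactorizationMonoid.normalizedFactors Q ∧ HasNontorsionRoot R := fun R hR => by
    rw [hLdef, Finset.mem_filter, Multiset.mem_toFinset] at hR
    exact hR
  have hL : ∀ R ∈ L, Irreducible R ∧ 0 < c R ∧ HasNontorsionRoot R := fun R hR =>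
    ⟨UniqueFactorizationMonoid.irreducible_of_normalized_factor R (hLmem R hR).1, by
      rw [hc]; exact Multiset.count_pos.2 (hLmem R hR).1, (hLmem R hR).2⟩
  have hr₀ : ∀ r : ℕ, (2 : ℝ) ^ 2 ^ r ≤ intMahler P ^ (16 * P.natDegree ^ 2) → r ≤ ⌊x ^ γ⌋₊ := by
    intro r hr
    apply Nat.le_floor
    have hM1 := one_le_intMahler hP.ne_zero
    have h1 : (2 : ℝ) ^ 2 ^ r ≤ Real.exp (32 * x ^ (2 + β)) := by
      calc (2 : ℝ) ^ 2 ^ r ≤ intMahler P ^ (16 * P.natDegree ^ 2) := hr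
        _ ≤ intMahler P ^ (16 * n ^ 2) := by
          gcongr
          exact hP.natDegree_le
        _ ≤ Real.exp (2 * x ^ β) ^ (16 * n ^ 2) := by gcongr
        _ = Real.exp (32 * x ^ (2 + β)) := by
          rw [← Real.exp_nat_mul, ← hadd, Real.rpow_two]
          push_cast
          rw [hx]
          ring_nf
    have h2 := Real.log_le_log (by positivity) h1
    rw [Real.log_exp, Real.log_pow] at h2
    push_cast at h2
    have h3 : (2 : ℝ) ^ r ≤ 64 * x ^ (2 + β) := by
      have : (2 : ℝ) ^ r * 0.5 ≤ 2 ^ r * Real.log 2 := by gcongr; linarith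
      linarith
    have h4 := Real.log_le_log (by positivity) h3
    rw [Real.log_mul (by norm_num) (hpos _).ne', Real.log_pow, Real.log_rpow hn0] at h4
    have h5 : Real.log 64 ≤ 64 := Real.log_le_self (by norm_num)
    have h6 : (r : ℝ) * 0.5 ≤ r * Real.log 2 := by gcongr; linarith
    linarith
  have hRQ : ∀ R ∈ L, R ∣ Q := fun R hR => UniqueFactorizationMonoid.dvd_of_mem_normalizedFactors (hLmem R hR).1
  have hbad : ∀ R ∈ L, ∀ b : ℕ, 2 ^ b ≤ R.natDegree ^ 2 → (b : ℝ) ≤ y := by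
    intro R hR b hb
    have h1 : (R.natDegree : ℝ) ≤ x ^ 2 :=
      le_trans (by exact_mod_cast natDegree_le_of_dvd (hRQ R hR) hQ.ne_zero) hQd
    have h2 : (2 : ℝ) ^ b ≤ x ^ 4 := by
      calc (2 : ℝ) ^ b ≤ (R.natDegree : ℝ) ^ 2 := by exact_mod_cast hb
        _ ≤ (x ^ 2) ^ 2 := by gcongr
        _ = x ^ 4 := by ring
    have h3 := Real.log_le_log (by positivity) h2
    rw [Real.log_pow, Real.log_pow] at h3
    push_cast at h3
    have h4 : (b : ℝ) * 0.5 ≤ b * Real.log 2 := by gcongr; linarith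
    linarith
  obtain ⟨hsum₁, hsum₂⟩ := sum_natDegree_and_log_intMahler_le hP.ne_zero L c ht0 ps hL
    (fun R hR R' hR' h => eq_of_associated_of_mem_normalizedFactors (hLmem R hR).1
      (hLmem R' hR').1 h)
    (fun R _ p hp j hj => by
      rw [hc]
      exact (pow_count_normalizedFactors_dvd hQ.ne_zero R).trans (hQdvd p hp j hj))
    hr₀ (by linarith) (fun p hp => ⟨(hps p hp).1, (hps p hp).2.1, (hps p hp).2.2.1⟩) hcard hbad
  have hfloor : ((⌊x ^ γ⌋₊ : ℕ) : ℝ) ≤ x ^ γ := Nat.floor_le (hpos _).le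
  have hlogP : Real.log (intMahler P) ≤ 2 * x ^ β := by
    rw [Real.log_le_iff_le_exp (zero_lt_one.trans_le (one_le_intMahler hP.ne_zero))]
    exact hPM
  have hlogP0 : 0 ≤ Real.log (intMahler P) := Real.log_nonneg (one_le_intMahler hP.ne_zero)
  -- the weight `w R` compares the degree of `R` with `n / y` and its logarithmic Mahler measure with
  -- `n ^ β / y ^ 2`; the sum of the weights with multiplicities is at most `3 n ^ γ`
  obtain ⟨w, hw⟩ : ∃ w : ℤ[X] → ℝ, w = fun R : ℤ[X] => R.natDegree * (y / x) +
    Real.log (intMahler R) * (y ^ 2 / x ^ β) := ⟨_, rfl⟩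
  have hy0 : 0 < y := by linarith
  have hβ0 := hpos β
  have hwsum : ∑ R ∈ L, ((c R + t - 1 : ℕ) : ℝ) * w R ≤ 3 * x ^ γ := by
    have h1 : ∑ R ∈ L, ((c R + t - 1 : ℕ) : ℝ) * w R =
        (∑ R ∈ L, ((c R + t - 1 : ℕ) : ℝ) * R.natDegree) * y / x +
        (∑ R ∈ L, ((c R + t - 1 : ℕ) : ℝ) * Real.log (intMahler R)) * y ^ 2 / x ^ β := by
      rw [mul_div_assoc, mul_div_assoc, Finset.sum_mul, Finset.sum_mul, ← Finset.sum_add_distrib]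
      refine Finset.sum_congr rfl fun R _ => ?_
      rw [hw]
      ring
    have h2 : (∑ R ∈ L, ((c R + t - 1 : ℕ) : ℝ) * R.natDegree) * y / x ≤ x ^ γ := by
      rw [div_le_iff₀ hn0]
      exact hsum₁.trans (by gcongr)
    have h3 : (∑ R ∈ L, ((c R + t - 1 : ℕ) : ℝ) * Real.log (intMahler R)) * y ^ 2 / x ^ β ≤
        2 * x ^ γ := by
      rw [div_le_iff₀ hβ0]
      calc _ ≤ _ := hsum₂
        _ ≤ x ^ γ * (2 * x ^ β) := by gcongr
        _ = 2 * x ^ γ * x ^ β := by ring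
    rw [h1]
    linarith
  have hlogR : ∀ R ∈ L, 0 ≤ Real.log (intMahler R) := fun R hR =>
    Real.log_nonneg (one_le_intMahler (hL R hR).1.ne_zero)
  have hdegR : ∀ R ∈ L, (1 : ℝ) ≤ R.natDegree := fun R hR => by
    obtain ⟨hirr, -, α, hα, -⟩ := hL R hR
    exact_mod_cast Nat.one_le_iff_ne_zero.2 (hirr.natDegree_ne_zero_of_aeval_eq_zero hα)
  have hwpos : ∀ R ∈ L, 0 < w R := fun R hR => by
    have h1 := hlogR R hR
    have h2 : 0 < (R.natDegree : ℝ) := by linarith [hdegR R hR]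
    rw [hw]
    positivity
  have hγ0 := hpos γ
  obtain ⟨R, hR, hRsmall⟩ := exists_le_exp_of_prod_pow_le L
    (f := fun R => ∏ i ∈ I, ‖aeval (ξ ^ i) R‖) (w := w) (k := c) (U := I.card * x ^ ν / 8)
    (W := 4 * x ^ γ)
    (by
      have := (hpos (μ - ε)).trans_le hIcard
      have := hpos ν
      positivity)
    (by positivity)
    (by
      refine lt_of_le_of_lt (Finset.sum_le_sum fun R hR => ?_) (hwsum.trans_lt (by linarith))
      have := (hwpos R hR).le
      gcongr
      omega)
    (by rw [hc]; exact hQsmall)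
  have hRprim : R.IsPrimitive := isPrimitive_of_dvd hQ (hRQ R hR)
  have hw₁ : w R ≤ 6 * x ^ (γ - τ) := by
    have h1 : ((c R + t - 1 : ℕ) : ℝ) * w R ≤ 3 * x ^ γ :=
      (Finset.single_le_sum (f := fun R => ((c R + t - 1 : ℕ) : ℝ) * w R)
        (fun R hR => by have := (hwpos R hR).le; positivity) hR).trans hwsum
    have h2 : (t : ℝ) ≤ ((c R + t - 1 : ℕ) : ℝ) := by
      have := (hL R hR).2.1
      exact_mod_cast (by omega : t ≤ c R + t - 1)
    have h3 : x ^ τ / 2 * w R ≤ 3 * x ^ γ := by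
      refine le_trans ?_ h1
      have := (hwpos R hR).le
      gcongr
      linarith
    have h4 : x ^ (γ - τ) * x ^ τ = x ^ γ := by rw [hadd, sub_add_cancel]
    have h5 : w R * x ^ τ ≤ 6 * x ^ (γ - τ) * x ^ τ := by linarith
    exact le_of_mul_le_mul_right h5 (hpos τ)
  obtain ⟨k, hk0, hk1, hk2, hk3⟩ := exists_pow_of_small hRprim (I := I) (ξ := ξ) (w := w R)
    (K := x ^ (2 * γ - τ - ε)) (Z := I.card * x ^ ν / 8 / (4 * x ^ γ)) (a := x / y)
    (b := x ^ β / y ^ 2)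
    (hwpos R hR) (hpos _) (by have := hpos ν; positivity) hRsmall (by positivity) (by positivity)
    (by
      have h1 := hlogR R hR
      rw [hw]
      calc (R.natDegree : ℝ) = R.natDegree * (y / x) * (x / y) := by field_simp
        _ ≤ (R.natDegree * (y / x) + Real.log (intMahler R) * (y ^ 2 / x ^ β)) * (x / y) := by
          gcongr
          exact le_add_of_nonneg_right (by positivity))
    (by
      rw [hw]
      calc Real.log (intMahler R)
          = Real.log (intMahler R) * (y ^ 2 / x ^ β) * (x ^ β / y ^ 2) := by field_simp
        _ ≤ (R.natDegree * (y / x) + Real.log (intMahler R) * (y ^ 2 / x ^ β)) *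
            (x ^ β / y ^ 2) := by
          gcongr
          exact le_add_of_nonneg_left (by positivity))
  have hKw : x ^ (2 * γ - τ - ε) + w R ≤ 7 * x ^ (γ - τ) := by
    linarith [hmono (by linarith : 2 * γ - τ - ε ≤ γ - τ)]
  have hxy : x / y = x ^ (1 - (σ - μ) + γ) := by
    rw [← hy, div_eq_iff (hpos _).ne', hadd]
    conv_lhs => rw [← hx1']
    ring_nf
  have hxβy : x ^ β / y ^ 2 = x ^ (β - 2 * (σ - μ) + 2 * γ) := by
    rw [← hy, div_eq_iff (pow_pos (hpos _) 2).ne', sq, hadd, hadd]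
    ring_nf
  have h14 : 14 ≤ x ^ γ := by linarith
  refine ⟨R ^ k, ⟨R, (hL R hR).1, k, hk0, rfl⟩, ?_, ?_, ?_⟩
  · calc ((R ^ k).natDegree : ℝ) ≤ (x ^ (2 * γ - τ - ε) + w R) * (x / y) := hk1
      _ ≤ 7 * x ^ (γ - τ) * x ^ (1 - (σ - μ) + γ) := by rw [hxy]; gcongr
      _ ≤ x ^ γ * x ^ (γ - τ) * x ^ (1 - (σ - μ) + γ) := by gcongr; linarith
      _ = x ^ (1 - (σ - μ) - τ + 3 * γ) := by rw [hadd, hadd]; ring_nf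
      _ ≤ _ := hmono (by linarith)
  · have h1 : x ^ (1 - (σ - μ) + γ) ≤ x ^ (β - 2 * (σ - μ) + 2 * γ) := hmono (by linarith)
    calc Real.log (polyHeight (R ^ k)) ≤ (x ^ (2 * γ - τ - ε) + w R) * (x / y + x ^ β / y ^ 2) :=
          hk2
      _ ≤ 7 * x ^ (γ - τ) * (2 * x ^ (β - 2 * (σ - μ) + 2 * γ)) := by
          rw [hxy, hxβy]
          gcongr
          linarith
      _ = 14 * x ^ (γ - τ) * x ^ (β - 2 * (σ - μ) + 2 * γ) := by ring
      _ ≤ x ^ γ * x ^ (γ - τ) * x ^ (β - 2 * (σ - μ) + 2 * γ) := by gcongr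
      _ = x ^ (β - 2 * (σ - μ) - τ + 4 * γ) := by rw [hadd, hadd]; ring_nf
      _ ≤ _ := hmono (by linarith)
  · refine hk3.trans (Real.exp_le_exp.2 (neg_le_neg ?_))
    have h32 : 32 ≤ x ^ γ := by linarith
    calc x ^ (ν + μ - τ - 2 * ε) = x ^ (μ - ε) * x ^ ν * x ^ (-τ - ε) := by
          rw [hadd, hadd]; ring_nf
      _ = 32 * (x ^ (μ - ε) * x ^ ν / 8 / (4 * x ^ γ)) * (x ^ γ * x ^ (-τ - ε)) := by
          field_simp
          norm_num
      _ ≤ x ^ γ * (I.card * x ^ ν / 8 / (4 * x ^ γ)) * (x ^ γ * x ^ (-τ - ε)) := by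
          have := hpos ν
          have := hpos (-τ - ε)
          gcongr
      _ = I.card * x ^ ν / 8 / (4 * x ^ γ) * (x ^ γ * (x ^ γ * x ^ (-τ - ε))) := by ring
      _ = I.card * x ^ ν / 8 / (4 * x ^ γ) * x ^ (2 * γ - τ - ε) := by
          rw [hadd, hadd]; ring_nf
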